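/- Let $n\ge 0$, let $S=\mathbb C[X_1,\dots,X_n]$ with its standard grading, and let $W$ be a finite group acting on $S$ by degree-preserving $\mathbb C$-algebra automorphisms. Assume that every finite-dimensional complex representation of $W$ is isomorphic to its dual, and that $S/(S\cdot S^W_{>0})$ is finite-dimensional, where $S\cdot S^W_{>0}$ is the ideal generated by the homogeneous $W$-invariants of positive degree. Let $A=S*W$ be the skew group algebra, that is, $S\otimes_{\mathbb C}\mathbb CW$ with $(s\otimes w)(s'\otimes w')=s\,w(s')\otimes ww'$, graded by $A_i=S_i\otimes\mathbb CW$. Let $\mathrm{Irr}\,W$ be the set of isomorphism classes of irreducible complex representations of $W$. For $\lambda\in\mathrm{Irr}\,W$ let $P_\lambda=S\otimes_{\mathbb C}\lambda$, with $(P_\lambda)_i=S_i\otimes\lambda$, and let $L_\lambda$ be the graded $A$-module equal to $\lambda$ in degree $0$, on which $S_{>0}$ acts by zero. For graded $A$-modules, $M\langle d\rangle$ is the shift $(M\langle d\rangle)_i=M_{i-d}$, $\mathrm{Hom}_A(M,N)_d$ is the space of $A$-module maps $f$ with $f(M_i)\subseteq N_{i+d}$ for all $i$, and $\mathrm{Ext}^i_A(M,N)_d$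 is the group $\mathrm{Ext}^i(M,N\langle -d\rangle)$ in the category of graded $A$-modules (with $\mathrm{Ext}^0=\mathrm{Hom}$). For a finite-dimensional graded $A$-module $M$, the dual $M^*=\mathrm{Hom}_{\mathbb C}(M,\mathbb C)$ has the grading $(M^*)_i=\mathrm{Hom}_{\mathbb C}(M_{-i},\mathbb C)$ and the left action $((s\otimes w)f)(m)=f((w^{-1}(s)\otimes w^{-1})m)$. A graded module $M$ is filtered by a family $F=\{F_\alpha\}$ of graded modules if there is a (possibly infinite) sequence of graded submodules $M=M^0\supseteq M^1\supseteq\cdots$ with $\bigcap_k M^k=0$, each factor $M^{k-1}/M^k$ of which is zero or isomorphic, as a graded module, to $F_\alpha\langle d\rangle$ for some $\alpha$ and some $d\in\mathbb Z$. For a preorder $\precsim$ on $\mathrm{Irr}\,W$ write $\lambda\prec\mu$ if $\lambda\precsim\mu$ and $\mu\not\precsim\lambda$, and put $$I_\lambda=\sum_{\mu\succsim\lambda,\ d>0,\ f\in\mathrm{Hom}_A(P_\mu,P_\lambda)_d}\mathrm{Im}\,f,\qquad \widetilde I_\lambda=\sum_{\mu\succ\lambda,\ d>0,\ f\in\mathrm{Hom}_A(P_\mu,P_\lambda)_d}\mathrm{Im}\,f,$$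 $$K_\lambda=P_\lambda/I_\lambda,\qquad \widetilde K_\lambda=P_\lambda/\widetilde I_\lambda ;$$ these are the trace quotient modules and the strict trace quotient modules of $\precsim$. Let $\precsim$ be a preorder on $\mathrm{Irr}\,W$ that satisfies the following three conditions. 1. (Orthogonality) $\mathrm{Ext}^i_A(\widetilde K_\lambda,K_\mu^*)_d\cong\mathbb C$ if $i=d=0$ and $\lambda=\mu$, and it is $0$ for all other $i\ge 0$, $d\in\mathbb Z$, $\lambda,\mu\in\mathrm{Irr}\,W$. 2. Each $P_\lambda$ is filtered by $\{\widetilde K_\mu\}_{\mu\in\mathrm{Irr}\,W}$. 3. Each $\widetilde K_\lambda$ is filtered by $\{K_\mu\}_{\mu\in\mathrm{Irr}\,W}$. Let $\precsim_K$ be the preorder on $\mathrm{Irr}\,W$ for which $\lambda\precsim_K\lambda'$ if and only if there is a sequence $\lambda=\lambda_0,\lambda_1,\dots,\lambda_l=\lambda'$ with $l\ge 0$ and $\mathrm{Ext}^1_A(K_{\lambda_{i-1}},L_{\lambda_i})\ne 0$ for $1\le i\le l$ (the ungraded extension group of $A$-modules). Then for every $\lambda\in\mathrm{Irr}\,W$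 $$I_\lambda=\sum_{\mu\succsim_K\lambda,\ d>0,\ f\in\mathrm{Hom}_A(P_\mu,P_\lambda)_d}\mathrm{Im}\,f,\qquad \widetilde I_\lambda=\sum_{\mu\succ_K\lambda,\ d>0,\ f\in\mathrm{Hom}_A(P_\mu,P_\lambda)_d}\mathrm{Im}\,f.$$ In particular, the trace quotient modules and the strict trace quotient modules of $\precsim_K$ are again $\{K_\lambda\}$ and $\{\widetilde K_\lambda\}$. -/

import Mathlib

open scoped TensorProduct

noncomputable section

namespace SkewTrace

/-! ### Modules with homogeneous parts over a graded `ℂ`-algebra -/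

/-- A left `A`-module together with its homogeneous parts `deg i`, `i ∈ ℤ`. It is a graded
`A`-module when it is the direct sum of the `deg i` and `A_i • deg j ⊆ deg (i + j)`; all the modules
below to which the notions of this file are applied are of this kind. -/
structure GrMod (A : Type) [Ring A] [Algebra ℂ A] where
  carrier : Type
  [addCommGroup : AddCommGroup carrier]
  [moduleC : Module ℂ carrier]
  [module : Module A carrier]
  [tower : IsScalarTower ℂ A carrier]
  deg : ℤ → Submodule ℂ carrier

attribute [instance] GrMod.addCommGroup GrMod.moduleC GrMod.module GrMod.tower

namespace GrMod

variable {A : Type} [Ring A] [Algebra ℂ A]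

instance : CoeSort (GrMod A) Type := ⟨GrMod.carrier⟩

/-- The shift `M⟨d⟩`, with `(M⟨d⟩)_i = M_{i-d}`. -/
def shift (M : GrMod A) (d : ℤ) : GrMod A where
  carrier := M
  deg i := M.deg (i - d)

/-- A submodule `N`, with `N_i = N ∩ M_i`. -/
def sub (M : GrMod A) (N : Submodule A M) : GrMod A where
  carrier := N
  deg i := (M.deg i).comap (N.subtype.restrictScalars ℂ)

/-- The quotient `M / N`, with `(M / N)_i` the image of `M_i`. -/
def quot (M : GrMod A) (N : Submodule A M) : GrMod A where
  carrier := M ⧸ N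
  deg i := (M.deg i).map (N.mkQ.restrictScalars ℂ)

/-- `N` is a graded submodule: it is spanned by its homogeneous elements. -/
def IsHomogeneous (M : GrMod A) (N : Submodule A M) : Prop :=
  N.restrictScalars ℂ ≤ ⨆ i : ℤ, N.restrictScalars ℂ ⊓ M.deg i

/-- Isomorphism of graded modules (of degree `0`). -/
def Iso (M N : GrMod A) : Prop :=
  ∃ e : M ≃ₗ[A] N, ∀ (i : ℤ) (x : M), e x ∈ N.deg i ↔ x ∈ M.deg i

/-- `Hom_A(M, N)_d`, the graded homomorphisms of degree `d`. -/
def homDeg (M N : GrMod A) (d : ℤ) : Submodule ℂ (M →ₗ[A] N) where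
  carrier := {f | ∀ (i : ℤ) (x : M), x ∈ M.deg i → f x ∈ N.deg (i + d)}
  add_mem' hf hg _ _ hx := (N.deg _).add_mem (hf _ _ hx) (hg _ _ hx)
  zero_mem' _ _ _ := (N.deg _).zero_mem
  smul_mem' c _ hf _ _ hx := (N.deg _).smul_mem c (hf _ _ hx)

/-! ### Filtrations -/

/-- The factor `N / N'` of two submodules `N' ⊆ N` of `M`. -/
def factor (M : GrMod A) (N N' : Submodule A M) : GrMod A :=
  (M.sub N).quot (N'.comap N.subtype)

/-- `N 0 ⊇ N 1 ⊇ ⋯` is a (possibly infinite) `F`-filtration of `M`: it consists of graded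
submodules, starts with `M`, is separable, and each of its factors is zero or isomorphic to a
shift of a member of the family `F`. -/
structure IsFiltration (M : GrMod A) {Λ : Type} (F : Λ → GrMod A)
    (N : ℕ → Submodule A M) : Prop where
  top : N 0 = ⊤
  anti : ∀ k, N (k + 1) ≤ N k
  homogeneous : ∀ k, M.IsHomogeneous (N k)
  separable : ⨅ k, N k = ⊥
  factors : ∀ k, Subsingleton (M.factor (N k) (N (k + 1))) ∨
    ∃ (α : Λ) (d : ℤ), (M.factor (N k) (N (k + 1))).Iso ((F α).shift d)

/-- `M` is filtered by the family `F`. -/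
def FilteredBy (M : GrMod A) {Λ : Type} (F : Λ → GrMod A) : Prop :=
  ∃ N : ℕ → Submodule A M, M.IsFiltration F N

/-! ### Graded extension groups

`Ext^i_A(M, N)_d` is the `i`-th cohomology of `Hom_A(X_•, N)_d` for the canonical resolution `X_•`
of `M` by graded free modules: `X_0` is free on the homogeneous elements of `M`, `X_1` is free on the
homogeneous elements of the kernel of `X_0 → M`, and so on. The grading of `A` is `𝒜`. -/

variable (𝒜 : ℤ → Submodule ℂ A)

/-- The graded free module `⨁ A⟨j⟩` over all pairs of `j ∈ ℤ` and `m ∈ M_j`. -/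
def free (M : GrMod A) : GrMod A where
  carrier := (Σ j : ℤ, M.deg j) →₀ A
  deg i :=
    { carrier := {f | ∀ p : Σ j : ℤ, M.deg j, f p ∈ 𝒜 (i - p.1)}
      add_mem' := fun hf hg p => (𝒜 _).add_mem (hf p) (hg p)
      zero_mem' := fun _ => (𝒜 _).zero_mem
      smul_mem' := fun c _ hf p => (𝒜 _).smul_mem c (hf p) }

/-- The natural map `free M → M`, sending the basis element of `m ∈ M_j` to `m`. -/
def cover (M : GrMod A) : M.free 𝒜 →ₗ[A] M :=
  Finsupp.linearCombination A (fun p : Σ j : ℤ, M.deg j => (p.2 : M))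

/-- The kernel of `free M → M`. -/
def syz (M : GrMod A) : GrMod A := (M.free 𝒜).sub (LinearMap.ker (M.cover 𝒜))

/-- Iterated syzygies. -/
def syzIter (M : GrMod A) : ℕ → GrMod A
  | 0 => M
  | i + 1 => (M.syzIter i).syz 𝒜

/-- The `i`-th term `X_i` of the canonical graded free resolution. -/
def res (M : GrMod A) (i : ℕ) : GrMod A := (M.syzIter 𝒜 i).free 𝒜

/-- The differential `X_{i+1} → X_i`. -/
def resD (M : GrMod A) (i : ℕ) : M.res 𝒜 (i + 1) →ₗ[A] M.res 𝒜 i :=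
  (LinearMap.ker ((M.syzIter 𝒜 i).cover 𝒜)).subtype ∘ₗ ((M.syzIter 𝒜 i).syz 𝒜).cover 𝒜

/-- Composition with the differential, `Hom_A(X_i, N) → Hom_A(X_{i+1}, N)`. -/
def precompD (M N : GrMod A) (i : ℕ) :
    (M.res 𝒜 i →ₗ[A] N) →ₗ[ℂ] (M.res 𝒜 (i + 1) →ₗ[A] N) where
  toFun f := f ∘ₗ M.resD 𝒜 i
  map_add' _ _ := rfl
  map_smul' _ _ := rfl

/-- Degree `d` cocycles in `Hom_A(X_i, N)`. -/
def cocycles (M N : GrMod A) (i : ℕ) (d : ℤ) : Submodule ℂ (M.res 𝒜 i →ₗ[A] N) :=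
  (M.res 𝒜 i).homDeg N d ⊓ LinearMap.ker (M.precompD 𝒜 N i)

/-- Degree `d` coboundaries in `Hom_A(X_i, N)`. -/
def coboundaries (M N : GrMod A) (i : ℕ) (d : ℤ) : Submodule ℂ (M.res 𝒜 i →ₗ[A] N) :=
  match i with
  | 0 => ⊥
  | i + 1 => ((M.res 𝒜 i).homDeg N d).map (M.precompD 𝒜 N i)

/-- `Ext^i_A(M, N)_d`, that is, `Ext^i(M, N⟨-d⟩)` in the category of graded `A`-modules. -/
abbrev gext (M N : GrMod A) (i : ℕ) (d : ℤ) : Type :=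
  M.cocycles 𝒜 N i d ⧸ (M.coboundaries 𝒜 N i d).submoduleOf (M.cocycles 𝒜 N i d)

/-- A graded module from an algebra homomorphism `A → End_ℂ(M)`. -/
def ofAlgHom (M : Type) [AddCommGroup M] [Module ℂ M] (φ : A →ₐ[ℂ] Module.End ℂ M)
    (deg : ℤ → Submodule ℂ M) : GrMod A :=
  letI : Module A M := Module.compHom M φ.toRingHom
  haveI : IsScalarTower ℂ A M :=
    ⟨fun c a m => show φ (c • a) m = c • φ a m by rw [map_smul]; rfl⟩
  { carrier := M, deg := deg }

end GrMod

/-! ### The irreducible representations of `W` -/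

/-- An irreducible representation of `W` on some `ℂ^dim`. -/
structure IrrRep (W : Type) [Group W] where
  dim : ℕ
  ρ : Representation ℂ W (Fin dim → ℂ)
  irreducible : ρ.IsIrreducible

/-- Isomorphism of irreducible representations. -/
instance IrrRep.setoid (W : Type) [Group W] : Setoid (IrrRep W) where
  r V V' := Nonempty (V.ρ.Equiv V'.ρ)
  iseqv :=
    { refl := fun V => ⟨.refl V.ρ⟩
      symm := fun ⟨e⟩ => ⟨e.symm⟩
      trans := fun ⟨e⟩ ⟨e'⟩ => ⟨e.trans e'⟩ }

/-- The set of isomorphism classes of irreducible complex representations of `W`. -/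
def Irr (W : Type) [Group W] : Type := Quotient (IrrRep.setoid W)

/-- A representative of an isomorphism class. -/
def Irr.rep {W : Type} [Group W] (lam : Irr W) : IrrRep W := Quotient.out lam

/-- Every finite dimensional complex representation of `W` is isomorphic to its dual. -/
def AllSelfDual (W : Type) [Group W] : Prop :=
  ∀ (V : Type) [AddCommGroup V] [Module ℂ V] [FiniteDimensional ℂ V] (ρ : Representation ℂ W V),
    Nonempty (ρ.Equiv ρ.dual)

/-! ### The skew group algebra -/

/-- The polynomial ring `S` in `n` variables. -/
abbrev PolyRing (n : ℕ) : Type := MvPolynomial (Fin n) ℂ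

/-- `S_i` for `i ∈ ℤ`. -/
def polyDeg (n : ℕ) (i : ℤ) : Submodule ℂ (PolyRing n) :=
  if 0 ≤ i then MvPolynomial.homogeneousSubmodule (Fin n) ℂ i.toNat else ⊥

/-- The action of `W` on `S` preserves the grading. -/
class GradedAction (n : ℕ) (W : Type) [Group W] [MulSemiringAction W (PolyRing n)] : Prop where
  isHomogeneous_smul : ∀ (w : W) (d : ℕ) (f : PolyRing n), f.IsHomogeneous d → (w • f).IsHomogeneous d

/-- The ideal of `S` generated by the homogeneous invariants of positive degree. -/
def invariantIdeal (n : ℕ) (W : Type) [Group W] [MulSemiringAction W (PolyRing n)] : Ideal (PolyRing n) :=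
  Ideal.span {f | (∀ w : W, w • f = f) ∧ ∃ d : ℕ, 0 < d ∧ f.IsHomogeneous d}

section Skew

variable (n : ℕ) (W : Type) [Group W] [MulSemiringAction W (PolyRing n)] [SMulCommClass W ℂ (PolyRing n)]

/-- The skew group algebra `A = S * W`. -/
abbrev Skew : Type := SkewMonoidAlgebra (PolyRing n) W

/-- `A_i = S_i ⊗ ℂW`. -/
def skewDeg (i : ℤ) : Submodule ℂ (Skew n W) where
  carrier := {a | ∀ w, a.coeff w ∈ polyDeg n i}
  add_mem' {a b} ha hb w := by
    rw [SkewMonoidAlgebra.coeff_add]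
    exact (polyDeg n i).add_mem (ha w) (hb w)
  zero_mem' _ := (polyDeg n i).zero_mem
  smul_mem' c a ha w := by
    rw [SkewMonoidAlgebra.coeff_smul]
    exact (polyDeg n i).smul_mem c (ha w)

variable {W}

/-- The action of `A` on `S ⊗ V`: `(s ⊗ w)(t ⊗ v) = s w(t) ⊗ w(v)`. -/
def projAction {V : Type} [AddCommGroup V] [Module ℂ V] (ρ : Representation ℂ W V) :
    Skew n W →ₐ[ℂ] Module.End ℂ (PolyRing n ⊗[ℂ] V) :=
  SkewMonoidAlgebra.liftNCAlgHom (Algebra.lsmul ℂ ℂ (PolyRing n ⊗[ℂ] V))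
    ((Representation.ofDistribMulAction ℂ W (PolyRing n)).tprod ρ) (by
      intro s w
      refine TensorProduct.ext' fun t v => ?_
      simp [TensorProduct.smul_tmul', Representation.ofDistribMulAction_apply_apply])

/-- The graded module `P_V = S ⊗ V`, with `(P_V)_i = S_i ⊗ V`. -/
def projMod {V : Type} [AddCommGroup V] [Module ℂ V] (ρ : Representation ℂ W V) :
    GrMod (Skew n W) :=
  GrMod.ofAlgHom (PolyRing n ⊗[ℂ] V) (projAction n ρ)
    (fun i => LinearMap.range ((polyDeg n i).subtype.rTensor V))

theorem aeval_zero_smul [GradedAction n W] (w : W) (f : PolyRing n) :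
    MvPolynomial.aeval (fun _ : Fin n => (0 : ℂ)) (w • f) =
      MvPolynomial.aeval (fun _ : Fin n => (0 : ℂ)) f := by
  have key : ∀ g : PolyRing n, MvPolynomial.aeval (fun _ : Fin n => (0 : ℂ)) g =
      MvPolynomial.constantCoeff g := fun g => by
    rw [MvPolynomial.aeval_zero']; rfl
  have hw : ∀ g : PolyRing n, w • g = Representation.ofDistribMulAction ℂ W (PolyRing n) w g :=
    fun _ => rfl
  have hpos : ∀ (d : ℕ) (g : PolyRing n), d ≠ 0 → g.IsHomogeneous d →
      MvPolynomial.constantCoeff g = 0 := fun d g hd hg => by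
    rw [MvPolynomial.constantCoeff_eq]
    exact hg.coeff_eq_zero (by simpa using hd.symm)
  rw [key, key]
  conv_lhs => rw [← MvPolynomial.sum_homogeneousComponent f]
  conv_rhs => rw [← MvPolynomial.sum_homogeneousComponent f]
  rw [hw, map_sum, map_sum, map_sum]
  refine Finset.sum_congr rfl fun d _ => ?_
  rw [← hw]
  have hd := MvPolynomial.homogeneousComponent_isHomogeneous d f
  by_cases h0 : d = 0
  · subst h0
    have hC : ∀ c : ℂ, w • (MvPolynomial.C c : PolyRing n) = MvPolynomial.C c :=
      fun c => smul_algebraMap w c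
    rw [MvPolynomial.homogeneousComponent_zero, hC]
  · rw [hpos d _ h0 hd, hpos d _ h0 (GradedAction.isHomogeneous_smul w d _ hd)]

/-- The action of `A` on `V` for which `S_{>0}` acts as zero. -/
def simpleAction [GradedAction n W] {V : Type} [AddCommGroup V] [Module ℂ V]
    (ρ : Representation ℂ W V) : Skew n W →ₐ[ℂ] Module.End ℂ V :=
  SkewMonoidAlgebra.liftNCAlgHom
    ((Algebra.ofId ℂ (Module.End ℂ V)).comp (MvPolynomial.aeval fun _ : Fin n => (0 : ℂ)))
    ρ (by
      intro s w
      have h := aeval_zero_smul n w s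
      simp only [AlgHom.comp_apply, h]
      exact Algebra.commutes _ _)

/-- The graded module `L_V`, which is `V` in degree `0`. -/
def simpleMod [GradedAction n W] {V : Type} [AddCommGroup V] [Module ℂ V]
    (ρ : Representation ℂ W V) : GrMod (Skew n W) :=
  GrMod.ofAlgHom V (simpleAction n ρ) (fun i => if i = 0 then ⊤ else ⊥)

variable {n}

/-- The right action of `A` on `Hom_ℂ(M, ℂ)`: `(f a)(m) = f(a m)`. -/
def dualRight (M : GrMod (Skew n W)) (a : Skew n W) : Module.End ℂ (Module.Dual ℂ M) :=
  Module.Dual.transpose (Algebra.lsmul ℂ ℂ M a)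

theorem dualRight_apply (M : GrMod (Skew n W)) (a : Skew n W) (f : Module.Dual ℂ M) (m : M) :
    dualRight M a f m = f (a • m) := rfl

theorem dualRight_mul (M : GrMod (Skew n W)) (a b : Skew n W) :
    dualRight M a * dualRight M b = dualRight M (b * a) := by
  ext f m
  rw [Module.End.mul_apply, dualRight_apply, dualRight_apply, dualRight_apply, mul_smul]

theorem dualRight_one (M : GrMod (Skew n W)) : dualRight M (1 : Skew n W) = 1 := by
  ext f m
  rw [dualRight_apply, one_smul, Module.End.one_apply]

/-- The left action of `A` on `Hom_ℂ(M, ℂ)`: `((s ⊗ w) f)(m) = f((w⁻¹(s) ⊗ w⁻¹) m)`. In other words,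
`s ∈ S` acts by `(s f)(m) = f(s m)` and `w ∈ W` by `(w f)(m) = f(w⁻¹ m)`. -/
def dualAction (M : GrMod (Skew n W)) : Skew n W →ₐ[ℂ] Module.End ℂ (Module.Dual ℂ M) :=
  SkewMonoidAlgebra.liftNCAlgHom
    { toFun := fun s => dualRight M (SkewMonoidAlgebra.single (1 : W) s)
      map_one' := by rw [SkewMonoidAlgebra.single_one_one, dualRight_one]
      map_mul' := fun s t => by
        rw [dualRight_mul, SkewMonoidAlgebra.single_mul_single, one_smul, mul_one, mul_comm]
      map_zero' := by
        ext f m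
        rw [SkewMonoidAlgebra.single_zero, dualRight_apply, zero_smul, map_zero]
        rfl
      map_add' := fun s t => by
        ext f m
        rw [SkewMonoidAlgebra.single_add, dualRight_apply, add_smul, map_add]
        rfl
      commutes' := fun c => by
        ext f m
        have h : SkewMonoidAlgebra.single (1 : W) (algebraMap ℂ (PolyRing n) c) =
            algebraMap ℂ (Skew n W) c := rfl
        rw [h, dualRight_apply, algebraMap_smul, map_smul]
        rfl }
    { toFun := fun w => dualRight M (SkewMonoidAlgebra.single w⁻¹ (1 : PolyRing n))
      map_one' := by rw [inv_one, SkewMonoidAlgebra.single_one_one, dualRight_one]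
      map_mul' := fun w v => by
        rw [dualRight_mul, SkewMonoidAlgebra.single_mul_single, smul_one, mul_one, mul_inv_rev] }
    (by
      intro s w
      change dualRight M _ * dualRight M _ = dualRight M _ * dualRight M _
      rw [dualRight_mul, dualRight_mul, SkewMonoidAlgebra.single_mul_single,
        SkewMonoidAlgebra.single_mul_single, inv_smul_smul, one_smul, one_mul, mul_one, mul_one,
        one_mul])

/-- The dual `M^* = Hom_ℂ(M, ℂ)` of a finite dimensional graded module, with
`(M^*)_i = Hom_ℂ(M_{-i}, ℂ)`. -/
def dual (M : GrMod (Skew n W)) : GrMod (Skew n W) :=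
  GrMod.ofAlgHom (Module.Dual ℂ M) (dualAction M) (fun i =>
    { carrier := {f | ∀ j : ℤ, j ≠ -i → ∀ m ∈ M.deg j, f m = 0}
      add_mem' := fun hf hg j hj m hm => by
        rw [LinearMap.add_apply, hf j hj m hm, hg j hj m hm, add_zero]
      zero_mem' := fun _ _ _ _ => rfl
      smul_mem' := fun c f hf j hj m hm => by
        rw [LinearMap.smul_apply, hf j hj m hm, smul_zero] })

/-! ### Trace quotient modules -/

variable (n)

/-- `P_λ`. -/
def P (lam : Irr W) : GrMod (Skew n W) := projMod n lam.rep.ρ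

/-- `L_λ`. -/
def L [GradedAction n W] (lam : Irr W) : GrMod (Skew n W) := simpleMod n lam.rep.ρ

/-- The strict part of a relation: `λ ≺ μ` if `λ ≾ μ` and not `λ ∼ μ`. -/
def strict {X : Type} (le : X → X → Prop) (x y : X) : Prop := le x y ∧ ¬ (le x y ∧ le y x)

/-- The sum of the images of all homomorphisms `P_μ → P_λ` of positive degree with `r λ μ`. -/
def trace (r : Irr W → Irr W → Prop) (lam : Irr W) : Submodule (Skew n W) (P n lam) :=
  ⨆ (mu : Irr W) (_ : r lam mu) (d : ℤ) (_ : 0 < d) (f ∈ (P n mu).homDeg (P n lam) d),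
    LinearMap.range f

/-- `I_λ` with respect to the preorder `le`. -/
def I (le : Irr W → Irr W → Prop) (lam : Irr W) : Submodule (Skew n W) (P n lam) :=
  trace n le lam

/-- `Ĩ_λ` with respect to the preorder `le`. -/
def Itilde (le : Irr W → Irr W → Prop) (lam : Irr W) : Submodule (Skew n W) (P n lam) :=
  trace n (strict le) lam

/-- The trace quotient module `K_λ = P_λ / I_λ`. -/
def K (le : Irr W → Irr W → Prop) (lam : Irr W) : GrMod (Skew n W) :=
  (P n lam).quot (I n le lam)

/-- The strict trace quotient module `K̃_λ = P_λ / Ĩ_λ`. -/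
def Ktilde (le : Irr W → Irr W → Prop) (lam : Irr W) : GrMod (Skew n W) :=
  (P n lam).quot (Itilde n le lam)

/-- The orthogonality condition and the two filtration conditions. -/
structure BHRConditions (le : Irr W → Irr W → Prop) : Prop where
  /-- `Ext^0_A(K̃_λ, K_λ^*)_0 = ℂ`. -/
  ext_self : ∀ lam : Irr W,
    Nonempty ((Ktilde n le lam).gext (skewDeg n W) (dual (K n le lam)) 0 0 ≃ₗ[ℂ] ℂ)
  /-- `Ext^i_A(K̃_λ, K_μ^*)_d = 0` unless `i = d = 0` and `λ = μ`. -/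
  ext_eq_zero : ∀ (lam mu : Irr W) (i : ℕ) (d : ℤ), ¬ (i = 0 ∧ d = 0 ∧ lam = mu) →
    Subsingleton ((Ktilde n le lam).gext (skewDeg n W) (dual (K n le mu)) i d)
  /-- Each `P_λ` is filtered by the strict trace quotient modules. -/
  filtered_P : ∀ lam : Irr W, (P n lam).FilteredBy (Ktilde n le)
  /-- Each `K̃_λ` is filtered by the trace quotient modules. -/
  filtered_Ktilde : ∀ lam : Irr W, (Ktilde n le lam).FilteredBy (K n le)

/-- The preorder `≾_K` determined by the trace quotient modules `K` of `le`: `λ ≾_K λ'` if there is a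
chain `λ = λ_0, …, λ_l = λ'`, `l ≥ 0`, with `Ext^1_A(K_{λ_{i-1}}, L_{λ_i}) ≠ 0` for `1 ≤ i ≤ l`. -/
def leK [GradedAction n W] (le : Irr W → Irr W → Prop) : Irr W → Irr W → Prop :=
  Relation.ReflTransGen fun lam mu =>
    Nontrivial (CategoryTheory.Abelian.Ext (ModuleCat.of (Skew n W) (K n le lam))
      (ModuleCat.of (Skew n W) (L n mu)) 1)

end Skew

end SkewTrace

end

open SkewTrace

noncomputable section

namespace SkewTrace

/-! The ungraded group `Ext^1(K_λ, L_ν)` is read off from the head of `I_λ`. Since `P_λ` is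
projective and every map from `P_λ` to a simple `L_ν` kills `I_λ`, this group is nonzero exactly
when `I_λ` has a nonzero map to `L_ν`. The images generating `I_λ` come from modules `P_ν` with `λ ≾
ν`, so `≾_K` is contained in `≾` (`le_of_leK`). Conversely the head of `I_λ` generates `I_λ`, degree
by degree (`exists_head`), so the labels `ν` with `λ ≾_K ν` already suffice. This gives the equality
for `I_λ` without the three conditions.

For `Ĩ_λ ⊆ trace` of `≻_K`, pull the filtration of `K̃_λ` by modules `K_κ` back to `P_λ`. Passing
from one term to the next creates a new simple quotient `L_ν` only if `Ext^1(K_κ, L_ν) ≠ 0`, so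
inductively all simple quotients of all terms have labels above `λ` for `≾_K`
(`leK_of_pullback_hom`). In bounded degrees a late term agrees with `Ĩ_λ`, whose own simple
quotients lie strictly above `λ` for `≾`; strictness then passes to `≾_K`.

The reverse inclusion needs a symmetry. Orthogonality makes `Hom(-, K_ν^*)` count the factors `K̃_ν`
of `P_λ`. Together with self-duality this gives the reciprocity `(P_λ : K̃_ν⟨d⟩) = dim Hom(P_λ,
K_ν)_d` (`BHRConditions.mult_eq_homDim`). Collected in power series, the matrix of graded dimensions
of `Hom(P_μ, P_λ)` factors as `kᵀ Ω k`, where `Ω` holds the multiplicities `(K̃_λ : K_μ⟨d⟩)` and `k`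
is invertible. Self-duality makes the left side symmetric, hence `Ω` is symmetric
(`BHRConditions.mult_symm`).

Now let `λ ≺_K μ` and suppose that a map `P_μ → P_λ` of positive degree is nonzero modulo `Ĩ_λ`.
Then `λ ∼ μ` for `≾`, and some factor `K_κ` of `K̃_λ` receives a nonzero map from `P_μ`. Comparing
`κ` with `λ` and `μ` forces `κ = μ`. By symmetry `K_λ` is a factor of `K̃_μ`, hence `μ ≾_K λ`, a
contradiction. -/

/-- A linear map vanishing on the kernel of a surjection factors through it. -/
theorem exists_comp_eq_of_ker_le {R X Y Z : Type*} [Ring R] [AddCommGroup X] [AddCommGroup Y]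
    [AddCommGroup Z] [Module R X] [Module R Y] [Module R Z] (s : X →ₗ[R] Y) (t : X →ₗ[R] Z)
    (hs : Function.Surjective s) (h : LinearMap.ker s ≤ LinearMap.ker t) :
    ∃ u : Y →ₗ[R] Z, u ∘ₗ s = t := by
  refine ⟨(LinearMap.ker s).liftQ t h ∘ₗ (s.quotKerEquivOfSurjective hs).symm.toLinearMap, ?_⟩
  ext x
  have : (s.quotKerEquivOfSurjective hs).symm (s x) = (LinearMap.ker s).mkQ x := by
    rw [LinearEquiv.symm_apply_eq]; rfl
  simp [this]

/-! ### Graded modules by means of homogeneous projections -/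

namespace GrMod

variable {A : Type} [Ring A] [Algebra ℂ A] {𝒜 : ℤ → Submodule ℂ A}

/-- `M` is a graded module: the direct sum of its homogeneous parts, expressed by means of the
projections to them, with `A_i • M_j ⊆ M_{i+j}`. -/
structure IsGraded (𝒜 : ℤ → Submodule ℂ A) (M : GrMod A) : Prop where
  smul_mem : ∀ {i j : ℤ} {a : A} {x : M}, a ∈ 𝒜 i → x ∈ M.deg j → a • x ∈ M.deg (i + j)
  iSup_deg : ⨆ i, M.deg i = ⊤
  exists_proj : ∃ p : ℤ → M →ₗ[ℂ] M, (∀ i x, p i x ∈ M.deg i) ∧ (∀ i, ∀ x ∈ M.deg i, p i x = x) ∧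
    ∀ i j, i ≠ j → ∀ x ∈ M.deg i, p j x = 0

open Classical in
/-- The projection to the part of degree `i` (junk if `M` is not graded). -/
def proj (M : GrMod A) (i : ℤ) : M →ₗ[ℂ] M :=
  if h : ∃ p : ℤ → M →ₗ[ℂ] M, (∀ i x, p i x ∈ M.deg i) ∧ (∀ i, ∀ x ∈ M.deg i, p i x = x) ∧
    ∀ i j, i ≠ j → ∀ x ∈ M.deg i, p j x = 0 then h.choose i else 0

namespace IsGraded

variable {M N : GrMod A}

theorem proj_spec (hM : M.IsGraded 𝒜) : (∀ i x, M.proj i x ∈ M.deg i) ∧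
    (∀ i, ∀ x ∈ M.deg i, M.proj i x = x) ∧ ∀ i j, i ≠ j → ∀ x ∈ M.deg i, M.proj j x = 0 := by
  have h := hM.exists_proj
  have : M.proj = h.choose := by
    funext i
    rw [proj, dif_pos h]
  rw [this]
  exact h.choose_spec

theorem proj_mem (hM : M.IsGraded 𝒜) (i : ℤ) (x : M) : M.proj i x ∈ M.deg i := hM.proj_spec.1 i x

theorem proj_of_mem (hM : M.IsGraded 𝒜) {i : ℤ} {x : M} (hx : x ∈ M.deg i) : M.proj i x = x :=
  hM.proj_spec.2.1 i x hx

theorem proj_of_ne (hM : M.IsGraded 𝒜) {i j : ℤ} (h : i ≠ j) {x : M} (hx : x ∈ M.deg i) :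
    M.proj j x = 0 :=
  hM.proj_spec.2.2 i j h x hx

theorem homogeneous_induction (hM : M.IsGraded 𝒜) {p : M → Prop} (x : M)
    (deg : ∀ i, ∀ x ∈ M.deg i, p x) (zero : p 0) (add : ∀ x y, p x → p y → p (x + y)) : p x :=
  Submodule.iSup_induction M.deg (motive := p) (by rw [hM.iSup_deg]; trivial) deg zero add

theorem exists_sum_proj (hM : M.IsGraded 𝒜) (x : M) :
    ∃ s : Finset ℤ, x = ∑ i ∈ s, M.proj i x := by
  suffices h : ∃ s : Finset ℤ, ∀ t, s ⊆ t → x = ∑ i ∈ t, M.proj i x from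
    ⟨h.choose, h.choose_spec _ le_rfl⟩
  refine hM.homogeneous_induction (p := fun x => ∃ s : Finset ℤ, ∀ t, s ⊆ t →
    x = ∑ i ∈ t, M.proj i x) x (fun i x hx => ?_) ?_ ?_
  · refine ⟨{i}, fun t ht => ?_⟩
    rw [Finset.sum_eq_single_of_mem i (ht (by simp)) (fun j _ hj => hM.proj_of_ne hj.symm hx),
      hM.proj_of_mem hx]
  · exact ⟨∅, fun t _ => by simp⟩
  · rintro x y ⟨s, hs⟩ ⟨t, ht⟩
    classical
    refine ⟨s ∪ t, fun u hu => ?_⟩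
    simp_rw [map_add, Finset.sum_add_distrib]
    rw [← hs u (Finset.union_subset_left hu), ← ht u (Finset.union_subset_right hu)]

theorem mem_of_proj_mem (hM : M.IsGraded 𝒜) (U : Submodule ℂ M) {x : M}
    (h : ∀ i, M.proj i x ∈ U) : x ∈ U := by
  obtain ⟨s, hs⟩ := hM.exists_sum_proj x
  rw [hs]
  exact U.sum_mem fun i _ => h i

/-- The elementwise form of homogeneity, which passes easily to submodules, quotients, kernels and
images. -/
theorem isHomogeneous_iff (hM : M.IsGraded 𝒜) {U : Submodule A M} :
    M.IsHomogeneous U ↔ ∀ x ∈ U, ∀ i, M.proj i x ∈ U := by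
  constructor
  · intro h x hx i
    refine Submodule.iSup_induction _ (motive := fun x => M.proj i x ∈ U) (h hx) ?_ ?_ ?_
    · rintro j x ⟨hxU, hxj⟩
      by_cases hij : j = i
      · subst hij
        rw [hM.proj_of_mem hxj]
        exact hxU
      · rw [hM.proj_of_ne hij hxj]
        exact U.zero_mem
    · rw [map_zero]; exact U.zero_mem
    · intro x y hx hy
      rw [map_add]; exact U.add_mem hx hy
  · intro h x hx
    exact hM.mem_of_proj_mem _ fun i => Submodule.mem_iSup_of_mem i ⟨h x hx i, hM.proj_mem i x⟩

theorem map_proj (hM : M.IsGraded 𝒜) (hN : N.IsGraded 𝒜) {d : ℤ} {f : M →ₗ[A] N}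
    (hf : f ∈ M.homDeg N d) (i : ℤ) (x : M) : f (M.proj i x) = N.proj (i + d) (f x) := by
  refine hM.homogeneous_induction (p := fun x => f (M.proj i x) = N.proj (i + d) (f x)) x
    (fun j x hx => ?_) (by simp only [map_zero]) ?_
  · by_cases h : j = i
    · subst h
      rw [hM.proj_of_mem hx, hN.proj_of_mem (hf _ _ hx)]
    · rw [hM.proj_of_ne h hx, hN.proj_of_ne (by omega) (hf _ _ hx), map_zero]
  · intro x y hx hy
    simp only [map_add, hx, hy]

theorem proj_smul (hM : M.IsGraded 𝒜) {j : ℤ} {a : A} (ha : a ∈ 𝒜 j) (i : ℤ) (x : M) :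
    M.proj i (a • x) = a • M.proj (i - j) x := by
  refine hM.homogeneous_induction (p := fun x => M.proj i (a • x) = a • M.proj (i - j) x) x
    (fun k x hx => ?_) (by simp only [smul_zero, map_zero]) ?_
  · by_cases h : k = i - j
    · subst h
      rw [hM.proj_of_mem hx, hM.proj_of_mem (by simpa using hM.smul_mem ha hx)]
    · rw [hM.proj_of_ne h hx, hM.proj_of_ne (by omega) (hM.smul_mem ha hx), smul_zero]
  · intro x y hx hy
    simp only [smul_add, map_add, hx, hy]

theorem sub (hM : M.IsGraded 𝒜) {U : Submodule A M} (hU : M.IsHomogeneous U) :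
    (M.sub U).IsGraded 𝒜 where
  smul_mem ha hx := hM.smul_mem ha hx
  iSup_deg := by
    rw [hM.isHomogeneous_iff] at hU
    rw [eq_top_iff]
    rintro ⟨x, hx⟩ -
    obtain ⟨s, hs⟩ := hM.exists_sum_proj x
    have : (⟨x, hx⟩ : M.sub U) = ∑ i ∈ s, (⟨M.proj i x, hU x hx i⟩ : M.sub U) := by
      apply Subtype.ext
      refine hs.trans ?_
      exact (map_sum U.subtype (fun i => (⟨M.proj i x, hU x hx i⟩ : U)) s).symm
    change (⟨x, hx⟩ : M.sub U) ∈ (⨆ i, (M.sub U).deg i)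
    rw [this]
    exact Submodule.sum_mem _ fun i _ =>
      Submodule.mem_iSup_of_mem (p := (M.sub U).deg) i (hM.proj_mem i x)
  exists_proj := by
    rw [hM.isHomogeneous_iff] at hU
    let p (i : ℤ) : (M.sub U) →ₗ[ℂ] (M.sub U) :=
      { toFun := fun x => ⟨M.proj i x.1, hU x.1 x.2 i⟩
        map_add' := fun x y => Subtype.ext (map_add (M.proj i) x.1 y.1)
        map_smul' := fun c x => Subtype.ext (map_smul (M.proj i) c x.1) }
    refine ⟨p, fun i x => hM.proj_mem i _, fun i x hx => ?_, fun i j h x hx => ?_⟩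
    · exact Subtype.ext (hM.proj_of_mem hx)
    · exact Subtype.ext (hM.proj_of_ne h hx)

theorem quot (hM : M.IsGraded 𝒜) {U : Submodule A M} (hU : M.IsHomogeneous U) :
    (M.quot U).IsGraded 𝒜 where
  smul_mem {i j a x} ha hx := by
    obtain ⟨y, hy, rfl⟩ := hx
    exact ⟨a • y, hM.smul_mem ha hy, map_smul U.mkQ a y⟩
  iSup_deg := by
    change ⨆ i, (M.deg i).map (U.mkQ.restrictScalars ℂ) = ⊤
    rw [← Submodule.map_iSup, hM.iSup_deg, Submodule.map_top, LinearMap.range_eq_top]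
    exact U.mkQ_surjective
  exists_proj := by
    rw [hM.isHomogeneous_iff] at hU
    -- A homogeneous submodule is stable under the projections, so they descend to the quotient.
    have (i : ℤ) : ∃ p : (M ⧸ U) →ₗ[ℂ] (M ⧸ U),
        p ∘ₗ U.mkQ.restrictScalars ℂ = U.mkQ.restrictScalars ℂ ∘ₗ M.proj i := by
      refine exists_comp_eq_of_ker_le _ _ U.mkQ_surjective fun x hx => ?_
      have hx : x ∈ U := by simpa using hx
      simpa using hU x hx i
    choose p hp using this
    have hp' (i : ℤ) (x : M) : p i (U.mkQ x) = U.mkQ (M.proj i x) := LinearMap.congr_fun (hp i) x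
    refine ⟨p, fun i x => ?_, ?_, ?_⟩
    · obtain ⟨x, rfl⟩ := U.mkQ_surjective x
      exact ⟨M.proj i x, hM.proj_mem i x, (hp' i x).symm⟩
    · rintro i _ ⟨x, hx, rfl⟩
      exact (hp' i x).trans (by rw [hM.proj_of_mem hx]; rfl)
    · rintro i j h _ ⟨x, hx, rfl⟩
      exact (hp' j x).trans (by rw [hM.proj_of_ne h hx, map_zero]; rfl)

theorem isHomogeneous_ker (hM : M.IsGraded 𝒜) (hN : N.IsGraded 𝒜) {d : ℤ} {f : M →ₗ[A] N}
    (hf : f ∈ M.homDeg N d) : M.IsHomogeneous (LinearMap.ker f) := by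
  rw [hM.isHomogeneous_iff]
  intro x hx i
  rw [LinearMap.mem_ker] at hx ⊢
  rw [hM.map_proj hN hf, hx, map_zero]

theorem isHomogeneous_range (hM : M.IsGraded 𝒜) (hN : N.IsGraded 𝒜) {d : ℤ} {f : M →ₗ[A] N}
    (hf : f ∈ M.homDeg N d) : N.IsHomogeneous (LinearMap.range f) := by
  rw [hN.isHomogeneous_iff]
  rintro _ ⟨x, rfl⟩ i
  exact ⟨M.proj (i - d) x, by rw [hM.map_proj hN hf, sub_add_cancel]⟩

end IsGraded

theorem isHomogeneous_iSup (M : GrMod A) {ι : Sort*} {U : ι → Submodule A M}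
    (h : ∀ k, M.IsHomogeneous (U k)) : M.IsHomogeneous (⨆ k, U k) := by
  intro x hx
  refine Submodule.iSup_induction U (motive := fun x => x ∈ ⨆ i : ℤ,
    (⨆ k, U k).restrictScalars ℂ ⊓ M.deg i) hx (fun k x hx => ?_) (Submodule.zero_mem _)
    fun x y hx hy => Submodule.add_mem _ hx hy
  refine (iSup_mono fun i => inf_le_inf_right _ ?_ :
    (⨆ i : ℤ, (U k).restrictScalars ℂ ⊓ M.deg i) ≤ _) (h k hx)
  exact fun y hy => Submodule.mem_iSup_of_mem k hy

/-! ### The canonical resolution in low degrees -/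

/-- `A` as a module over itself, with the grading `𝒜`. -/
def regular (𝒜 : ℤ → Submodule ℂ A) : GrMod A where
  carrier := A
  deg := 𝒜

section Free

variable (𝒜) (M : GrMod A) {E : GrMod A}

/-- The multiple `a` of a basis element of `free M`. -/
def freeSingle (p : Σ j : ℤ, M.deg j) : A →ₗ[A] M.free 𝒜 :=
  (Finsupp.lsingle p : A →ₗ[A] (Σ j : ℤ, M.deg j) →₀ A)

/-- The linear map on `free M` with prescribed values on the basis. -/
def freeLift (v : (Σ j : ℤ, M.deg j) → E) : M.free 𝒜 →ₗ[A] E :=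
  Finsupp.linearCombination A v

/-- The coordinates on `free M`. -/
def freeCoord (p : Σ j : ℤ, M.deg j) : M.free 𝒜 →ₗ[A] A :=
  (Finsupp.lapply p : ((Σ j : ℤ, M.deg j) →₀ A) →ₗ[A] A)

variable {M}

theorem freeLift_freeSingle (v : (Σ j : ℤ, M.deg j) → E) (p) (a : A) :
    M.freeLift 𝒜 v (M.freeSingle 𝒜 p a) = a • v p :=
  Finsupp.linearCombination_single A a p

theorem cover_freeSingle (p : Σ j : ℤ, M.deg j) (a : A) :
    M.cover 𝒜 (M.freeSingle 𝒜 p a) = a • (p.2 : M) :=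
  Finsupp.linearCombination_single A a p

theorem free_induction {q : M.free 𝒜 → Prop} (x : M.free 𝒜) (zero : q 0)
    (add : ∀ x y, q x → q y → q (x + y)) (single : ∀ p a, q (M.freeSingle 𝒜 p a)) : q x :=
  Finsupp.induction_linear (motive := q) x zero add single

theorem free_hom_ext {f g : M.free 𝒜 →ₗ[A] E}
    (h : ∀ p, f (M.freeSingle 𝒜 p 1) = g (M.freeSingle 𝒜 p 1)) : f = g :=
  Finsupp.lhom_ext' fun p => LinearMap.ext_ring (h p)

theorem free_ext {x y : M.free 𝒜} (h : ∀ p, M.freeCoord 𝒜 p x = M.freeCoord 𝒜 p y) : x = y :=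
  Finsupp.ext h

theorem mem_free_deg {i : ℤ} {x : M.free 𝒜} :
    x ∈ (M.free 𝒜).deg i ↔ ∀ p : Σ j : ℤ, M.deg j, M.freeCoord 𝒜 p x ∈ 𝒜 (i - p.1) := Iff.rfl

theorem freeCoord_freeSingle_self (p : Σ j : ℤ, M.deg j) (a : A) :
    M.freeCoord 𝒜 p (M.freeSingle 𝒜 p a) = a := Finsupp.single_eq_same

theorem freeCoord_freeSingle_of_ne {p q : Σ j : ℤ, M.deg j} (h : p ≠ q) (a : A) :
    M.freeCoord 𝒜 q (M.freeSingle 𝒜 p a) = 0 := Finsupp.single_eq_of_ne h.symm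

variable {𝒜}

theorem freeSingle_mem_deg {i : ℤ} {a : A} (ha : a ∈ 𝒜 i) (p : Σ j : ℤ, M.deg j) :
    M.freeSingle 𝒜 p a ∈ (M.free 𝒜).deg (i + p.1) := by
  rw [mem_free_deg]
  intro q
  by_cases h : p = q
  · subst h
    rwa [freeCoord_freeSingle_self, add_sub_cancel_right]
  · rw [freeCoord_freeSingle_of_ne 𝒜 h]
    exact Submodule.zero_mem _

theorem freeLift_mem_deg (hE : E.IsGraded 𝒜) {e : ℤ}
    (v : (Σ j : ℤ, M.deg j) → E) (hv : ∀ p, v p ∈ E.deg (p.1 + e)) {i : ℤ} {x : M.free 𝒜}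
    (hx : x ∈ (M.free 𝒜).deg i) : M.freeLift 𝒜 v x ∈ E.deg (i + e) := by
  change (x : (Σ j : ℤ, M.deg j) →₀ A).sum (fun p a => a • v p) ∈ _
  refine Submodule.sum_mem _ fun p _ => ?_
  have := hE.smul_mem (hx p) (hv p)
  rwa [← add_assoc, sub_add_cancel] at this

theorem IsGraded.free (hA : (regular 𝒜).IsGraded 𝒜) (M : GrMod A) : (M.free 𝒜).IsGraded 𝒜 where
  smul_mem {i j a x} ha hx p := by
    have := hA.smul_mem ha (hx p)
    rwa [← add_sub_assoc] at this
  iSup_deg := by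
    rw [eq_top_iff]
    rintro x -
    refine free_induction 𝒜 x
      (Submodule.zero_mem _) (fun x y hx hy => Submodule.add_mem _ hx hy)
      fun p a => ?_
    refine hA.homogeneous_induction (p := fun a => M.freeSingle 𝒜 p a ∈ ⨆ i, (M.free 𝒜).deg i) a
      (fun i a ha => Submodule.mem_iSup_of_mem (i + p.1)
        (freeSingle_mem_deg (A := A) (a := a) ha p)) ?_
      fun a b ha hb => ?_
    · have : M.freeSingle 𝒜 p (0 : A) ∈ ⨆ i, (M.free 𝒜).deg i := by
        rw [map_zero]
        exact Submodule.zero_mem _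
      exact this
    · have : ∀ a b : A, M.freeSingle 𝒜 p a ∈ (⨆ i, (M.free 𝒜).deg i) →
          M.freeSingle 𝒜 p b ∈ (⨆ i, (M.free 𝒜).deg i) →
          M.freeSingle 𝒜 p (a + b) ∈ ⨆ i, (M.free 𝒜).deg i := fun a b ha hb => by
        rw [map_add]
        exact Submodule.add_mem _ ha hb
      exact this a b ha hb
  exists_proj := by
    let r (i : ℤ) : A →ₗ[ℂ] A := (regular 𝒜).proj i
    -- The basis element indexed by `p` sits in degree `p.1`, so its coefficient is projected to
    -- degree `i - p.1`.
    let q (i : ℤ) : ((Σ j : ℤ, M.deg j) →₀ A) →ₗ[ℂ] ((Σ j : ℤ, M.deg j) →₀ A) :=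
      Finsupp.lsum (R := ℂ) ℂ fun p : Σ j : ℤ, M.deg j =>
        (Finsupp.lsingle p : A →ₗ[ℂ] (Σ j : ℤ, M.deg j) →₀ A) ∘ₗ r (i - p.1)
    have hq (i : ℤ) (x : (Σ j : ℤ, M.deg j) →₀ A) (p : Σ j : ℤ, M.deg j) :
        q i x p = r (i - p.1) (x p) := by
      induction x using Finsupp.induction_linear with
      | zero => simp
      | add f g hf hg => simp [hf, hg]
      | single s a =>
        classical
        simp only [q, Finsupp.lsum_single, LinearMap.comp_apply, Finsupp.lsingle_apply,
          Finsupp.single_apply]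
        split_ifs with h
        · subst h; rfl
        · exact (map_zero _).symm
    refine ⟨q, fun i x p => ?_, fun i x hx => free_ext 𝒜 fun p => ?_,
      fun i j h x hx => free_ext 𝒜 fun p => ?_⟩
    · exact (congrArg (· ∈ 𝒜 (i - p.1)) (hq i x p)).mpr (hA.proj_mem _ _)
    · exact (hq i x p).trans (hA.proj_of_mem (hx p))
    · exact (hq j x p).trans (hA.proj_of_ne (by omega) (hx p))

end Free

section Cover

variable {M N : GrMod A}

theorem cover_mem_homDeg (hM : M.IsGraded 𝒜) : M.cover 𝒜 ∈ (M.free 𝒜).homDeg M 0 :=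
  fun _ _ hx => freeLift_mem_deg hM (e := 0) (fun p : Σ j : ℤ, M.deg j => (p.2 : M))
    (fun p => by rw [add_zero]; exact p.2.2) hx

theorem freeSingle_one_mem_deg (h1 : (1 : A) ∈ 𝒜 0) (p : Σ j : ℤ, M.deg j) :
    M.freeSingle 𝒜 p 1 ∈ (M.free 𝒜).deg p.1 := by
  simpa using freeSingle_mem_deg h1 p

theorem cover_surjective (hM : M.IsGraded 𝒜) : Function.Surjective (M.cover 𝒜) := by
  rw [← LinearMap.range_eq_top, eq_top_iff]
  intro x _
  refine hM.homogeneous_induction x (fun i x hx => ?_) (Submodule.zero_mem _)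
    fun x y hx hy => Submodule.add_mem _ hx hy
  exact ⟨M.freeSingle 𝒜 ⟨i, x, hx⟩ 1, by rw [cover_freeSingle, one_smul]⟩

theorem isGraded_syz (hA : (regular 𝒜).IsGraded 𝒜) (hM : M.IsGraded 𝒜) : (M.syz 𝒜).IsGraded 𝒜 :=
  (hA.free M).sub ((hA.free M).isHomogeneous_ker hM (cover_mem_homDeg hM))

/-- Every element of degree `i` is the image of a basis element of degree `i`. -/
theorem map_mem_deg_of_comp_cover {f : M →ₗ[A] N} (h1 : (1 : A) ∈ 𝒜 0) {d : ℤ}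
    (h : f ∘ₗ M.cover 𝒜 ∈ (M.free 𝒜).homDeg N d) : f ∈ M.homDeg N d := by
  intro i x hx
  have := h i _ (freeSingle_one_mem_deg h1 ⟨i, x, hx⟩)
  rwa [LinearMap.comp_apply, cover_freeSingle, one_smul] at this

/-- `Ext^0_A(M, N)_d = Hom_A(M, N)_d`. -/
theorem length_gext_zero (hA : (regular 𝒜).IsGraded 𝒜) (h1 : (1 : A) ∈ 𝒜 0) (hM : M.IsGraded 𝒜)
    (N : GrMod A) (d : ℤ) :
    Module.length ℂ (M.gext 𝒜 N 0 d) = Module.length ℂ (M.homDeg N d) := by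
  have hbot : (M.coboundaries 𝒜 N 0 d).submoduleOf (M.cocycles 𝒜 N 0 d) = ⊥ :=
    LinearMap.ker_eq_bot.2 (Submodule.subtype_injective _)
  rw [(Submodule.quotEquivOfEqBot _ hbot).length_eq]
  have hzero : M.cover 𝒜 ∘ₗ M.resD 𝒜 0 = 0 := by
    ext x : 1
    exact ((M.syz 𝒜).cover 𝒜 x).2
  have hmem (f : M.homDeg N d) : f.1 ∘ₗ M.cover 𝒜 ∈ M.cocycles 𝒜 N 0 d := by
    refine ⟨fun i x hx => f.2 i _ ?_, ?_⟩
    · simpa using cover_mem_homDeg hM i x hx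
    · refine LinearMap.ext fun x => ?_
      exact (congrArg f.1 (LinearMap.congr_fun hzero x)).trans (map_zero f.1)
  let T : M.homDeg N d →ₗ[ℂ] M.cocycles 𝒜 N 0 d :=
    { toFun := fun f => ⟨f.1 ∘ₗ M.cover 𝒜, hmem f⟩
      map_add' := fun _ _ => rfl
      map_smul' := fun _ _ => rfl }
  refine (LinearEquiv.ofBijective T ⟨?_, ?_⟩).length_eq.symm
  · intro f g h
    have h' : f.1 ∘ₗ M.cover 𝒜 = g.1 ∘ₗ M.cover 𝒜 := congrArg Subtype.val h
    exact Subtype.ext ((LinearMap.cancel_right (cover_surjective hM)).1 h')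
  · rintro ⟨φ, hφ, hφ'⟩
    have hφ' : φ ∘ₗ M.resD 𝒜 0 = 0 := hφ'
    obtain ⟨f, hf⟩ := exists_comp_eq_of_ker_le (M.cover 𝒜) φ (cover_surjective hM) fun x hx => by
      obtain ⟨y, hy⟩ := cover_surjective (isGraded_syz hA hM) (⟨x, hx⟩ : LinearMap.ker (M.cover 𝒜))
      have := LinearMap.congr_fun hφ' y
      have hy' : M.resD 𝒜 0 y = x := congrArg Subtype.val hy
      exact (congrArg φ hy'.symm).trans this
    have hf' : f ∈ M.homDeg N d := map_mem_deg_of_comp_cover h1 (by rw [hf]; exact hφ)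
    exact ⟨⟨f, hf'⟩, Subtype.ext hf⟩

end Cover

/-! ### Graded short exact sequences -/

/-- `0 → E' → E → M⟨e⟩ → 0` is an exact sequence of graded modules. -/
structure ShortExact (E' E M : GrMod A) (ι : E' →ₗ[A] E) (π : E →ₗ[A] M) (e : ℤ) : Prop where
  injective : Function.Injective ι
  exact : Function.Exact ι π
  deg_iff : ∀ i x, ι x ∈ E.deg i ↔ x ∈ E'.deg i
  map_deg : ∀ i, ∀ x ∈ E.deg i, π x ∈ M.deg (i - e)
  lift_deg : ∀ j, ∀ m ∈ M.deg j, ∃ y ∈ E.deg (j + e), π y = m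

namespace ShortExact

variable {E' E M N : GrMod A} {ι : E' →ₗ[A] E} {π : E →ₗ[A] M} {e : ℤ}

theorem surjective (h : ShortExact E' E M ι π e) (hM : M.IsGraded 𝒜) : Function.Surjective π := by
  rw [← LinearMap.range_eq_top, eq_top_iff]
  intro x _
  refine hM.homogeneous_induction x (fun i x hx => ?_) (Submodule.zero_mem _)
    fun x y hx hy => Submodule.add_mem _ hx hy
  obtain ⟨y, -, rfl⟩ := h.lift_deg i x hx
  exact ⟨y, rfl⟩

/-- A homomorphism of degree `d` from the submodule extends if `Ext^1` vanishes. -/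
theorem exists_extension (h : ShortExact E' E M ι π e) (hA : (regular 𝒜).IsGraded 𝒜)
    (h1 : (1 : A) ∈ 𝒜 0) (hE : E.IsGraded 𝒜) (hM : M.IsGraded 𝒜) {d : ℤ}
    (hext : Subsingleton (M.gext 𝒜 N 1 (d + e))) {g : E' →ₗ[A] N} (hg : g ∈ E'.homDeg N d) :
    ∃ f ∈ E.homDeg N d, f ∘ₗ ι = g := by
  -- The free cover of `M` lifts through `π` to a map `l` raising degrees by `e`; on the syzygy it
  -- lands in `E'`. The resulting map `l'` represents the class of the extension.
  choose v hv hπv using fun p : Σ j : ℤ, M.deg j => h.lift_deg p.1 p.2 p.2.2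
  let l : M.free 𝒜 →ₗ[A] E := M.freeLift 𝒜 v
  have hl : ∀ i, ∀ x ∈ (M.free 𝒜).deg i, l x ∈ E.deg (i + e) := fun i x hx =>
    freeLift_mem_deg hE v hv hx
  have hπl : π ∘ₗ l = M.cover 𝒜 := free_hom_ext 𝒜 fun p => by
    rw [LinearMap.comp_apply, freeLift_freeSingle, one_smul, hπv, cover_freeSingle, one_smul]
  obtain ⟨l', hl'⟩ : ∃ l' : M.syz 𝒜 →ₗ[A] E', ι ∘ₗ l' = l ∘ₗ (LinearMap.ker (M.cover 𝒜)).subtype := by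
    have hr (x : M.syz 𝒜) : (l ∘ₗ (LinearMap.ker (M.cover 𝒜)).subtype) x ∈ LinearMap.range ι := by
      obtain ⟨y, hy⟩ := (h.exact (l x.1)).1 (by rw [← LinearMap.comp_apply, hπl]; exact x.2)
      exact ⟨y, hy⟩
    let k : M.syz 𝒜 →ₗ[A] LinearMap.range ι := LinearMap.codRestrict (LinearMap.range ι) _ hr
    refine ⟨(LinearEquiv.ofInjective ι h.injective).symm.toLinearMap ∘ₗ k,
      LinearMap.ext fun x => ?_⟩
    exact congrArg Subtype.val ((LinearEquiv.ofInjective ι h.injective).apply_symm_apply (k x))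
  have hl'' (x : M.syz 𝒜) : ι (l' x) = l x.1 := LinearMap.congr_fun hl' x
  have hS := isGraded_syz hA hM
  -- The cocycle of the extension pushed out along `g`. Its vanishing class provides a `ψ` on the
  -- free cover that agrees with `g ∘ l'` on the syzygy.
  let φ : M.res 𝒜 1 →ₗ[A] N := g ∘ₗ l' ∘ₗ (M.syz 𝒜).cover 𝒜
  have hφ : φ ∈ M.cocycles 𝒜 N 1 (d + e) := by
    refine ⟨fun i x hx => ?_, ?_⟩
    · have h2 : (M.syz 𝒜).cover 𝒜 x ∈ (M.syz 𝒜).deg i := by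
        simpa using cover_mem_homDeg hS i x hx
      have h3 : l' ((M.syz 𝒜).cover 𝒜 x) ∈ E'.deg (i + e) := by
        rw [← h.deg_iff, hl'']
        exact hl i _ h2
      have := hg _ _ h3
      rwa [add_assoc, add_comm e d] at this
    · change φ ∘ₗ M.resD 𝒜 1 = 0
      ext x
      have : (M.syz 𝒜).cover 𝒜 (M.resD 𝒜 1 x) = 0 := (((M.syz 𝒜).syz 𝒜).cover 𝒜 x).2
      change g (l' ((M.syz 𝒜).cover 𝒜 (M.resD 𝒜 1 x))) = 0
      rw [this, map_zero, map_zero]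
  have hb : φ ∈ M.coboundaries 𝒜 N 1 (d + e) := by
    have h0 : Submodule.Quotient.mk (p := (M.coboundaries 𝒜 N 1 (d + e)).submoduleOf
        (M.cocycles 𝒜 N 1 (d + e))) ⟨φ, hφ⟩ = 0 := hext.elim _ _
    rw [Submodule.Quotient.mk_eq_zero] at h0
    exact h0
  obtain ⟨ψ, hψ, hψφ⟩ := hb
  have hψφ : ψ ∘ₗ M.resD 𝒜 0 = φ := hψφ
  have hψl (x : M.syz 𝒜) : ψ x.1 = g (l' x) := by
    obtain ⟨y, rfl⟩ := cover_surjective hS x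
    exact LinearMap.congr_fun hψφ y
  -- `E` is a quotient of `free M × E'` under `l + ι`, and `ψ + g` vanishes on the kernel by the
  -- choice of `ψ`, so it descends to the desired extension.
  let s : (M.free 𝒜 × E') →ₗ[A] E := l.coprod ι
  let t : (M.free 𝒜 × E') →ₗ[A] N := LinearMap.coprod ψ g
  have hdec (x : E) (c : M.free 𝒜) (hc : M.cover 𝒜 c = π x) : ∃ y, x = l c + ι y := by
    obtain ⟨y, hy⟩ := (h.exact (x - l c)).1 (by
      rw [map_sub, ← LinearMap.comp_apply, hπl, hc, sub_self])
    exact ⟨y, by rw [hy, add_sub_cancel]⟩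
  obtain ⟨f, hf⟩ := exists_comp_eq_of_ker_le s t (fun x => by
      obtain ⟨c, hc⟩ := cover_surjective hM (π x)
      obtain ⟨y, hy⟩ := hdec x c hc
      exact ⟨(c, y), hy.symm⟩) (by
      rintro ⟨c, y⟩ hcy
      have hcy : l c + ι y = 0 := hcy
      have hc : M.cover 𝒜 c = 0 := by
        have := congrArg π hcy
        rwa [map_add, (h.exact _).2 ⟨y, rfl⟩, add_zero, map_zero, ← LinearMap.comp_apply, hπl]
          at this
      have hy : y = - l' ⟨c, hc⟩ := by
        apply h.injective
        have h2 : ι (l' ⟨c, hc⟩) = l c := hl'' ⟨c, hc⟩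
        rw [map_neg, h2, eq_neg_iff_add_eq_zero, add_comm]
        exact hcy
      change ψ c + g y = 0
      have h2 : ψ c = g (l' ⟨c, hc⟩) := hψl ⟨c, hc⟩
      rw [hy, map_neg, h2, add_neg_cancel])
  have hfs (c : M.free 𝒜) (y : E') : f (l c + ι y) = ψ c + g y := LinearMap.congr_fun hf (c, y)
  refine ⟨f, fun i x hx => ?_, ?_⟩
  -- Lifting `π x` to the basis element in degree `i - e`, rather than to an arbitrary preimage,
  -- makes the remainder `y` homogeneous of degree `i`.
  · let p : Σ j : ℤ, M.deg j := ⟨i - e, π x, h.map_deg i x hx⟩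
    let c : M.free 𝒜 := M.freeSingle 𝒜 p 1
    have hcd : c ∈ (M.free 𝒜).deg (i - e) := freeSingle_one_mem_deg h1 p
    obtain ⟨y, hy⟩ := hdec x c ((cover_freeSingle 𝒜 p 1).trans (one_smul _ _))
    have hyd : y ∈ E'.deg i := by
      rw [← h.deg_iff]
      have : ι y = x - l c := by rw [hy, add_sub_cancel_left]
      rw [this]
      refine Submodule.sub_mem _ hx ?_
      simpa using hl _ _ hcd
    rw [hy, hfs]
    refine Submodule.add_mem _ ?_ (hg _ _ hyd)
    have := hψ _ _ hcd
    rwa [show i - e + (d + e) = i + d by ring] at this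
  · ext y
    have := hfs 0 y
    rwa [map_zero, show ψ (0 : M.free 𝒜) = 0 from map_zero ψ, zero_add, zero_add] at this

/-- Additivity of `Hom_A(-, N)_d` when `Ext^1` vanishes. -/
theorem length_homDeg_left (h : ShortExact E' E M ι π e) (hA : (regular 𝒜).IsGraded 𝒜)
    (h1 : (1 : A) ∈ 𝒜 0) (hE : E.IsGraded 𝒜) (hM : M.IsGraded 𝒜) {d : ℤ}
    (hext : Subsingleton (M.gext 𝒜 N 1 (d + e))) :
    Module.length ℂ (E.homDeg N d) =
      Module.length ℂ (M.homDeg N (d + e)) + Module.length ℂ (E'.homDeg N d) := by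
  let F : M.homDeg N (d + e) →ₗ[ℂ] E.homDeg N d :=
    { toFun := fun f => ⟨f.1 ∘ₗ π, fun i x hx => by
        have := f.2 _ _ (h.map_deg i x hx)
        rwa [show i - e + (d + e) = i + d by ring] at this⟩
      map_add' := fun _ _ => rfl
      map_smul' := fun _ _ => rfl }
  let G : E.homDeg N d →ₗ[ℂ] E'.homDeg N d :=
    { toFun := fun f => ⟨f.1 ∘ₗ ι, fun i x hx => f.2 _ _ ((h.deg_iff i x).2 hx)⟩
      map_add' := fun _ _ => rfl
      map_smul' := fun _ _ => rfl }
  have hs := h.surjective hM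
  refine Module.length_eq_add_of_exact F G ?_ ?_ ?_
  · intro f g hfg
    exact Subtype.ext ((LinearMap.cancel_right hs).1 (congrArg Subtype.val hfg))
  · rintro ⟨g, hg⟩
    obtain ⟨f, hf, hfg⟩ := h.exists_extension hA h1 hE hM hext hg
    exact ⟨⟨f, hf⟩, Subtype.ext hfg⟩
  · rintro ⟨f, hf⟩
    constructor
    · intro hfG
      have hfG : f ∘ₗ ι = 0 := congrArg Subtype.val hfG
      obtain ⟨u, hu⟩ := exists_comp_eq_of_ker_le π f hs fun x hx => by
        obtain ⟨y, rfl⟩ := (h.exact x).1 hx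
        exact LinearMap.congr_fun hfG y
      refine ⟨⟨u, fun j m hm => ?_⟩, Subtype.ext hu⟩
      obtain ⟨y, hy, rfl⟩ := h.lift_deg j m hm
      have := hf _ _ hy
      rw [← hu] at this
      rwa [show j + (d + e) = j + e + d by ring]
    · rintro ⟨u, hu⟩
      have hu : u.1 ∘ₗ π = f := congrArg Subtype.val hu
      refine Subtype.ext ?_
      ext y
      change f (ι y) = 0
      rw [← hu, LinearMap.comp_apply, (h.exact _).2 ⟨y, rfl⟩, map_zero]

end ShortExact

end GrMod

open GrMod SkewMonoidAlgebra

/-! ### The grading of the polynomial ring -/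

section Poly

variable (n : ℕ)

/-- The projection of `S` to `S_i`. -/
def polyProj (i : ℤ) : PolyRing n →ₗ[ℂ] PolyRing n :=
  if 0 ≤ i then MvPolynomial.homogeneousComponent i.toNat else 0

variable {n}

theorem mem_polyDeg_natCast {d : ℕ} {s : PolyRing n} :
    s ∈ polyDeg n d ↔ s.IsHomogeneous d := by
  simp [polyDeg, MvPolynomial.mem_homogeneousSubmodule]

theorem polyDeg_of_neg {i : ℤ} (h : i < 0) : polyDeg n i = ⊥ := if_neg (by omega)

theorem exists_natCast_of_mem_polyDeg {i : ℤ} {s : PolyRing n} (hs : s ∈ polyDeg n i) (h0 : s ≠ 0) :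
    ∃ d : ℕ, i = d := by
  by_cases h : 0 ≤ i
  · exact ⟨i.toNat, (Int.toNat_of_nonneg h).symm⟩
  · rw [polyDeg_of_neg (by omega)] at hs
    exact absurd hs h0

theorem mul_mem_polyDeg {i j : ℤ} {s t : PolyRing n} (hs : s ∈ polyDeg n i) (ht : t ∈ polyDeg n j) :
    s * t ∈ polyDeg n (i + j) := by
  by_cases hs0 : s = 0
  · rw [hs0, zero_mul]; exact Submodule.zero_mem _
  by_cases ht0 : t = 0
  · rw [ht0, mul_zero]; exact Submodule.zero_mem _
  obtain ⟨d, rfl⟩ := exists_natCast_of_mem_polyDeg hs hs0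
  obtain ⟨e, rfl⟩ := exists_natCast_of_mem_polyDeg ht ht0
  rw [← Nat.cast_add, mem_polyDeg_natCast]
  exact (mem_polyDeg_natCast.1 hs).mul (mem_polyDeg_natCast.1 ht)

theorem one_mem_polyDeg : (1 : PolyRing n) ∈ polyDeg n 0 :=
  mem_polyDeg_natCast.2 (MvPolynomial.isHomogeneous_one _ _)

theorem polyProj_mem (i : ℤ) (s : PolyRing n) : polyProj n i s ∈ polyDeg n i := by
  unfold polyProj polyDeg
  split_ifs
  · exact MvPolynomial.homogeneousComponent_mem _ _
  · exact Submodule.zero_mem _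

theorem polyProj_of_mem {i : ℤ} {s : PolyRing n} (hs : s ∈ polyDeg n i) : polyProj n i s = s := by
  by_cases hs0 : s = 0
  · rw [hs0, map_zero]
  obtain ⟨d, rfl⟩ := exists_natCast_of_mem_polyDeg hs hs0
  have := MvPolynomial.homogeneousComponent_of_mem (m := d) (mem_polyDeg_natCast.1 hs)
  simpa [polyProj] using this

theorem polyProj_of_ne {i j : ℤ} (h : i ≠ j) {s : PolyRing n} (hs : s ∈ polyDeg n i) :
    polyProj n j s = 0 := by
  by_cases hs0 : s = 0
  · rw [hs0, map_zero]
  obtain ⟨d, rfl⟩ := exists_natCast_of_mem_polyDeg hs hs0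
  unfold polyProj
  split_ifs with hj
  · have := MvPolynomial.homogeneousComponent_of_mem (m := j.toNat) (mem_polyDeg_natCast.1 hs)
    rw [this, if_neg (by omega)]
  · rfl

theorem poly_homogeneous_induction {p : PolyRing n → Prop} (s : PolyRing n) (zero : p 0)
    (add : ∀ s t, p s → p t → p (s + t)) (deg : ∀ i, ∀ s ∈ polyDeg n i, p s) : p s := by
  rw [← MvPolynomial.sum_homogeneousComponent s]
  refine Finset.sum_induction _ p add zero fun d _ => deg d _ ?_
  exact mem_polyDeg_natCast.2 (MvPolynomial.homogeneousComponent_isHomogeneous _ _)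

instance finite_polyDeg (i : ℤ) : Module.Finite ℂ (polyDeg n i) := by
  rw [Module.Finite.iff_fg]
  unfold polyDeg
  split_ifs
  · exact MvPolynomial.homogeneousSubmodule_fg _ _ _
  · exact Submodule.fg_bot

variable {W : Type} [Group W] [MulSemiringAction W (PolyRing n)] [GradedAction n W]

theorem smul_mem_polyDeg (w : W) {i : ℤ} {s : PolyRing n} (hs : s ∈ polyDeg n i) :
    w • s ∈ polyDeg n i := by
  by_cases hs0 : s = 0
  · rw [hs0, smul_zero]; exact Submodule.zero_mem _
  obtain ⟨d, rfl⟩ := exists_natCast_of_mem_polyDeg hs hs0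
  exact mem_polyDeg_natCast.2 (GradedAction.isHomogeneous_smul w d s (mem_polyDeg_natCast.1 hs))

end Poly

section Skew

set_option linter.unusedSectionVars false

variable {n : ℕ} {W : Type} [Group W] [MulSemiringAction W (PolyRing n)]
  [SMulCommClass W ℂ (PolyRing n)]

theorem single_mem_skewDeg {i : ℤ} {s : PolyRing n} (hs : s ∈ polyDeg n i) (w : W) :
    (single w s : Skew n W) ∈ skewDeg n W i := by
  intro v
  classical
  rw [coeff_single, Finsupp.single_apply]
  split_ifs
  · exact hs
  · exact Submodule.zero_mem _

theorem skewDeg_eq_sum {i : ℤ} {a : Skew n W} (ha : a ∈ skewDeg n W i) {p : Skew n W → Prop}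
    (zero : p 0) (add : ∀ a b, p a → p b → p (a + b))
    (single : ∀ w, ∀ s ∈ polyDeg n i, p (single w s)) : p a := by
  rw [← sum_single a]
  exact Finset.sum_induction _ p add zero fun w _ => single w _ (ha w)

/-- To prove an additive property for all elements of `A`, it suffices to consider `s ⊗ w` for
homogeneous `s`. -/
theorem skew_induction {p : Skew n W → Prop} (a : Skew n W) (zero : p 0)
    (add : ∀ a b, p a → p b → p (a + b))
    (single : ∀ w i, ∀ s ∈ polyDeg n i, p (single w s)) : p a := by
  refine SkewMonoidAlgebra.induction_on a zero (fun w s => ?_) add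
  refine poly_homogeneous_induction (p := fun s => p (SkewMonoidAlgebra.single w s)) s ?_ ?_
    (single w)
  · rw [single_zero]; exact zero
  · intro s t hs ht
    rw [single_add]; exact add _ _ hs ht

theorem one_mem_skewDeg : (1 : Skew n W) ∈ skewDeg n W 0 := by
  rw [← single_one_one]
  exact single_mem_skewDeg one_mem_polyDeg 1

theorem isGraded_regular [GradedAction n W] : (regular (skewDeg n W)).IsGraded (skewDeg n W) where
  smul_mem {i j a} (b : Skew n W) ha hb := by
    change (a * b : Skew n W) ∈ skewDeg n W (i + j)
    refine skewDeg_eq_sum (p := fun a => (a * b : Skew n W) ∈ skewDeg n W (i + j)) ha ?_ ?_ ?_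
    · rw [zero_mul]; exact Submodule.zero_mem _
    · intro a a' h h'
      rw [add_mul]; exact Submodule.add_mem _ h h'
    intro w s hs
    refine skewDeg_eq_sum (p := fun b => (single w s * b : Skew n W) ∈ skewDeg n W (i + j)) hb ?_ ?_
      ?_
    · rw [mul_zero]; exact Submodule.zero_mem _
    · intro a a' h h'
      rw [mul_add]; exact Submodule.add_mem _ h h'
    intro v t ht
    rw [single_mul_single]
    exact single_mem_skewDeg (mul_mem_polyDeg hs (smul_mem_polyDeg w ht)) _
  iSup_deg := by
    rw [eq_top_iff]
    rintro a -
    refine skew_induction (p := fun a => a ∈ ⨆ i, skewDeg n W i) a (Submodule.zero_mem _)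
      (fun a b ha hb => Submodule.add_mem _ ha hb) fun w i s hs => ?_
    exact Submodule.mem_iSup_of_mem i (single_mem_skewDeg hs w)
  exists_proj := by
    let e : Skew n W ≃ₗ[ℂ] (W →₀ PolyRing n) := coeffLinearEquiv
    let q (i : ℤ) : Skew n W →ₗ[ℂ] Skew n W :=
      e.symm.toLinearMap ∘ₗ Finsupp.mapRange.linearMap (polyProj n i) ∘ₗ e.toLinearMap
    have hq (i : ℤ) (a : Skew n W) (w : W) : (q i a).coeff w = polyProj n i (a.coeff w) := rfl
    refine ⟨q, fun i a w => ?_, fun i a ha => SkewMonoidAlgebra.ext fun w => ?_,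
      fun i j h a ha => SkewMonoidAlgebra.ext fun w => ?_⟩
    · exact (congrArg (· ∈ polyDeg n i) (hq i a w)).mpr (polyProj_mem _ _)
    · exact (hq i a w).trans (polyProj_of_mem (ha w))
    · exact (hq j a w).trans (polyProj_of_ne h (ha w))

/-! ### Modules `S ⊗ V` -/

section ProjMod

variable {V : Type} [AddCommGroup V] [Module ℂ V] (ρ : Representation ℂ W V)

/-- The element `s ⊗ v` of `P_V`. -/
def ptmul : PolyRing n →ₗ[ℂ] V →ₗ[ℂ] projMod n ρ := TensorProduct.mk ℂ (PolyRing n) V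

theorem projMod_induction {p : projMod n ρ → Prop} (x : projMod n ρ) (zero : p 0)
    (add : ∀ x y, p x → p y → p (x + y)) (tmul : ∀ i, ∀ s ∈ polyDeg n i, ∀ v, p (ptmul ρ s v)) :
    p x := by
  refine TensorProduct.induction_on (motive := p) x zero (fun s v => ?_) add
  refine poly_homogeneous_induction (p := fun s => p (ptmul ρ s v)) s ?_ ?_
    fun i s hs => tmul i s hs v
  · rw [map_zero]; exact zero
  · intro s t hs ht
    rw [map_add]; exact add _ _ hs ht

theorem single_smul_ptmul (w : W) (s t : PolyRing n) (v : V) :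
    (single w s : Skew n W) • ptmul ρ t v = ptmul ρ (s * w • t) (ρ w v) := by
  change projAction n ρ (single w s) (t ⊗ₜ[ℂ] v) = (s * w • t) ⊗ₜ[ℂ] (ρ w v)
  have : projAction n ρ (single w s) = (Algebra.lsmul ℂ ℂ (PolyRing n ⊗[ℂ] V) s) *
      ((Representation.ofDistribMulAction ℂ W (PolyRing n)).tprod ρ) w :=
    liftNC_single _ _ _ _
  rw [this]
  simp [TensorProduct.smul_tmul', Representation.ofDistribMulAction_apply_apply]

theorem ptmul_eq_smul (s : PolyRing n) (v : V) :
    ptmul ρ s v = (single 1 s : Skew n W) • ptmul ρ 1 v := by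
  rw [single_smul_ptmul, one_smul, mul_one, map_one, Module.End.one_apply]

theorem ptmul_mem_deg {i : ℤ} {s : PolyRing n} (hs : s ∈ polyDeg n i) (v : V) :
    ptmul ρ s v ∈ (projMod n ρ).deg i :=
  ⟨(⟨s, hs⟩ : polyDeg n i) ⊗ₜ[ℂ] v, rfl⟩

theorem projMod_deg_le_iff {i : ℤ} {U : Submodule ℂ (projMod n ρ)} :
    (projMod n ρ).deg i ≤ U ↔ ∀ s ∈ polyDeg n i, ∀ v, ptmul ρ s v ∈ U := by
  constructor
  · intro h s hs v
    exact h (ptmul_mem_deg ρ hs v)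
  · rintro h _ ⟨x, rfl⟩
    refine TensorProduct.induction_on (motive := fun x => (((polyDeg n i).subtype.rTensor V) x :
      projMod n ρ) ∈ U) x ?_ ?_ ?_
    · rw [map_zero]; exact U.zero_mem
    · intro s v
      exact h s.1 s.2 v
    · intro x y hx hy
      rw [map_add]; exact U.add_mem hx hy

theorem isGraded_projMod [GradedAction n W] : (projMod n ρ).IsGraded (skewDeg n W) where
  smul_mem {i j a x} ha hx := by
    refine skewDeg_eq_sum (p := fun a => a • x ∈ (projMod n ρ).deg (i + j)) ha ?_ ?_ ?_
    · rw [zero_smul]; exact Submodule.zero_mem _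
    · intro a a' h h'
      rw [add_smul]; exact Submodule.add_mem _ h h'
    intro w s hs
    have : (projMod n ρ).deg j ≤ ((projMod n ρ).deg (i + j)).comap
        (Algebra.lsmul ℂ ℂ (projMod n ρ) (single w s : Skew n W)) := by
      rw [projMod_deg_le_iff]
      intro t ht v
      change (single w s : Skew n W) • ptmul ρ t v ∈ (projMod n ρ).deg (i + j)
      rw [single_smul_ptmul]
      exact ptmul_mem_deg ρ (mul_mem_polyDeg hs (smul_mem_polyDeg w ht)) _
    exact this hx
  iSup_deg := by
    rw [eq_top_iff]
    rintro x -
    exact projMod_induction ρ (p := fun x => x ∈ ⨆ i, (projMod n ρ).deg i) x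
      (Submodule.zero_mem _) (fun x y hx hy => Submodule.add_mem _ hx hy)
      fun i s hs v => Submodule.mem_iSup_of_mem i (ptmul_mem_deg ρ hs v)
  exists_proj := by
    let q (i : ℤ) : projMod n ρ →ₗ[ℂ] projMod n ρ := (polyProj n i).rTensor V
    have hq (i : ℤ) (s : PolyRing n) (v : V) :
      q i (ptmul ρ s v) = ptmul ρ (polyProj n i s) v := rfl
    refine ⟨q, fun i x => ?_, fun i x hx => ?_, fun i j h x hx => ?_⟩
    · refine projMod_induction ρ (p := fun x => q i x ∈ (projMod n ρ).deg i) x ?_ ?_ fun j s hs v => ?_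
      · rw [map_zero]; exact Submodule.zero_mem _
      · intro x y hx hy
        rw [map_add]; exact Submodule.add_mem _ hx hy
      · rw [hq]; exact ptmul_mem_deg ρ (polyProj_mem i s) v
    · refine ((projMod_deg_le_iff ρ (U := LinearMap.eqLocus (q i) LinearMap.id)).2
        fun s hs v => ?_) hx
      rw [LinearMap.mem_eqLocus, hq, polyProj_of_mem hs]; rfl
    · refine ((projMod_deg_le_iff ρ (U := LinearMap.ker (q j))).2 fun s hs v => ?_) hx
      rw [LinearMap.mem_ker, hq, polyProj_of_ne h hs, map_zero, LinearMap.zero_apply]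

theorem projMod_deg_of_neg {i : ℤ} (h : i < 0) : (projMod n ρ).deg i = ⊥ := by
  rw [eq_bot_iff, projMod_deg_le_iff]
  intro s hs v
  rw [polyDeg_of_neg h, Submodule.mem_bot] at hs
  rw [hs, map_zero, LinearMap.zero_apply]
  exact Submodule.zero_mem _

instance finite_projMod_deg [FiniteDimensional ℂ V] (i : ℤ) :
    Module.Finite ℂ ((projMod n ρ).deg i) :=
  Module.Finite.range ((polyDeg n i).subtype.rTensor V)

variable {ρ} {M N : GrMod (Skew n W)}

theorem projMod_hom_ext {f g : projMod n ρ →ₗ[Skew n W] M}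
    (h : ∀ v, f (ptmul ρ 1 v) = g (ptmul ρ 1 v)) : f = g := by
  refine LinearMap.ext fun x => ?_
  refine projMod_induction ρ (p := fun x => f x = g x) x ?_ ?_ fun i s _ v => ?_
  · rw [map_zero, map_zero]
  · intro x y hx hy
    rw [map_add, map_add, hx, hy]
  · rw [ptmul_eq_smul, map_smul, map_smul, h]

theorem hom_ptmul_one_smul (f : projMod n ρ →ₗ[Skew n W] M) (w : W) (v : V) :
    f (ptmul ρ 1 (ρ w v)) = (single w 1 : Skew n W) • f (ptmul ρ 1 v) := by
  rw [← map_smul, single_smul_ptmul, smul_one, mul_one]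

/-- A homomorphism `P_V → M` is given by a `W`-equivariant map `V → M`. -/
theorem exists_projMod_hom (φ : V →ₗ[ℂ] M)
    (hφ : ∀ w v, φ (ρ w v) = (single w 1 : Skew n W) • φ v) :
    ∃ f : projMod n ρ →ₗ[Skew n W] M, ∀ v, f (ptmul ρ 1 v) = φ v := by
  let B : PolyRing n →ₗ[ℂ] V →ₗ[ℂ] M := LinearMap.mk₂ ℂ
    (fun s v => (single 1 s : Skew n W) • φ v)
    (fun s t v => by rw [single_add, add_smul])
    (fun c s v => by rw [← smul_single, smul_assoc])
    (fun s v v' => by rw [map_add, smul_add])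
    (fun c s v => by rw [map_smul, smul_algebra_smul_comm])
  let F : projMod n ρ →ₗ[ℂ] M := TensorProduct.lift B
  have hF (s : PolyRing n) (v : V) : F (ptmul ρ s v) = (single 1 s : Skew n W) • φ v := rfl
  refine ⟨{ toFun := F, map_add' := map_add F, map_smul' := fun a x => ?_ }, fun v => ?_⟩
  · change F (a • x) = a • F x
    refine skew_induction (p := fun a => F (a • x) = a • F x) a ?_ ?_ fun w _ s _ => ?_
    · rw [zero_smul, zero_smul, map_zero]
    · intro a b ha hb
      rw [add_smul, add_smul, map_add, ha, hb]
    · refine projMod_induction ρ (p := fun x => F ((single w s : Skew n W) • x) =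
        (single w s : Skew n W) • F x) x ?_ ?_ fun i t _ v => ?_
      · rw [smul_zero, map_zero, smul_zero]
      · intro x y hx hy
        rw [smul_add, map_add, map_add, smul_add, hx, hy]
      · rw [single_smul_ptmul, hF, hF, hφ, ← mul_smul, ← mul_smul, single_mul_single,
          single_mul_single, one_smul, mul_one, one_mul, mul_one]
  · change F (ptmul ρ 1 v) = φ v
    rw [hF, single_one_one, one_smul]

/-- `P_V` is generated by `1 ⊗ V` in degree `0`. Only compatibility of the action with degrees is
required of `M`, so that duals, which need not be sums of their homogeneous parts, are covered. -/
theorem mem_homDeg_projMod_of_smul_mem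
    (hM : ∀ {i j : ℤ} {a : Skew n W} {x : M}, a ∈ skewDeg n W i → x ∈ M.deg j →
      a • x ∈ M.deg (i + j)) {d : ℤ} {f : projMod n ρ →ₗ[Skew n W] M} :
    f ∈ (projMod n ρ).homDeg M d ↔ ∀ v, f (ptmul ρ 1 v) ∈ M.deg d := by
  constructor
  · intro hf v
    have := hf 0 _ (ptmul_mem_deg ρ one_mem_polyDeg v)
    rwa [zero_add] at this
  · intro hf i
    refine (projMod_deg_le_iff ρ (U := (M.deg (i + d)).comap (f.restrictScalars ℂ))).2
      fun s hs v => ?_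
    change f (ptmul ρ s v) ∈ M.deg (i + d)
    rw [ptmul_eq_smul, map_smul]
    exact hM (single_mem_skewDeg hs 1) (hf v)

theorem mem_homDeg_projMod [GradedAction n W] (hM : M.IsGraded (skewDeg n W)) {d : ℤ}
    {f : projMod n ρ →ₗ[Skew n W] M} :
    f ∈ (projMod n ρ).homDeg M d ↔ ∀ v, f (ptmul ρ 1 v) ∈ M.deg d :=
  mem_homDeg_projMod_of_smul_mem hM.smul_mem

theorem range_le_of_ptmul_one_mem {f : projMod n ρ →ₗ[Skew n W] M} {U : Submodule (Skew n W) M}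
    (h : ∀ v, f (ptmul ρ 1 v) ∈ U) : LinearMap.range f ≤ U := by
  rintro _ ⟨x, rfl⟩
  refine projMod_induction ρ (p := fun x => f x ∈ U) x ?_ ?_ fun i s _ v => ?_
  · rw [map_zero]; exact U.zero_mem
  · intro x y hx hy
    rw [map_add]; exact U.add_mem hx hy
  · rw [ptmul_eq_smul, map_smul]
    exact U.smul_mem _ (h v)

/-- Homomorphisms from `P_V` lift along a linear map if they do so pointwise, by averaging. -/
theorem exists_projMod_lift [Finite W] (p : M →ₗ[Skew n W] N) (f : projMod n ρ →ₗ[Skew n W] N)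
    (U : Submodule ℂ M) (hU : ∀ (w : W), ∀ u ∈ U, (single w 1 : Skew n W) • u ∈ U)
    (h : ∀ v, ∃ u ∈ U, p u = f (ptmul ρ 1 v)) :
    ∃ g : projMod n ρ →ₗ[Skew n W] M, p ∘ₗ g = f ∧ ∀ v, g (ptmul ρ 1 v) ∈ U := by
  have := Fintype.ofFinite W
  let p' : M →ₗ[ℂ] N := p.restrictScalars ℂ
  let φ : V →ₗ[ℂ] N := f.restrictScalars ℂ ∘ₗ ptmul ρ 1
  -- A linear lift with values in `U` exists over the field `ℂ`, but need not be equivariant.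
  obtain ⟨σ, hσ⟩ : ∃ σ : V →ₗ[ℂ] U, (p' ∘ₗ U.subtype) ∘ₗ σ = φ := by
    have hr : LinearMap.range φ ≤ LinearMap.range (p' ∘ₗ U.subtype) := by
      rintro _ ⟨v, rfl⟩
      obtain ⟨u, hu, hpu⟩ := h v
      exact ⟨⟨u, hu⟩, hpu⟩
    obtain ⟨s, hs⟩ := (p' ∘ₗ U.subtype).rangeRestrict.exists_rightInverse_of_surjective
      (LinearMap.range_rangeRestrict _)
    refine ⟨s ∘ₗ φ.codRestrict _ (fun v => hr ⟨v, rfl⟩), LinearMap.ext fun v => ?_⟩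
    exact congrArg Subtype.val (LinearMap.congr_fun hs ⟨φ v, hr ⟨v, rfl⟩⟩)
  have hσ' (v : V) : p (σ v : M) = f (ptmul ρ 1 v) := LinearMap.congr_fun hσ v
  let act (w : W) : M →ₗ[ℂ] M := Algebra.lsmul ℂ ℂ M (single w 1 : Skew n W)
  -- The average of the conjugates of `σ` is equivariant; it still lifts `f` because `f` is, and it
  -- stays in the `W`-stable subspace `U`.
  let ψ : V →ₗ[ℂ] M := (Fintype.card W : ℂ)⁻¹ • ∑ w : W, act w ∘ₗ U.subtype ∘ₗ σ ∘ₗ ρ w⁻¹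
  have hψ (v : V) : ψ v = (Fintype.card W : ℂ)⁻¹ •
      ∑ w : W, (single w (1 : PolyRing n) : Skew n W) • (σ (ρ w⁻¹ v) : M) := by
    simp only [ψ, LinearMap.smul_apply, LinearMap.sum_apply]
    rfl
  obtain ⟨g, hg⟩ := exists_projMod_hom (ρ := ρ) ψ fun w v => by
    rw [hψ, hψ]
    have key : ∑ x : W, (single x (1 : PolyRing n) : Skew n W) • (σ (ρ x⁻¹ (ρ w v)) : M) =
        ∑ x : W, (single w (1 : PolyRing n) : Skew n W) •
          (single x (1 : PolyRing n) : Skew n W) • (σ (ρ x⁻¹ v) : M) := by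
      refine Fintype.sum_equiv (Equiv.mulLeft w⁻¹) _ _ fun x => ?_
      rw [Equiv.coe_mulLeft, ← mul_smul, single_mul_single, smul_one, mul_one, mul_inv_cancel_left,
        mul_inv_rev, inv_inv, map_mul, Module.End.mul_apply]
    rw [key, ← Finset.smul_sum]
    exact (smul_algebra_smul_comm _ _ _).symm
  refine ⟨g, projMod_hom_ext fun v => ?_, fun v => ?_⟩
  · rw [LinearMap.comp_apply, hg, hψ, ← LinearMap.coe_restrictScalars ℂ, map_smul, _root_.map_sum]
    have : ∀ w ∈ Finset.univ, (p.restrictScalars ℂ) ((single w 1 : Skew n W) • (σ (ρ w⁻¹ v) : M)) =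
        f (ptmul ρ 1 v) := fun w _ => by
      rw [LinearMap.coe_restrictScalars, map_smul, hσ', ← hom_ptmul_one_smul,
        ← Module.End.mul_apply, ← map_mul, mul_inv_cancel, map_one ρ, Module.End.one_apply]
    rw [Finset.sum_congr rfl this, Finset.sum_const, Finset.card_univ, ← Nat.cast_smul_eq_nsmul ℂ,
      smul_smul, inv_mul_cancel₀ (by exact_mod_cast Fintype.card_ne_zero), one_smul]
  · rw [hg, hψ]
    exact U.smul_mem _ (U.sum_mem fun w _ => hU w _ (σ _).2)

theorem single_one_smul_mem_deg (hM : M.IsGraded (skewDeg n W)) (w : W) {i : ℤ} {x : M}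
    (hx : x ∈ M.deg i) : (single w 1 : Skew n W) • x ∈ M.deg i := by
  have := hM.smul_mem (single_mem_skewDeg one_mem_polyDeg w) hx
  rwa [zero_add] at this

theorem projective_projMod [Finite W] : Module.Projective (Skew n W) (projMod n ρ) := by
  refine Module.Projective.of_lifting_property'' fun p hp => ?_
  let M : GrMod (Skew n W) := { carrier := (projMod n ρ →₀ Skew n W), deg := fun _ => ⊤ }
  obtain ⟨g, hg, -⟩ := exists_projMod_lift (M := M) (N := projMod n ρ) p LinearMap.id ⊤
    (fun _ _ _ => trivial) fun v => by
      obtain ⟨u, hu⟩ := hp (ptmul ρ 1 v)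
      exact ⟨u, trivial, hu⟩
  exact ⟨g, hg⟩

end ProjMod

end Skew

/-! ### Irreducible representations and irreducible quotients -/

section Reps

variable {W : Type} [Group W]

theorem Irr.rep_mk (V : IrrRep W) :
    Nonempty ((Irr.rep (Quotient.mk (IrrRep.setoid W) V)).ρ.Equiv V.ρ) :=
  Quotient.mk_out (s := IrrRep.setoid W) V

theorem Irr.eq_of_equiv {lam mu : Irr W} (h : Nonempty (lam.rep.ρ.Equiv mu.rep.ρ)) : lam = mu := by
  have : (Quotient.mk (IrrRep.setoid W) lam.rep) = Quotient.mk (IrrRep.setoid W) mu.rep :=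
    Quotient.sound (s := IrrRep.setoid W) h
  exact (Quotient.out_eq (s := IrrRep.setoid W) lam).symm.trans
    (this.trans (Quotient.out_eq (s := IrrRep.setoid W) mu))

/-- Schur's lemma, combined with the choice of one representative per isomorphism class. -/
theorem Irr.eq_of_intertwining {lam mu : Irr W}
    (φ : (Fin lam.rep.dim → ℂ) →ₗ[ℂ] (Fin mu.rep.dim → ℂ))
    (hφ : ∀ w v, φ (lam.rep.ρ w v) = mu.rep.ρ w (φ v)) (h0 : φ ≠ 0) : lam = mu := by
  let f : lam.rep.ρ.IntertwiningMap mu.rep.ρ := φ.intertwiningMap_of_isIntertwiningMap _ _ hφ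
  have := lam.rep.irreducible
  have := mu.rep.irreducible
  rcases Representation.IsIrreducible.bijective_or_eq_zero f with h | h
  · exact Irr.eq_of_equiv ⟨.mk (LinearEquiv.ofBijective φ h) fun w => LinearMap.ext fun v => hφ w v⟩
  · exact absurd (congrArg Representation.IntertwiningMap.toLinearMap h) h0

theorem Irr.nontrivial_rep (lam : Irr W) : Nontrivial (Fin lam.rep.dim → ℂ) := by
  by_contra h
  rw [not_nontrivial_iff_subsingleton] at h
  have := lam.rep.irreducible
  obtain ⟨a, b, hab⟩ := exists_pair_ne (Subrepresentation lam.rep.ρ)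
  refine hab (SetLike.ext fun x => ?_)
  rw [Subsingleton.elim x 0]
  exact ⟨fun _ => b.toSubmodule.zero_mem, fun _ => a.toSubmodule.zero_mem⟩

/-- A finite dimensional representation has an irreducible quotient killing a given proper
subrepresentation. -/
theorem exists_irreducible_quotient {V : Type} [AddCommGroup V] [Module ℂ V]
    [FiniteDimensional ℂ V] (ρ : Representation ℂ W V) (U : Submodule ℂ V)
    (hU : ∀ w, ∀ u ∈ U, ρ w u ∈ U) (hU' : U ≠ ⊤) :
    ∃ (nu : Irr W) (q : V →ₗ[ℂ] (Fin nu.rep.dim → ℂ)), Function.Surjective q ∧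
      (∀ w v, q (ρ w v) = nu.rep.ρ w (q v)) ∧ ∀ u ∈ U, q u = 0 := by
  -- A maximal proper subrepresentation containing `U` has an irreducible quotient; it is
  -- transported to some `ℂ^dim`, the form in which `IrrRep` is given.
  let S : Set (Submodule ℂ V) := {X | (∀ w, ∀ u ∈ X, ρ w u ∈ X) ∧ X ≠ ⊤ ∧ U ≤ X}
  obtain ⟨m, ⟨hm, hmt, hUm⟩, hmax⟩ :=
    (wellFounded_gt : WellFounded ((· > ·) : Submodule ℂ V → _ → Prop)).has_min S ⟨U, hU, hU', le_rfl⟩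
  let e : (V ⧸ m) ≃ₗ[ℂ] (Fin (Module.finrank ℂ (V ⧸ m)) → ℂ) :=
    LinearEquiv.ofFinrankEq _ _ (by simp)
  let q : V →ₗ[ℂ] (Fin (Module.finrank ℂ (V ⧸ m)) → ℂ) := e.toLinearMap ∘ₗ m.mkQ
  have hq : Function.Surjective q := e.surjective.comp m.mkQ_surjective
  have hker (v : V) : q v = 0 ↔ v ∈ m := by
    change e (m.mkQ v) = 0 ↔ _
    rw [LinearEquiv.map_eq_zero_iff, Submodule.mkQ_apply, Submodule.Quotient.mk_eq_zero]
  choose r hr using fun w : W => exists_comp_eq_of_ker_le q (q ∘ₗ ρ w) hq fun v hv =>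
    (hker _).2 (hm w v ((hker v).1 hv))
  have hr' (w : W) (v : V) : r w (q v) = q (ρ w v) := LinearMap.congr_fun (hr w) v
  let σ : Representation ℂ W (Fin (Module.finrank ℂ (V ⧸ m)) → ℂ) :=
    { toFun := r
      map_one' := LinearMap.ext fun x => by
        obtain ⟨v, rfl⟩ := hq x
        rw [hr', map_one]; rfl
      map_mul' := fun w w' => LinearMap.ext fun x => by
        obtain ⟨v, rfl⟩ := hq x
        rw [Module.End.mul_apply, hr', hr', hr', map_mul]; rfl }
  have hmem (X : Subrepresentation σ) (hX : X ≠ ⊤) : X = ⊥ := by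
    have hle : X.toSubmodule.comap q = m := by
      have hge : m ≤ X.toSubmodule.comap q := fun v hv => by
        rw [Submodule.mem_comap, (hker v).2 hv]; exact X.toSubmodule.zero_mem
      by_contra hne
      refine hmax (X.toSubmodule.comap q) ⟨fun w u hu => ?_, fun htop => hX ?_, hUm.trans hge⟩
        (lt_of_le_of_ne hge (Ne.symm hne))
      · rw [Submodule.mem_comap, ← hr']
        exact X.apply_mem_toSubmodule w hu
      · refine SetLike.ext fun x => ⟨fun _ => trivial, fun _ => ?_⟩
        obtain ⟨v, rfl⟩ := hq x
        have : v ∈ X.toSubmodule.comap q := by rw [htop]; trivial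
        exact this
    refine SetLike.ext fun x => ⟨fun hx => ?_, fun hx => ?_⟩
    · obtain ⟨v, rfl⟩ := hq x
      have hv : v ∈ X.toSubmodule.comap q := hx
      rw [hle, ← hker] at hv
      exact hv
    · have hx : x = 0 := hx
      rw [hx]
      exact X.toSubmodule.zero_mem
  have hirr : σ.IsIrreducible :=
    { exists_pair_ne := by
        refine ⟨⊥, ⊤, fun h => hmt ?_⟩
        rw [eq_top_iff]
        intro v _
        have : q v ∈ (⊥ : Subrepresentation σ) := by rw [h]; trivial
        exact (hker v).1 this
      eq_bot_or_eq_top := fun X => by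
        by_cases h : X = ⊤
        · exact Or.inr h
        · exact Or.inl (hmem X h) }
  obtain ⟨φ⟩ := Irr.rep_mk (⟨_, σ, hirr⟩ : IrrRep W)
  refine ⟨Quotient.mk (IrrRep.setoid W) ⟨_, σ, hirr⟩, φ.symm.toLinearEquiv.toLinearMap ∘ₗ q,
    φ.symm.toLinearEquiv.surjective.comp hq, fun w v => ?_, fun u hu => ?_⟩
  · have h1 : q (ρ w v) = σ w (q v) := (hr' w v).symm
    have := Representation.IntertwiningMap.isIntertwining _ _ φ.symm.toIntertwiningMap w (q v)
    rw [LinearMap.comp_apply, h1]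
    exact this
  · rw [LinearMap.comp_apply, (hker u).2 (hUm hu), map_zero]

end Reps

section Skew

set_option linter.unusedSectionVars false

variable {n : ℕ} {W : Type} [Group W] [MulSemiringAction W (PolyRing n)]
  [SMulCommClass W ℂ (PolyRing n)]

/-- A `W`-stable subspace of an `A`-module as a representation of `W`. -/
def subRep (M : GrMod (Skew n W)) (U : Submodule ℂ M)
    (hU : ∀ (w : W), ∀ u ∈ U, (single w 1 : Skew n W) • u ∈ U) : Representation ℂ W U where
  toFun w := (Algebra.lsmul ℂ ℂ M (single w 1 : Skew n W)).restrict (hU w)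
  map_one' := LinearMap.ext fun u => Subtype.ext (by
    change (single 1 1 : Skew n W) • (u : M) = u
    rw [single_one_one, one_smul])
  map_mul' w v := LinearMap.ext fun u => Subtype.ext (by
    change (single (w * v) 1 : Skew n W) • (u : M) =
      (single w 1 : Skew n W) • (single v 1 : Skew n W) • (u : M)
    rw [← mul_smul, single_mul_single, smul_one, mul_one])

/-! ### The modules `L_V` -/

section Simple

variable [GradedAction n W] {V V' : Type} [AddCommGroup V] [Module ℂ V] [AddCommGroup V']
  [Module ℂ V'] (ρ : Representation ℂ W V) (ρ' : Representation ℂ W V')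

variable (n) in
/-- The identification of `V` with the underlying space of `L_V`. -/
def simpleEquiv : V ≃ₗ[ℂ] simpleMod n ρ := LinearEquiv.refl ℂ V

theorem single_smul_simpleEquiv (w : W) (s : PolyRing n) (v : V) :
    (single w s : Skew n W) • simpleEquiv n ρ v =
      simpleEquiv n ρ (MvPolynomial.constantCoeff s • ρ w v) := by
  change simpleAction n ρ (single w s) v = _
  have : simpleAction n ρ (single w s) = ((Algebra.ofId ℂ (Module.End ℂ V)).comp
      (MvPolynomial.aeval fun _ : Fin n => (0 : ℂ))) s * ρ w :=
    liftNC_single _ _ _ _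
  rw [this, AlgHom.comp_apply, MvPolynomial.aeval_zero']
  rfl

theorem constantCoeff_of_mem_polyDeg {i : ℤ} (hi : i ≠ 0) {s : PolyRing n} (hs : s ∈ polyDeg n i) :
    MvPolynomial.constantCoeff s = 0 := by
  by_cases hs0 : s = 0
  · rw [hs0, map_zero]
  obtain ⟨d, rfl⟩ := exists_natCast_of_mem_polyDeg hs hs0
  rw [MvPolynomial.constantCoeff_eq]
  refine (mem_polyDeg_natCast.1 hs).coeff_eq_zero ?_
  simpa using Ne.symm (by simpa using hi)

theorem eq_C_of_mem_polyDeg_zero {s : PolyRing n} (hs : s ∈ polyDeg n 0) :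
    s = MvPolynomial.constantCoeff s • (1 : PolyRing n) := by
  have h : s.totalDegree = 0 :=
    Nat.le_zero.1 (mem_polyDeg_natCast (d := 0).1 hs).totalDegree_le
  rw [MvPolynomial.totalDegree_eq_zero_iff_eq_C] at h
  rw [MvPolynomial.smul_eq_C_mul, mul_one]
  exact h

theorem smul_simple_of_ne {i : ℤ} (hi : i ≠ 0) {s : PolyRing n} (hs : s ∈ polyDeg n i) (w : W)
    (x : simpleMod n ρ) : (single w s : Skew n W) • x = 0 := by
  obtain ⟨v, rfl⟩ := (simpleEquiv n ρ).surjective x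
  rw [single_smul_simpleEquiv, constantCoeff_of_mem_polyDeg hi hs, zero_smul, map_zero]

variable {ρ ρ'}

/-- In degree `i ≠ 0` everything is a sum of `s • (1 ⊗ v)` with `s` in `S_i`, and such an `s` kills
`L_V`. -/
theorem projMod_hom_simple_apply (f : projMod n ρ →ₗ[Skew n W] simpleMod n ρ') {i : ℤ} (hi : i ≠ 0)
    {x : projMod n ρ} (hx : x ∈ (projMod n ρ).deg i) : f x = 0 := by
  refine (projMod_deg_le_iff ρ (U := LinearMap.ker (f.restrictScalars ℂ))).2 (fun s hs v => ?_) hx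
  change f (ptmul ρ s v) = 0
  rw [ptmul_eq_smul, map_smul, smul_simple_of_ne _ hi hs]

variable (n ρ) in
theorem exists_augmentation : ∃ f : projMod n ρ →ₗ[Skew n W] simpleMod n ρ,
    ∀ v, f (ptmul ρ 1 v) = simpleEquiv n ρ v :=
  exists_projMod_hom (simpleEquiv n ρ).toLinearMap fun w v => by
    change simpleEquiv n ρ (ρ w v) = (single w 1 : Skew n W) • simpleEquiv n ρ v
    rw [single_smul_simpleEquiv, map_one, one_smul]

/-- The map is determined by its restriction to `1 ⊗ λ`, which is an intertwining map from `λ` to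
`μ`, so Schur's lemma applies. -/
theorem eq_of_P_hom_L {lam mu : Irr W} (f : P n lam →ₗ[Skew n W] L n mu) (hf : f ≠ 0) :
    lam = mu := by
  let φ : (Fin lam.rep.dim → ℂ) →ₗ[ℂ] (Fin mu.rep.dim → ℂ) :=
    (simpleEquiv n mu.rep.ρ).symm.toLinearMap ∘ₗ f.restrictScalars ℂ ∘ₗ ptmul lam.rep.ρ 1
  have hφ (v) : simpleEquiv n mu.rep.ρ (φ v) = f (ptmul lam.rep.ρ 1 v) :=
    (simpleEquiv n mu.rep.ρ).apply_symm_apply _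
  refine Irr.eq_of_intertwining φ (fun w v => ?_) fun h0 => hf ?_
  · apply (simpleEquiv n mu.rep.ρ).injective
    have := single_smul_simpleEquiv (n := n) mu.rep.ρ w 1 (φ v)
    rw [map_one, one_smul] at this
    refine (hφ _).trans ((hom_ptmul_one_smul (M := L n mu) f w v).trans (Eq.trans ?_ this))
    exact congrArg ((single w 1 : Skew n W) • ·) (hφ v).symm
  · refine projMod_hom_ext (M := L n mu) fun v => ?_
    exact (hφ v).symm.trans (by rw [h0, LinearMap.zero_apply, map_zero]; rfl)

end Simple

/-! ### Traces -/

section Trace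

variable [GradedAction n W] {r : Irr W → Irr W → Prop}

theorem isGraded_P (lam : Irr W) : (P n lam).IsGraded (skewDeg n W) := isGraded_projMod _

theorem trace_le_iff {lam : Irr W} {T : Submodule (Skew n W) (P n lam)} :
    trace n r lam ≤ T ↔ ∀ mu, r lam mu → ∀ d : ℤ, 0 < d → ∀ f ∈ (P n mu).homDeg (P n lam) d,
      LinearMap.range f ≤ T := by
  simp only [trace, iSup_le_iff]

theorem range_le_trace {lam mu : Irr W} (h : r lam mu) {d : ℤ} (hd : 0 < d)
    {f : P n mu →ₗ[Skew n W] P n lam} (hf : f ∈ (P n mu).homDeg (P n lam) d) :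
    LinearMap.range f ≤ trace n r lam :=
  trace_le_iff.1 le_rfl mu h d hd f hf

theorem trace_mono {r' : Irr W → Irr W → Prop} {lam : Irr W} (h : ∀ mu, r lam mu → r' lam mu) :
    trace n r lam ≤ trace n r' lam :=
  trace_le_iff.2 fun mu hmu _ hd _ hf => range_le_trace (h mu hmu) hd hf

theorem isHomogeneous_trace (r : Irr W → Irr W → Prop) (lam : Irr W) :
    (P n lam).IsHomogeneous (trace n r lam) := by
  unfold trace
  refine isHomogeneous_iSup _ fun mu => isHomogeneous_iSup _ fun _ => isHomogeneous_iSup _ fun d =>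
    isHomogeneous_iSup _ fun _ => isHomogeneous_iSup _ fun f => isHomogeneous_iSup _ fun hf => ?_
  exact (isGraded_P mu).isHomogeneous_range (isGraded_P lam) hf

/-- The generators of the trace are images of `1 ⊗ ν` under maps of positive degree, and maps to
simple modules kill positive degrees. Hence no nonzero map from the trace to a simple module extends
to `P_λ`. -/
theorem hom_L_trace {lam mu : Irr W} (g : P n lam →ₗ[Skew n W] L n mu) {x : P n lam}
    (hx : x ∈ trace n r lam) : g x = 0 := by
  refine (trace_le_iff (T := LinearMap.ker g)).2 (fun nu _ d hd f hf => ?_) hx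
  refine range_le_of_ptmul_one_mem (M := P n lam) fun v => ?_
  exact projMod_hom_simple_apply g hd.ne' ((mem_homDeg_projMod (isGraded_P lam)).1 hf v)

/-- A nonzero map out of the trace is nonzero on the image of some `P_ν` with `r λ ν`, and `P_ν` has
nonzero maps to `L_ν` alone. -/
theorem rel_of_trace_hom {lam mu : Irr W} (g : trace n r lam →ₗ[Skew n W] L n mu) (hg : g ≠ 0) :
    r lam mu := by
  by_contra hr
  refine hg (LinearMap.ext fun x => ?_)
  have hle : trace n r lam ≤ (LinearMap.ker g).map (trace n r lam).subtype := by
    refine trace_le_iff.2 fun nu hnu d hd f hf => ?_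
    have hft := range_le_trace hnu hd hf
    let f' : P n nu →ₗ[Skew n W] trace n r lam := f.codRestrict _ fun x => hft ⟨x, rfl⟩
    have h0 : g ∘ₗ f' = 0 := by
      by_contra h0
      exact hr (eq_of_P_hom_L _ h0 ▸ hnu)
    rintro _ ⟨x, rfl⟩
    exact ⟨f' x, LinearMap.congr_fun h0 x, rfl⟩
  obtain ⟨y, hy, hyx⟩ := hle x.2
  rw [← Subtype.ext hyx]
  exact hy

theorem exists_ptmul_notMem_trace (lam : Irr W) :
    ∃ v, ptmul lam.rep.ρ 1 v ∉ trace n r lam := by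
  have := Irr.nontrivial_rep lam
  obtain ⟨v, hv⟩ := exists_ne (0 : Fin lam.rep.dim → ℂ)
  obtain ⟨ε, hε⟩ := exists_augmentation n lam.rep.ρ
  refine ⟨v, fun h => hv ?_⟩
  have := hom_L_trace (r := r) (lam := lam) (mu := lam) ε h
  exact (LinearEquiv.map_eq_zero_iff (simpleEquiv n lam.rep.ρ)).1 ((hε v).symm.trans this)

end Trace

/-! ### Generators of graded submodules -/

/-- If `N` is contained in `T` in degrees below `d`, but not in degree `d`, then some `L_ν` occurs
in degree `d` of the head of `N`, generated by the image of a homomorphism not contained in `T`. -/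
theorem exists_head [Finite W] [GradedAction n W] {M : GrMod (Skew n W)}
    (hM : M.IsGraded (skewDeg n W)) {d : ℤ}
    [Module.Finite ℂ (M.deg d)] {N T : Submodule (Skew n W) M} (hN : M.IsHomogeneous N)
    (hlow : ∀ i < d, ∀ x ∈ N, x ∈ M.deg i → x ∈ T) {x : M} (hxN : x ∈ N) (hxd : x ∈ M.deg d)
    (hxT : x ∉ T) :
    ∃ (nu : Irr W) (g : N →ₗ[Skew n W] L n nu), ∃ f ∈ (P n nu).homDeg M d,
      (∀ v, f (ptmul nu.rep.ρ 1 v) ∈ N) ∧ (∃ y : N, (y : M) ∈ LinearMap.range f ∧ g y ≠ 0) ∧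
      ¬ LinearMap.range f ≤ T := by
  rw [hM.isHomogeneous_iff] at hN
  let X : Submodule ℂ M := N.restrictScalars ℂ ⊓ M.deg d
  have hX (w : W) : ∀ u ∈ X, (single w 1 : Skew n W) • u ∈ X := fun u hu =>
    ⟨N.smul_mem _ hu.1, single_one_smul_mem_deg hM w hu.2⟩
  have : Module.Finite ℂ X := Submodule.finiteDimensional_inf_right _ _
  -- The degree `d` part of `N ∩ T`, a subrepresentation of `N_d` that is proper because of `x`. An
  -- irreducible quotient of `N_d` killing it becomes a simple quotient of `N` concentrated in
  -- degree `d`.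
  let U : Submodule ℂ X := (T.restrictScalars ℂ).comap X.subtype
  obtain ⟨nu, q, hq, hqρ, hqU⟩ := exists_irreducible_quotient (subRep M X hX) U
    (fun w u hu => T.smul_mem _ hu) (fun htop => hxT (by
      have : (⟨x, hxN, hxd⟩ : X) ∈ U := by rw [htop]; trivial
      exact this))
  have hmem (y : N) : M.proj d y ∈ X := ⟨hN y y.2 d, hM.proj_mem d y⟩
  let g₀ : N → L n nu := fun y => simpleEquiv n nu.rep.ρ (q ⟨M.proj d y, hmem y⟩)
  have hadd (y z : N) : g₀ (y + z) = g₀ y + g₀ z := by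
    have : (⟨M.proj d (y + z : N), hmem (y + z)⟩ : X) = ⟨M.proj d y, hmem y⟩ + ⟨M.proj d z, hmem z⟩ :=
      Subtype.ext (map_add _ _ _)
    exact (congrArg (fun u => simpleEquiv n nu.rep.ρ (q u)) this).trans
      (((simpleEquiv n nu.rep.ρ).toLinearMap ∘ₗ q).map_add _ _)
  have hsmul (a : Skew n W) (y : N) : g₀ (a • y) = a • g₀ y := by
    refine skew_induction (p := fun a => g₀ (a • y) = a • g₀ y) a ?_ ?_ fun w j s hs => ?_
    · rw [zero_smul, zero_smul]
      have := hadd 0 0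
      rwa [add_zero, left_eq_add] at this
    · intro a b ha hb
      rw [add_smul, add_smul, hadd, ha, hb]
    · have hproj : M.proj d ((single w s : Skew n W) • (y : M)) =
          (single w s : Skew n W) • M.proj (d - j) y := hM.proj_smul (single_mem_skewDeg hs w) d _
      by_cases hj : j = 0
      · subst hj
        have hs' := eq_C_of_mem_polyDeg_zero hs
        have hy : (⟨M.proj d ((single w s : Skew n W) • y : N), hmem _⟩ : X) =
            MvPolynomial.constantCoeff s • subRep M X hX w ⟨M.proj d y, hmem y⟩ := by
          refine Subtype.ext (hproj.trans ?_)
          change _ = MvPolynomial.constantCoeff s • (single w 1 : Skew n W) • M.proj d y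
          rw [sub_zero, ← smul_assoc, smul_single, ← hs']
        change simpleEquiv n nu.rep.ρ (q _) = (single w s : Skew n W) • simpleEquiv n nu.rep.ρ (q _)
        rw [hy, single_smul_simpleEquiv, map_smul, hqρ]
      · have hz : (single w s : Skew n W) • g₀ y = 0 := smul_simple_of_ne nu.rep.ρ hj hs w _
        rw [hz]
        -- For `s` of positive degree, the degree `d` part of `s • y` comes from a part of `y` in
        -- degree below `d`. That part lies in `T` by `hlow`, so its multiple lies in `U`, which `q`
        -- kills.
        have : q ⟨M.proj d ((single w s : Skew n W) • y : N), hmem _⟩ = 0 := by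
          refine hqU _ ?_
          change M.proj d ((single w s : Skew n W) • (y : M)) ∈ T
          rw [hproj]
          by_cases hs0 : s = 0
          · rw [hs0, single_zero, zero_smul]; exact T.zero_mem
          obtain ⟨e, rfl⟩ := exists_natCast_of_mem_polyDeg hs hs0
          exact T.smul_mem _ (hlow _ (by omega) _ (hN y y.2 _) (hM.proj_mem _ _))
        change simpleEquiv n nu.rep.ρ (q _) = 0
        rw [this, map_zero]
  let g : N →ₗ[Skew n W] L n nu := { toFun := g₀, map_add' := hadd, map_smul' := hsmul }
  have hg (u : X) : g ⟨u, u.2.1⟩ = simpleEquiv n nu.rep.ρ (q u) := by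
    change simpleEquiv n nu.rep.ρ (q _) = _
    congr 2
    exact Subtype.ext (hM.proj_of_mem u.2.2)
  obtain ⟨ε, hε⟩ := exists_augmentation n nu.rep.ρ
  let MN : GrMod (Skew n W) := M.sub N
  -- Lifting `P_ν → L_ν` through `g` inside degree `d` gives a homogeneous map, and `g ∘ f ≠ 0`
  -- keeps its image out of `T`.
  obtain ⟨f, hf, hfX⟩ := exists_projMod_lift (M := MN) (N := L n nu) g ε (MN.deg d)
    (fun w u hu => single_one_smul_mem_deg hM w hu) (fun v => by
      obtain ⟨u, hu⟩ := hq v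
      refine ⟨⟨u, u.2.1⟩, u.2.2, ?_⟩
      exact (hg u).trans ((congrArg (simpleEquiv n nu.rep.ρ) hu).trans (hε v).symm))
  let F : P n nu →ₗ[Skew n W] M := N.subtype ∘ₗ f
  have := Irr.nontrivial_rep nu
  obtain ⟨v, hv⟩ := exists_ne (0 : Fin nu.rep.dim → ℂ)
  have hgv : g (f (ptmul nu.rep.ρ 1 v)) ≠ 0 := by
    have h1 : g (f (ptmul nu.rep.ρ 1 v)) = simpleEquiv n nu.rep.ρ v :=
      (LinearMap.congr_fun hf _).trans (hε v)
    rw [h1]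
    exact fun h => hv ((LinearEquiv.map_eq_zero_iff _).1 h)
  refine ⟨nu, g, F, (mem_homDeg_projMod hM).2 hfX, fun v => (f (ptmul nu.rep.ρ 1 v)).2,
    ⟨f (ptmul nu.rep.ρ 1 v), ⟨_, rfl⟩, hgv⟩, fun hle => hgv ?_⟩
  have hT : F (ptmul nu.rep.ρ 1 v) ∈ T := hle ⟨_, rfl⟩
  let u : X := ⟨F (ptmul nu.rep.ρ 1 v), (f (ptmul nu.rep.ρ 1 v)).2, hfX v⟩
  have hu : q u = 0 := hqU u hT
  exact (hg u).trans (by rw [hu, map_zero]; rfl)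

/-- Additivity of `Hom_A(P_V, -)_d`. -/
theorem length_homDeg_right [Finite W] [GradedAction n W] {V : Type} [AddCommGroup V] [Module ℂ V]
    (ρ : Representation ℂ W V) {E' E M : GrMod (Skew n W)} {ι : E' →ₗ[Skew n W] E}
    {π : E →ₗ[Skew n W] M} {e : ℤ} (h : GrMod.ShortExact E' E M ι π e)
    (hE : E.IsGraded (skewDeg n W)) (hM : M.IsGraded (skewDeg n W)) (d : ℤ) :
    Module.length ℂ ((projMod n ρ).homDeg E d) =
      Module.length ℂ ((projMod n ρ).homDeg E' d) +
        Module.length ℂ ((projMod n ρ).homDeg M (d - e)) := by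
  let F : (projMod n ρ).homDeg E' d →ₗ[ℂ] (projMod n ρ).homDeg E d :=
    { toFun := fun f => ⟨ι ∘ₗ f.1, fun i x hx => (h.deg_iff _ _).2 (f.2 i x hx)⟩
      map_add' := fun f g => Subtype.ext (LinearMap.comp_add _ _ _)
      map_smul' := fun c f => Subtype.ext (LinearMap.ext fun x =>
        (ι.restrictScalars ℂ).map_smul c (f.1 x)) }
  let G : (projMod n ρ).homDeg E d →ₗ[ℂ] (projMod n ρ).homDeg M (d - e) :=
    { toFun := fun f => ⟨π ∘ₗ f.1, fun i x hx => by
        rw [← add_sub_assoc]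
        exact h.map_deg _ _ (f.2 i x hx)⟩
      map_add' := fun f g => Subtype.ext (LinearMap.comp_add _ _ _)
      map_smul' := fun c f => Subtype.ext (LinearMap.ext fun x =>
        (π.restrictScalars ℂ).map_smul c (f.1 x)) }
  refine Module.length_eq_add_of_exact F G ?_ ?_ ?_
  · intro f g hfg
    exact Subtype.ext ((LinearMap.cancel_left h.injective).1 (congrArg Subtype.val hfg))
  · rintro ⟨f, hf⟩
    rw [mem_homDeg_projMod hM] at hf
    obtain ⟨g, hg, hgd⟩ := exists_projMod_lift π f (E.deg d)
      (fun w u hu => single_one_smul_mem_deg hE w hu) (fun v => by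
        have := h.lift_deg _ _ (hf v)
        rwa [sub_add_cancel] at this)
    exact ⟨⟨g, (mem_homDeg_projMod hE).2 hgd⟩, Subtype.ext hg⟩
  · rintro ⟨f, hf⟩
    constructor
    · intro hfG
      have hfG : π ∘ₗ f = 0 := congrArg Subtype.val hfG
      have hr (x) : f x ∈ LinearMap.range ι := (h.exact _).1 (LinearMap.congr_fun hfG x)
      let k : projMod n ρ →ₗ[Skew n W] LinearMap.range ι := f.codRestrict _ hr
      have hk : ι ∘ₗ (LinearEquiv.ofInjective ι h.injective).symm.toLinearMap ∘ₗ k = f :=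
        LinearMap.ext fun x =>
          congrArg Subtype.val ((LinearEquiv.ofInjective ι h.injective).apply_symm_apply (k x))
      refine ⟨⟨(LinearEquiv.ofInjective ι h.injective).symm.toLinearMap ∘ₗ k, fun i x hx => ?_⟩,
        Subtype.ext hk⟩
      rw [← h.deg_iff]
      have := hf i x hx
      rwa [← hk] at this
    · rintro ⟨u, hu⟩
      have hu : ι ∘ₗ u.1 = f := congrArg Subtype.val hu
      refine Subtype.ext (LinearMap.ext fun x => ?_)
      change π (f x) = 0
      rw [← hu]
      exact (h.exact _).2 ⟨u.1 x, rfl⟩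

end Skew

/-! ### Ungraded extension groups -/

section Ext

open CategoryTheory CategoryTheory.Abelian

variable {R : Type} [Ring R] {X Y Z L : Type} [AddCommGroup X] [AddCommGroup Y] [AddCommGroup Z]
  [AddCommGroup L] [Module R X] [Module R Y] [Module R Z] [Module R L]

theorem shortExact_moduleCat {ι : X →ₗ[R] Y} {π : Y →ₗ[R] Z} (hι : Function.Injective ι)
    (hπ : Function.Surjective π) (h : Function.Exact ι π) :
    (ShortComplex.mk (ModuleCat.ofHom ι) (ModuleCat.ofHom π)
      (by rw [← ModuleCat.ofHom_comp, h.linearMap_comp_eq_zero]; rfl)).ShortExact where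
  exact := by
    rw [ShortComplex.ShortExact.moduleCat_exact_iff_function_exact]
    exact h
  mono_f := (ModuleCat.mono_iff_injective _).2 hι
  epi_g := (ModuleCat.epi_iff_surjective _).2 hπ

/-- Homomorphisms from a submodule extend if `Ext^1` vanishes. -/
theorem exists_extension_of_subsingleton_ext {ι : X →ₗ[R] Y} {π : Y →ₗ[R] Z}
    (hι : Function.Injective ι) (hπ : Function.Surjective π) (h : Function.Exact ι π)
    (hext : Subsingleton (Ext (ModuleCat.of R Z) (ModuleCat.of R L) 1)) (g : X →ₗ[R] L) :
    ∃ f : Y →ₗ[R] L, f ∘ₗ ι = g := by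
  have hS := shortExact_moduleCat hι hπ h
  obtain ⟨f, hf⟩ := Ext.contravariant_sequence_exact₁ hS (ModuleCat.of R L)
    (Ext.mk₀ (ModuleCat.ofHom g)) (add_zero 1) (Subsingleton.elim _ _)
  obtain ⟨f, rfl⟩ := Ext.mk₀_bijective _ _ |>.surjective f
  rw [Ext.mk₀_comp_mk₀] at hf
  have := (Ext.mk₀_bijective _ _).injective hf
  exact ⟨f.hom, congrArg ModuleCat.Hom.hom this⟩

/-- A nonzero class in `Ext^1` of a quotient of a projective module comes from a homomorphism from
the submodule. -/
theorem exists_hom_ne_zero_of_nontrivial_ext {ι : X →ₗ[R] Y} {π : Y →ₗ[R] Z}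
    (hι : Function.Injective ι) (hπ : Function.Surjective π) (h : Function.Exact ι π)
    [Module.Projective R Y]
    (hext : Nontrivial (Ext (ModuleCat.of R Z) (ModuleCat.of R L) 1)) :
    ∃ g : X →ₗ[R] L, g ≠ 0 := by
  have hS := shortExact_moduleCat hι hπ h
  have : Projective (ModuleCat.of R Y) := (IsProjective.iff_projective _).1 inferInstance
  obtain ⟨x, hx⟩ := exists_ne (0 : Ext (ModuleCat.of R Z) (ModuleCat.of R L) 1)
  obtain ⟨y, hy⟩ := Ext.contravariant_sequence_exact₃ hS (ModuleCat.of R L) x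
    (Ext.eq_zero_of_projective _) (add_zero 1)
  obtain ⟨g, rfl⟩ := Ext.mk₀_bijective _ _ |>.surjective y
  refine ⟨g.hom, fun h0 => hx ?_⟩
  have : g = 0 := ModuleCat.hom_ext h0
  rw [← hy, this, Ext.mk₀_zero, Ext.comp_zero]

end Ext

/-! ### Locally finite graded modules and filtrations -/

namespace GrMod

variable {A : Type} [Ring A] [Algebra ℂ A] {𝒜 : ℤ → Submodule ℂ A} {M : GrMod A}

/-- A graded module with finite dimensional homogeneous parts, which vanish in negative degrees. -/
structure IsLocFinite (𝒜 : ℤ → Submodule ℂ A) (M : GrMod A) : Prop where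
  graded : M.IsGraded 𝒜
  deg_of_neg : ∀ i < 0, M.deg i = ⊥
  finite : ∀ i, Module.Finite ℂ (M.deg i)

theorem IsLocFinite.quot (hM : M.IsLocFinite 𝒜) {U : Submodule A M} (hU : M.IsHomogeneous U) :
    (M.quot U).IsLocFinite 𝒜 where
  graded := hM.graded.quot hU
  deg_of_neg i hi := by
    change (M.deg i).map (U.mkQ.restrictScalars ℂ) = ⊥
    rw [hM.deg_of_neg i hi, Submodule.map_bot]
  finite i := by
    have := hM.finite i
    exact Module.Finite.map (M.deg i) (U.mkQ.restrictScalars ℂ)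

/-- Inclusion of graded submodules can be checked by induction on the degree. -/
theorem IsLocFinite.le_of_forall_deg (hM : M.IsLocFinite 𝒜) {N T : Submodule A M}
    (hN : M.IsHomogeneous N)
    (h : ∀ d : ℕ, (∀ i < (d : ℤ), ∀ x ∈ N, x ∈ M.deg i → x ∈ T) →
      ∀ x ∈ N, x ∈ M.deg (d : ℤ) → x ∈ T) : N ≤ T := by
  have key (d : ℕ) : ∀ i < (d : ℤ), ∀ x ∈ N, x ∈ M.deg i → x ∈ T := by
    induction d with
    | zero =>
      intro i hi x _ hxi
      rw [hM.deg_of_neg i (by simpa using hi), Submodule.mem_bot] at hxi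
      rw [hxi]; exact T.zero_mem
    | succ d ih =>
      intro i hi x hx hxi
      rcases lt_or_eq_of_le (show i ≤ d by push_cast at hi; omega) with h' | h'
      · exact ih i h' x hx hxi
      · subst h'; exact h d ih x hx hxi
  rw [hM.graded.isHomogeneous_iff] at hN
  intro x hx
  refine hM.graded.mem_of_proj_mem (T.restrictScalars ℂ) fun i => ?_
  exact key (i.toNat + 1) i (by push_cast; omega) _ (hN x hx i) (hM.graded.proj_mem i x)

/-- A separated descending sequence of submodules vanishes eventually in each degree. -/
theorem IsLocFinite.exists_eq_zero (hM : M.IsLocFinite 𝒜) {N : ℕ → Submodule A M}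
    (hanti : Antitone N) (hsep : ⨅ k, N k = ⊥) (d : ℤ) :
    ∃ k, ∀ i ≤ d, ∀ x ∈ N k, x ∈ M.deg i → x = 0 := by
  have one (i : ℤ) : ∃ k, ∀ x ∈ N k, x ∈ M.deg i → x = 0 := by
    have := hM.finite i
    -- In one degree, the descending chain of subspaces of a finite dimensional space stabilizes,
    -- necessarily at the zero intersection.
    let f : ℕ →o (Submodule ℂ (M.deg i))ᵒᵈ :=
      ⟨fun k => OrderDual.toDual (((N k).restrictScalars ℂ).comap (M.deg i).subtype),
        fun a b hab => Submodule.comap_mono (hanti hab)⟩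
    obtain ⟨k, hk⟩ := IsArtinian.monotone_stabilizes f
    refine ⟨k, fun x hx hxi => ?_⟩
    have : x ∈ ⨅ k, N k := by
      rw [Submodule.mem_iInf]
      intro m
      rcases le_total k m with h | h
      · have hx' : (⟨x, hxi⟩ : M.deg i) ∈ OrderDual.ofDual (f k) := hx
        rw [hk m h] at hx'
        exact hx'
      · exact hanti h hx
    rwa [hsep, Submodule.mem_bot] at this
  have nat (d : ℕ) : ∃ k, ∀ i < (d : ℤ), ∀ x ∈ N k, x ∈ M.deg i → x = 0 := by
    induction d with
    | zero =>
      refine ⟨0, fun i hi x _ hxi => ?_⟩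
      rwa [hM.deg_of_neg i (by simpa using hi), Submodule.mem_bot] at hxi
    | succ d ih =>
      obtain ⟨k, hk⟩ := ih
      obtain ⟨l, hl⟩ := one d
      refine ⟨max k l, fun i hi x hx hxi => ?_⟩
      rcases lt_or_eq_of_le (show i ≤ d by push_cast at hi; omega) with h' | h'
      · exact hk i h' x (hanti (le_max_left _ _) hx) hxi
      · subst h'; exact hl x (hanti (le_max_right _ _) hx) hxi
  obtain ⟨k, hk⟩ := nat (d.toNat + 1)
  exact ⟨k, fun i hi => hk i (by push_cast; omega)⟩

/-- The sequence `0 → U → M → M / U → 0`. -/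
theorem shortExact_quot (M : GrMod A) (U : Submodule A M) :
    ShortExact (M.sub U) M (M.quot U) U.subtype U.mkQ 0 where
  injective := U.subtype_injective
  exact := LinearMap.exact_subtype_mkQ U
  deg_iff _ _ := Iff.rfl
  map_deg i x hx := by
    rw [sub_zero]
    exact ⟨x, hx, rfl⟩
  lift_deg j m hm := by
    obtain ⟨y, hy, rfl⟩ := hm
    exact ⟨y, by rwa [add_zero], rfl⟩

/-- Replaces the abstract factor by a short exact sequence, the form used both for extending maps
and for additivity of dimensions. The shift moves into the degree of `π`. -/
theorem IsFiltration.step {Λ : Type} {F : Λ → GrMod A} {N : ℕ → Submodule A M}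
    (h : M.IsFiltration F N) (k : ℕ) :
    N (k + 1) = N k ∨ ∃ (α : Λ) (d : ℤ) (π : M.sub (N k) →ₗ[A] F α),
      ShortExact (M.sub (N (k + 1))) (M.sub (N k)) (F α) (Submodule.inclusion (h.anti k)) π d := by
  rcases h.factors k with hk | ⟨α, d, e, he⟩
  · left
    refine le_antisymm (h.anti k) fun x hx => ?_
    have hs : Subsingleton (N k ⧸ (N (k + 1)).comap (N k).subtype) := hk
    rw [Submodule.Quotient.subsingleton_iff] at hs
    have : (⟨x, hx⟩ : N k) ∈ (N (k + 1)).comap (N k).subtype := by rw [hs]; trivial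
    exact this
  · right
    let U : Submodule A (M.sub (N k)) := (N (k + 1)).comap (N k).subtype
    let p : M.sub (N k) →ₗ[A] M.factor (N k) (N (k + 1)) := U.mkQ
    let e' : M.factor (N k) (N (k + 1)) ≃ₗ[A] F α := e
    have hp (x : M.sub (N k)) : p x = 0 ↔ (x.1 : M) ∈ N (k + 1) := by
      exact Submodule.Quotient.mk_eq_zero U
    refine ⟨α, d, e'.toLinearMap ∘ₗ p, ?_, fun x => ?_, fun i x => Iff.rfl, fun i x hx => ?_,
      fun j m hm => ?_⟩
    · exact Submodule.inclusion_injective _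
    · rw [LinearMap.comp_apply, LinearEquiv.coe_coe, LinearEquiv.map_eq_zero_iff, hp]
      constructor
      · intro hx
        exact ⟨⟨x.1, hx⟩, rfl⟩
      · rintro ⟨y, rfl⟩
        exact y.2
    · exact (he i (p x)).2 ⟨x, hx, rfl⟩
    · obtain ⟨y, hy, hym⟩ := (he (j + d) (e'.symm m)).1 (by
        have h1 : e (e'.symm m) = m := e'.apply_symm_apply m
        rw [h1]
        change m ∈ (F α).deg (j + d - d)
        rwa [add_sub_cancel_right])
      refine ⟨y, hy, ?_⟩
      have hym : p y = e'.symm m := hym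
      rw [LinearMap.comp_apply, hym]
      exact e'.apply_symm_apply m

theorem IsFiltration.antitone {Λ : Type} {F : Λ → GrMod A} {N : ℕ → Submodule A M}
    (h : M.IsFiltration F N) : Antitone N :=
  antitone_nat_of_succ_le h.anti

end GrMod

/-! ### Comparison of the two preorders and the inclusions obtained from heads -/

section Skew

set_option linter.unusedSectionVars false

variable {n : ℕ} {W : Type} [Group W] [MulSemiringAction W (PolyRing n)]
  [SMulCommClass W ℂ (PolyRing n)] [GradedAction n W] {r : Irr W → Irr W → Prop}

theorem isLocFinite_P (lam : Irr W) : (P n lam).IsLocFinite (skewDeg n W) where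
  graded := isGraded_P lam
  deg_of_neg _ hi := projMod_deg_of_neg _ hi
  finite i := finite_projMod_deg lam.rep.ρ i

theorem isLocFinite_quot_trace (r : Irr W → Irr W → Prop) (lam : Irr W) :
    ((P n lam).quot (trace n r lam)).IsLocFinite (skewDeg n W) :=
  (isLocFinite_P lam).quot (isHomogeneous_trace r lam)

theorem isLocFinite_K (le : Irr W → Irr W → Prop) (lam : Irr W) :
    (K n le lam).IsLocFinite (skewDeg n W) := isLocFinite_quot_trace le lam

theorem isLocFinite_Ktilde (le : Irr W → Irr W → Prop) (lam : Irr W) :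
    (Ktilde n le lam).IsLocFinite (skewDeg n W) := isLocFinite_quot_trace _ lam

theorem exists_ptmul_one_eq {lam : Irr W} {x : P n lam} (hx : x ∈ (P n lam).deg 0) :
    ∃ v, ptmul lam.rep.ρ (1 : PolyRing n) v = x := by
  have hle : (projMod n lam.rep.ρ).deg 0 ≤ LinearMap.range (ptmul lam.rep.ρ (1 : PolyRing n)) := by
    rw [projMod_deg_le_iff]
    intro s hs v
    refine ⟨MvPolynomial.constantCoeff s • v, ?_⟩
    conv_rhs => rw [eq_C_of_mem_polyDeg_zero hs]
    rw [map_smul, map_smul, LinearMap.smul_apply]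
  exact hle hx

/-- In degree `0` the augmentation `P_λ → L_λ` is injective, and it kills the trace. -/
theorem eq_zero_of_mem_trace_of_mem_deg_zero {lam : Irr W} {x : P n lam} (hx : x ∈ trace n r lam)
    (hx0 : x ∈ (P n lam).deg 0) : x = 0 := by
  obtain ⟨v, rfl⟩ := exists_ptmul_one_eq hx0
  obtain ⟨ε, hε⟩ := exists_augmentation n lam.rep.ρ
  have := hom_L_trace (mu := lam) ε hx
  have hv : v = 0 := (LinearEquiv.map_eq_zero_iff (simpleEquiv n lam.rep.ρ)).1 ((hε v).symm.trans this)
  rw [hv]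
  exact map_zero _

/-- The head of `P_λ / trace` is `L_λ`. -/
theorem exists_quot_trace_hom_L (r : Irr W → Irr W → Prop) (lam : Irr W) :
    ∃ f : (P n lam).quot (trace n r lam) →ₗ[Skew n W] L n lam, f ≠ 0 := by
  obtain ⟨ε, hε⟩ := exists_augmentation n lam.rep.ρ
  let ε' : P n lam →ₗ[Skew n W] L n lam := ε
  refine ⟨(trace n r lam).liftQ ε' fun x hx => hom_L_trace ε' hx, fun h0 => ?_⟩
  have := Irr.nontrivial_rep lam
  obtain ⟨v, hv⟩ := exists_ne (0 : Fin lam.rep.dim → ℂ)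
  refine hv ((LinearEquiv.map_eq_zero_iff (simpleEquiv n lam.rep.ρ)).1 ((hε v).symm.trans ?_))
  exact LinearMap.congr_fun h0 ((trace n r lam).mkQ (ptmul lam.rep.ρ 1 v))

variable [Finite W] {le : Irr W → Irr W → Prop}

/-- As `P_λ` is projective, a nonzero class is the image of a nonzero map `I_λ → L_μ`, and `I_λ` is
generated by images of modules `P_ν` with `λ ≾ ν`. -/
theorem le_of_nontrivial_ext {lam mu : Irr W}
    (h : Nontrivial (CategoryTheory.Abelian.Ext (ModuleCat.of (Skew n W) (K n le lam))
      (ModuleCat.of (Skew n W) (L n mu)) 1)) : le lam mu := by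
  have : Module.Projective (Skew n W) (P n lam) := projective_projMod (ρ := lam.rep.ρ)
  have hs := shortExact_quot (P n lam) (I n le lam)
  obtain ⟨g, hg⟩ := exists_hom_ne_zero_of_nontrivial_ext (L := L n mu) hs.injective
    (I n le lam).mkQ_surjective hs.exact h
  exact rel_of_trace_hom g hg

theorem le_of_leK (hrefl : ∀ x, le x x) (htrans : ∀ x y z, le x y → le y z → le x z)
    {lam mu : Irr W} (h : leK n le lam mu) : le lam mu := by
  induction h with
  | refl => exact hrefl _
  | tail _ h ih => exact htrans _ _ _ ih (le_of_nontrivial_ext h)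

/-- In the first degree where the inclusion fails, the head of `I_λ` contains some `L_ν`. The map
`I_λ → L_ν` cannot extend to `P_λ`, so `Ext^1(K_λ, L_ν) ≠ 0` and the generator in question already
belongs to the larger trace. -/
theorem I_le_trace_leK (le : Irr W → Irr W → Prop) (lam : Irr W) :
    I n le lam ≤ trace n (leK n le) lam := by
  have hI : (P n lam).IsHomogeneous (I n le lam) := isHomogeneous_trace le lam
  refine (isLocFinite_P lam).le_of_forall_deg hI fun d hd x hx hxd => ?_
  by_contra hxT
  have := (isLocFinite_P (n := n) lam).finite d
  obtain ⟨nu, g, f, hf, -, ⟨y, -, hy⟩, hfT⟩ := exists_head (isGraded_P lam) hI hd hx hxd hxT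
  refine hfT (range_le_trace (Relation.ReflTransGen.single ?_) ?_ hf)
  · by_contra hext
    rw [not_nontrivial_iff_subsingleton] at hext
    have hs := shortExact_quot (P n lam) (I n le lam)
    obtain ⟨k, hk⟩ := exists_extension_of_subsingleton_ext (L := L n nu) hs.injective
      (I n le lam).mkQ_surjective hs.exact hext g
    exact hy ((LinearMap.congr_fun hk y).symm.trans (hom_L_trace k y.2))
  -- Only positive degrees count in a trace; failure in degree `0` is excluded since `I_λ` vanishes
  -- there.
  · rcases Nat.eq_zero_or_pos d with h0 | h0
    · subst h0
      refine absurd ?_ hxT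
      rw [eq_zero_of_mem_trace_of_mem_deg_zero hx hxd]
      exact Submodule.zero_mem _
    · exact_mod_cast h0

section KtildeFiltration

variable {lam : Irr W} {N : ℕ → Submodule (Skew n W) (Ktilde n le lam)}

/-- The preimage in `P_λ` of a submodule of `K̃_λ`. -/
def pullback (U : Submodule (Skew n W) (Ktilde n le lam)) : Submodule (Skew n W) (P n lam) :=
  U.comap (Itilde n le lam).mkQ

theorem Itilde_le_pullback (U : Submodule (Skew n W) (Ktilde n le lam)) :
    Itilde n le lam ≤ pullback U := fun x hx => by
  have : (Itilde n le lam).mkQ x = 0 := by simpa using hx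
  change (Itilde n le lam).mkQ x ∈ U
  rw [this]
  exact U.zero_mem

theorem pullback_mono {U U' : Submodule (Skew n W) (Ktilde n le lam)} (h : U' ≤ U) :
    pullback U' ≤ pullback U := Submodule.comap_mono h

theorem isHomogeneous_pullback {U : Submodule (Skew n W) (Ktilde n le lam)}
    (hU : (Ktilde n le lam).IsHomogeneous U) : (P n lam).IsHomogeneous (pullback U) := by
  rw [(isGraded_P lam).isHomogeneous_iff]
  rw [(isLocFinite_Ktilde le lam).graded.isHomogeneous_iff] at hU
  intro x hx i
  have hmk : (Itilde n le lam).mkQ ∈ (P n lam).homDeg (Ktilde n le lam) 0 := fun i x hx =>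
    ⟨x, by rwa [add_zero], rfl⟩
  have := (isGraded_P lam).map_proj (isLocFinite_Ktilde le lam).graded hmk i x
  change (Itilde n le lam).mkQ ((P n lam).proj i x) ∈ U
  refine (congrArg (· ∈ U) this).mpr ?_
  exact hU _ hx _

/-- The pulled back terms have the same successive quotients, but start at `P_λ`, whose only simple
quotient is `L_λ`; that begins the induction below. -/
theorem exists_pullback_hom {U U' : Submodule (Skew n W) (Ktilde n le lam)} (hU : U' ≤ U)
    {E : GrMod (Skew n W)} (hE : E.IsGraded (skewDeg n W)) {d : ℤ}
    {π : (Ktilde n le lam).sub U →ₗ[Skew n W] E}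
    (h : ShortExact ((Ktilde n le lam).sub U') ((Ktilde n le lam).sub U) E
      (Submodule.inclusion hU) π d) :
    ∃ p : pullback U →ₗ[Skew n W] E, Function.Surjective p ∧
      Function.Exact (Submodule.inclusion (pullback_mono hU)) p := by
  let q : pullback U →ₗ[Skew n W] (Ktilde n le lam).sub U :=
    ((Itilde n le lam).mkQ ∘ₗ (pullback U).subtype).codRestrict U fun x => x.2
  refine ⟨π ∘ₗ q, (h.surjective hE).comp fun y => ?_, fun x => ?_⟩
  · obtain ⟨x, hx⟩ := (Itilde n le lam).mkQ_surjective y.1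
    refine ⟨⟨x, ?_⟩, Subtype.ext hx⟩
    change (Itilde n le lam).mkQ x ∈ U
    rw [hx]
    exact y.2
  · refine (h.exact (q x)).trans ⟨?_, ?_⟩
    · rintro ⟨y, hy⟩
      have : (Itilde n le lam).mkQ x.1 = y.1 := (congrArg Subtype.val hy).symm
      refine ⟨⟨x.1, ?_⟩, rfl⟩
      change (Itilde n le lam).mkQ x.1 ∈ U'
      rw [this]
      exact y.2
    · rintro ⟨y, rfl⟩
      exact ⟨⟨_, y.2⟩, rfl⟩

/-- The simple quotients of the terms of a filtration of `K̃_λ` by the modules `K_μ`, and the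
factors of the filtration, have labels `ν` with `λ ≾_K ν`. -/
theorem leK_of_pullback_hom (h : (Ktilde n le lam).IsFiltration (K n le) N) (k : ℕ) (nu : Irr W)
    (g : pullback (N k) →ₗ[Skew n W] L n nu) (hg : g ≠ 0) : leK n le lam nu := by
  induction k generalizing nu with
  | zero =>
    have hmem (x : P n lam) : x ∈ pullback (N 0) := by
      change (Itilde n le lam).mkQ x ∈ N 0
      rw [h.top]; trivial
    let j : P n lam →ₗ[Skew n W] pullback (N 0) := LinearMap.id.codRestrict _ hmem
    have : lam = nu := eq_of_P_hom_L (g ∘ₗ j) fun h0 => hg (LinearMap.ext fun x =>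
      LinearMap.congr_fun h0 x.1)
    subst this
    exact .refl
  | succ k ih =>
    rcases h.step k with hk | ⟨κ, d, π, hπ⟩
    -- The type of `g` depends on `N (k + 1)`, so the equality is used after generalizing the
    -- submodule.
    · have key : ∀ U, U = N k → ∀ g : pullback U →ₗ[Skew n W] L n nu, g ≠ 0 → leK n le lam nu := by
        rintro U rfl
        exact ih nu
      exact key _ hk g hg
    · obtain ⟨p, hp, hexact⟩ := exists_pullback_hom (h.anti k) (isLocFinite_K le κ).graded hπ
      obtain ⟨φ, hφ⟩ := exists_quot_trace_hom_L (n := n) le κ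
      -- The head `L_κ` of the factor `K_κ` is also a simple quotient of the earlier term.
      have hκ : leK n le lam κ := ih κ (φ ∘ₗ p) fun h0 => hφ ((LinearMap.cancel_right hp).1 h0)
      by_cases hext : Nontrivial (CategoryTheory.Abelian.Ext (ModuleCat.of (Skew n W) (K n le κ))
          (ModuleCat.of (Skew n W) (L n nu)) 1)
      · exact hκ.tail hext
      -- With `Ext^1(K_κ, L_ν) = 0` the map `g` extends to the earlier term, so `L_ν` is not new.
      · rw [not_nontrivial_iff_subsingleton] at hext
        obtain ⟨f, hf⟩ := exists_extension_of_subsingleton_ext (L := L n nu)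
          (Submodule.inclusion_injective _) hp hexact hext g
        refine ih nu f fun h0 => hg ?_
        rw [← hf, h0, LinearMap.zero_comp]

theorem leK_of_factor (h : (Ktilde n le lam).IsFiltration (K n le) N) (k : ℕ) {κ : Irr W} {d : ℤ}
    {π : (Ktilde n le lam).sub (N k) →ₗ[Skew n W] K n le κ}
    (hπ : ShortExact ((Ktilde n le lam).sub (N (k + 1))) ((Ktilde n le lam).sub (N k)) (K n le κ)
      (Submodule.inclusion (h.anti k)) π d) : leK n le lam κ := by
  obtain ⟨p, hp, -⟩ := exists_pullback_hom (h.anti k) (isLocFinite_K le κ).graded hπ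
  obtain ⟨φ, hφ⟩ := exists_quot_trace_hom_L (n := n) le κ
  exact leK_of_pullback_hom h k κ (φ ∘ₗ p) fun h0 => hφ ((LinearMap.cancel_right hp).1 h0)

/-- `≾_K` is controlled on simple quotients of the pulled back terms, strictness on those of `Ĩ_λ`.
A late term and `Ĩ_λ` agree in degrees up to `d`, so one simple quotient in degree `d` serves for
both. -/
theorem Itilde_le_trace_leK (hrefl : ∀ x, le x x) (htrans : ∀ x y z, le x y → le y z → le x z)
    (h : (Ktilde n le lam).IsFiltration (K n le) N) :
    Itilde n le lam ≤ trace n (strict (leK n le)) lam := by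
  have hI : (P n lam).IsHomogeneous (Itilde n le lam) := isHomogeneous_trace _ lam
  refine (isLocFinite_P lam).le_of_forall_deg hI fun d hd x hx hxd => ?_
  by_contra hxT
  have := (isLocFinite_P (n := n) lam).finite d
  -- Far enough along, the filtration of `K̃_λ` is zero in degrees at most `d`.
  obtain ⟨k, hk⟩ := (isLocFinite_Ktilde (n := n) le lam).exists_eq_zero h.antitone h.separable d
  have hk' (i : ℤ) (hi : i ≤ d) (x : P n lam) (hx : x ∈ pullback (N k)) (hxi : x ∈ (P n lam).deg i) :
      x ∈ Itilde n le lam := by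
    have := hk i hi _ hx ⟨x, hxi, rfl⟩
    exact (Submodule.Quotient.mk_eq_zero _).1 this
  obtain ⟨nu, g, f, hf, hfN, ⟨y, hyf, hy⟩, hfT⟩ := exists_head (isGraded_P lam)
    (isHomogeneous_pullback (h.homogeneous k))
    (fun i hi x hx hxi => hd i hi x (hk' i hi.le x hx hxi) hxi)
    (Itilde_le_pullback (N k) hx) hxd hxT
  have hfI : LinearMap.range f ≤ Itilde n le lam := range_le_of_ptmul_one_mem (M := P n lam)
    fun v => hk' d le_rfl _ (hfN v) ((mem_homDeg_projMod (isGraded_P lam)).1 hf v)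
  -- The head map stays nonzero on `Ĩ_λ`, because the image of `f` is generated in degree `d` and so
  -- lies in `Ĩ_λ`.
  have hlt : strict le lam nu := by
    refine rel_of_trace_hom (g ∘ₗ Submodule.inclusion (Itilde_le_pullback (N k))) fun h0 => hy ?_
    exact LinearMap.congr_fun h0 ⟨y.1, hfI hyf⟩
  -- A relation `ν ≾_K λ` would imply `ν ≾ λ`, against the strictness just found.
  refine hfT (range_le_trace ⟨leK_of_pullback_hom h k nu g fun h0 => hy (by rw [h0]; rfl),
    fun h' => hlt.2 ⟨hlt.1, le_of_leK hrefl htrans h'.2⟩⟩ ?_ hf)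
  rcases Nat.eq_zero_or_pos d with h0 | h0
  · subst h0
    refine absurd ?_ hxT
    rw [eq_zero_of_mem_trace_of_mem_deg_zero hx hxd]
    exact Submodule.zero_mem _
  · exact_mod_cast h0

end KtildeFiltration

end Skew

/-- Telescoping along a labelled sequence, where each label with index at most `d` occurs
finitely often. -/
theorem eq_sum_ncard_mul {Λ : Type} [Fintype Λ] {c : ℕ → Option (Λ × ℕ)}
    (hc : ∀ d, ∃ m, ∀ k α e, c k = some (α, e) → e ≤ d → k < m) {d : ℕ} {v : Λ → ℕ → ℕ∞}
    (hv : ∀ α e, d < e → v α e = 0) {f : ℕ → ℕ∞} (hnone : ∀ k, c k = none → f k = f (k + 1))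
    (hsome : ∀ k α e, c k = some (α, e) → f k = f (k + 1) + v α e)
    (hf : ∃ m, ∀ k, m ≤ k → f k = 0) :
    f 0 = ∑ α, ∑ e ∈ Finset.range (d + 1), ({k | c k = some (α, e)}.ncard : ℕ∞) * v α e := by
  classical
  obtain ⟨m₁, h₁⟩ := hc d
  obtain ⟨m₂, h₂⟩ := hf
  -- Beyond `m` no label has index at most `d`, and `f` vanishes.
  let m := max m₁ m₂
  let S : Finset (Λ × ℕ) := Finset.univ ×ˢ Finset.range (d + 1)
  let t (k : ℕ) : ℕ∞ := ∑ p ∈ S, if c k = some p then v p.1 p.2 else 0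
  have ht (k : ℕ) : f k = f (k + 1) + t k := by
    rcases hk : c k with _ | ⟨α, e⟩
    · have : t k = 0 := Finset.sum_eq_zero fun p _ => if_neg (by rw [hk]; exact fun h => nomatch h)
      rw [this, add_zero, hnone k hk]
    · rw [hsome k α e hk]
      congr 1
      simp only [t, hk, Option.some.injEq, Finset.sum_ite_eq]
      split_ifs with h
      · rfl
      · refine hv α e ?_
        simpa [S] using h
  have tele (k : ℕ) : f 0 = f k + ∑ i ∈ Finset.range k, t i := by
    induction k with
    | zero => simp
    | succ k ih => rw [ih, ht k, Finset.sum_range_succ]; ring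
  rw [tele m, h₂ m (le_max_right _ _), zero_add, Finset.sum_comm,
    ← Finset.sum_product' (f := fun α e => ({k | c k = some (α, e)}.ncard : ℕ∞) * v α e)]
  refine Finset.sum_congr rfl fun p hp => ?_
  rw [← Finset.sum_filter, Finset.sum_const, nsmul_eq_mul]
  congr 2
  rw [← Set.ncard_coe_finset]
  congr 1
  ext k
  simp only [Finset.coe_filter, Finset.mem_range, Set.mem_ofPred_eq, and_iff_right_iff_imp]
  intro hk
  refine (h₁ k p.1 p.2 hk ?_).trans_le (le_max_left _ _)
  have := (Finset.mem_product.1 hp).2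
  simp only [Finset.mem_range] at this
  omega

/-! ### Multiplicities in filtrations -/

namespace GrMod

variable {A : Type} [Ring A] [Algebra ℂ A] {𝒜 : ℤ → Submodule ℂ A} {M : GrMod A}

/-- The numbers `m α e` are the multiplicities `(M : F_α⟨e⟩)` of the factors of a filtration, in the
sense that they compute all functions that are additive along the filtration. -/
def IsFiltration.IsMult {Λ : Type} [Fintype Λ] {F : Λ → GrMod A} {N : ℕ → Submodule A M}
    (h : M.IsFiltration F N) (m : Λ → ℕ → ℕ) : Prop :=
  ∀ (d : ℕ) (χ : Submodule A M → ℕ∞) (v : Λ → ℕ → ℕ∞), (∀ α e, d < e → v α e = 0) →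
    (∀ (k : ℕ) (α : Λ) (e : ℕ) (π : M.sub (N k) →ₗ[A] F α),
      ShortExact (M.sub (N (k + 1))) (M.sub (N k)) (F α) (Submodule.inclusion (h.anti k)) π e →
        χ (N k) = χ (N (k + 1)) + v α e) →
    (∃ l, ∀ k, l ≤ k → χ (N k) = 0) →
    χ ⊤ = ∑ α, ∑ e ∈ Finset.range (d + 1), (m α e : ℕ∞) * v α e

/-- Count the factors by label. A nonzero element of `F_α` in degree `0` makes `F_α⟨e⟩` visible in
degree `e` of `M`; this rules out negative shifts and leaves finitely many factors with shift at
most any given bound. -/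
theorem IsFiltration.exists_isMult {Λ : Type} [Fintype Λ] {F : Λ → GrMod A} {N : ℕ → Submodule A M}
    (h : M.IsFiltration F N) (hM : M.IsLocFinite 𝒜) (hF : ∀ α, ∃ x ∈ (F α).deg 0, x ≠ 0) :
    ∃ m : Λ → ℕ → ℕ,
      (∀ α e, m α e ≠ 0 → ∃ (k : ℕ) (π : M.sub (N k) →ₗ[A] F α),
        ShortExact (M.sub (N (k + 1))) (M.sub (N k)) (F α) (Submodule.inclusion (h.anti k)) π e) ∧
      h.IsMult m := by
  have hnonneg {k : ℕ} {α : Λ} {d : ℤ} {π : M.sub (N k) →ₗ[A] F α}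
      (hπ : ShortExact (M.sub (N (k + 1))) (M.sub (N k)) (F α)
        (Submodule.inclusion (h.anti k)) π d) : 0 ≤ d := by
    by_contra hd
    obtain ⟨x, hx, hx0⟩ := hF α
    obtain ⟨y, hy, rfl⟩ := hπ.lift_deg 0 x hx
    have hy : y.1 ∈ M.deg (0 + d) := hy
    rw [hM.deg_of_neg _ (by omega), Submodule.mem_bot] at hy
    refine hx0 ?_
    have : y = 0 := Subtype.ext hy
    rw [this, map_zero]
  have hlabel (k : ℕ) : ∃ o : Option (Λ × ℕ), (o = none → N (k + 1) = N k) ∧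
      ∀ α e, o = some (α, e) → ∃ π : M.sub (N k) →ₗ[A] F α,
        ShortExact (M.sub (N (k + 1))) (M.sub (N k)) (F α) (Submodule.inclusion (h.anti k)) π e := by
    rcases h.step k with hk | ⟨α, d, π, hπ⟩
    · exact ⟨none, fun _ => hk, fun _ _ h => (nomatch h)⟩
    · refine ⟨some (α, d.toNat), (fun h => nomatch h), fun β e hβ => ?_⟩
      obtain ⟨rfl, rfl⟩ := Prod.ext_iff.1 (Option.some.inj hβ)
      rw [Int.toNat_of_nonneg (hnonneg hπ)]
      exact ⟨π, hπ⟩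
  choose c hcnone hcsome using hlabel
  refine ⟨fun α e => {k | c k = some (α, e)}.ncard, fun α e hm => ?_, fun d χ v hv hχ hl => ?_⟩
  · obtain ⟨k, hk⟩ := Set.nonempty_of_ncard_ne_zero hm
    exact ⟨k, hcsome k α e hk⟩
  · rw [← h.top]
    refine eq_sum_ncard_mul (f := fun k => χ (N k)) (fun d => ?_) hv
      (fun k hk => by simp only [hcnone k hk]) (fun k α e hk => ?_) hl
    · obtain ⟨m, hm⟩ := hM.exists_eq_zero h.antitone h.separable d
      refine ⟨m, fun k α e hk hed => ?_⟩
      by_contra hmk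
      obtain ⟨π, hπ⟩ := hcsome k α e hk
      obtain ⟨x, hx, hx0⟩ := hF α
      obtain ⟨y, hy, rfl⟩ := hπ.lift_deg 0 x hx
      -- A factor shifted by `e ≤ d` needs a nonzero element of `N k` in degree `e`, and there is
      -- none once `m ≤ k`.
      have : y = 0 := Subtype.ext (hm (0 + e) (by omega) y.1 (h.antitone (not_lt.1 hmk) y.2) hy)
      exact hx0 (by rw [this, map_zero])
    · obtain ⟨π, hπ⟩ := hcsome k α e hk
      exact hχ k α e π hπ

theorem length_homDeg_sub_top_right (X M : GrMod A) (d : ℤ) :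
    Module.length ℂ (X.homDeg (M.sub ⊤) d) = Module.length ℂ (X.homDeg M d) :=
  LinearEquiv.length_eq (R := ℂ)
    { toFun := fun f => ⟨(⊤ : Submodule A M).subtype ∘ₗ f.1, f.2⟩
      invFun := fun f => ⟨f.1.codRestrict ⊤ fun _ => trivial, f.2⟩
      map_add' := fun _ _ => rfl
      map_smul' := fun _ _ => rfl
      left_inv := fun _ => rfl
      right_inv := fun _ => rfl }

theorem length_homDeg_sub_top_left (M X : GrMod A) (d : ℤ) :
    Module.length ℂ ((M.sub ⊤).homDeg X d) = Module.length ℂ (M.homDeg X d) :=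
  LinearEquiv.length_eq (R := ℂ)
    { toFun := fun f => ⟨f.1 ∘ₗ LinearMap.id.codRestrict ⊤ fun _ => trivial,
        fun i x hx => f.2 i ⟨x, trivial⟩ hx⟩
      invFun := fun f => ⟨f.1 ∘ₗ (⊤ : Submodule A M).subtype, fun i x hx => f.2 i x.1 hx⟩
      map_add' := fun _ _ => rfl
      map_smul' := fun _ _ => rfl
      left_inv := fun _ => rfl
      right_inv := fun _ => rfl }

end GrMod

section Skew

set_option linter.unusedSectionVars false

variable {n : ℕ} {W : Type} [Group W] [MulSemiringAction W (PolyRing n)]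
  [SMulCommClass W ℂ (PolyRing n)] [GradedAction n W]

/-- Homomorphisms from `P_V` to `M` in degree `d` are intertwining maps from `V` to `M_d`. -/
theorem length_homDeg_projMod {V V' : Type} [AddCommGroup V] [Module ℂ V] [AddCommGroup V']
    [Module ℂ V'] (ρ : Representation ℂ W V) (σ : Representation ℂ W V') {M : GrMod (Skew n W)}
    (hM : ∀ {i j : ℤ} {a : Skew n W} {x : M}, a ∈ skewDeg n W i → x ∈ M.deg j →
      a • x ∈ M.deg (i + j)) {d : ℤ}
    (j : V' →ₗ[ℂ] M) (hj : Function.Injective j) (hr : LinearMap.range j = M.deg d)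
    (hσ : ∀ w v, j (σ w v) = (single w 1 : Skew n W) • j v) :
    Module.length ℂ ((projMod n ρ).homDeg M d) = Module.length ℂ (ρ.IntertwiningMap σ) := by
  let J := LinearEquiv.ofInjective j hj
  have hmem (f : (projMod n ρ).homDeg M d) (v : V) : f.1 (ptmul ρ 1 v) ∈ LinearMap.range j := by
    rw [hr]
    exact (mem_homDeg_projMod_of_smul_mem hM).1 f.2 v
  have hJ (x : LinearMap.range j) : j (J.symm x) = x := congrArg Subtype.val (J.apply_symm_apply x)
  let res (f : (projMod n ρ).homDeg M d) : V →ₗ[ℂ] V' :=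
    J.symm.toLinearMap ∘ₗ ((f.1.restrictScalars ℂ) ∘ₗ ptmul ρ 1).codRestrict _ (hmem f)
  have hres (f v) : j (res f v) = f.1 (ptmul ρ 1 v) := hJ ⟨_, hmem f v⟩
  let Φ : (projMod n ρ).homDeg M d →ₗ[ℂ] ρ.IntertwiningMap σ :=
    { toFun := fun f => ⟨res f, fun w => LinearMap.ext fun v => hj (by
        change j (res f (ρ w v)) = j (σ w (res f v))
        rw [hσ, hres, hres, hom_ptmul_one_smul])⟩
      map_add' := fun f g => Representation.IntertwiningMap.ext (LinearMap.ext fun v => hj (by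
        change j (res (f + g) v) = j (res f v + res g v)
        rw [map_add, hres, hres, hres]
        rfl))
      map_smul' := fun c f => Representation.IntertwiningMap.ext (LinearMap.ext fun v => hj (by
        change j (res (c • f) v) = j (c • res f v)
        rw [map_smul, hres, hres]
        rfl)) }
  refine (LinearEquiv.ofBijective Φ ⟨fun f g hfg => ?_, fun φ => ?_⟩).length_eq
  · refine Subtype.ext (projMod_hom_ext fun v => ?_)
    rw [← hres, ← hres]
    exact congrArg j (congrArg (fun ψ : ρ.IntertwiningMap σ => ψ v) hfg)
  · obtain ⟨f, hf⟩ := exists_projMod_hom (ρ := ρ) (j ∘ₗ φ.toLinearMap) fun w v => by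
      change j (φ (ρ w v)) = _
      rw [φ.isIntertwining, hσ]
      rfl
    refine ⟨⟨f, (mem_homDeg_projMod_of_smul_mem hM).2 fun v => ?_⟩,
      Representation.IntertwiningMap.ext (LinearMap.ext fun v => hj ?_)⟩
    · rw [hf, ← hr]
      exact ⟨_, rfl⟩
    · exact (hres _ v).trans (hf v)

end Skew

/-! ### Characters -/

section Character

set_option linter.unusedSectionVars false

variable {W : Type} [Group W] [Finite W] {V V' : Type} [AddCommGroup V] [Module ℂ V]
  [FiniteDimensional ℂ V] [AddCommGroup V'] [Module ℂ V'] [FiniteDimensional ℂ V']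
  (ρ : Representation ℂ W V) (σ : Representation ℂ W V')

instance finite_intertwiningMap : Module.Finite ℂ (ρ.IntertwiningMap σ) :=
  Module.Finite.equiv (Representation.invariantsEquivIntertwiningMap ρ σ)

/-- Irreducible characters are orthonormal, hence linearly independent in the finite dimensional
space of functions on `W`. -/
theorem finite_Irr (W : Type) [Group W] [Finite W] : Finite (Irr W) := by
  classical
  have := Fintype.ofFinite W
  have hW : (Nat.card W : ℂ) ≠ 0 := by exact_mod_cast Nat.card_pos.ne'
  have : Invertible (Nat.card W : ℂ) := invertibleOfNonzero hW
  have hortho (lam mu : Irr W) : (Nat.card W : ℂ)⁻¹ *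
      ∑ w : W, lam.rep.ρ.character w * mu.rep.ρ.character w⁻¹ = if lam = mu then 1 else 0 := by
    have := lam.rep.irreducible
    have := mu.rep.irreducible
    rw [Representation.char_orthonormal]
    refine if_congr ⟨fun h => (Irr.eq_of_equiv h).symm, fun h => ?_⟩ rfl rfl
    subst h
    exact ⟨.refl _⟩
  have hli : LinearIndependent ℂ fun lam : Irr W => lam.rep.ρ.character := by
    rw [linearIndependent_iff']
    intro s g hg mu hmu
    have h0 : ∑ lam ∈ s, g lam * ((Nat.card W : ℂ)⁻¹ *
        ∑ w : W, lam.rep.ρ.character w * mu.rep.ρ.character w⁻¹) = 0 := by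
      have hgw (w : W) : ∑ lam ∈ s, g lam * lam.rep.ρ.character w = 0 := by
        have := congrFun hg w
        rwa [Finset.sum_apply] at this
      calc _ = (Nat.card W : ℂ)⁻¹ * ∑ w : W, (∑ lam ∈ s, g lam * lam.rep.ρ.character w) *
            mu.rep.ρ.character w⁻¹ := by
            simp only [Finset.mul_sum, Finset.sum_mul]
            rw [Finset.sum_comm]
            refine Finset.sum_congr rfl fun _ _ => Finset.sum_congr rfl fun _ _ => by ring
        _ = 0 := by simp [hgw]
    simp only [hortho, mul_ite, mul_one, mul_zero, Finset.sum_ite_eq', hmu, if_true] at h0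
    exact h0
  exact hli.finite

theorem AllSelfDual.char_inv (hdual : AllSelfDual W) (w : W) :
    ρ.character w⁻¹ = ρ.character w := by
  obtain ⟨e⟩ := hdual V ρ
  rw [← Representation.char_dual, ← Representation.char_iso e]

theorem length_intertwiningMap :
    Module.length ℂ (ρ.IntertwiningMap σ) = Module.finrank ℂ (ρ.IntertwiningMap σ) :=
  Module.length_eq_finrank ℂ _

/-- Both dimensions are averages of products of characters, and self-duality identifies `χ(w⁻¹)`
with `χ(w)`. -/
theorem AllSelfDual.length_intertwiningMap_dual (hdual : AllSelfDual W) :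
    Module.length ℂ (ρ.IntertwiningMap σ.dual) = Module.length ℂ (ρ.IntertwiningMap σ) := by
  have := Fintype.ofFinite W
  have : Invertible (Nat.card W : ℂ) :=
    invertibleOfNonzero (by exact_mod_cast Nat.card_pos.ne')
  rw [length_intertwiningMap, length_intertwiningMap]
  congr 1
  rw [← Nat.cast_inj (R := ℂ), ← Representation.card_inv_mul_sum_char_mul_char_eq_finrank,
    ← Representation.card_inv_mul_sum_char_mul_char_eq_finrank]
  simp only [Representation.char_dual, hdual.char_inv]

/-- Once inverses can be dropped, both dimensions are the average over `W` of the product of the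
three characters. -/
theorem AllSelfDual.length_intertwiningMap_tprod_comm (hdual : AllSelfDual W) {V'' : Type}
    [AddCommGroup V''] [Module ℂ V''] [FiniteDimensional ℂ V''] (τ : Representation ℂ W V'') :
    Module.length ℂ (ρ.IntertwiningMap (τ.tprod σ)) =
      Module.length ℂ (σ.IntertwiningMap (τ.tprod ρ)) := by
  have := Fintype.ofFinite W
  have : Invertible (Nat.card W : ℂ) :=
    invertibleOfNonzero (by exact_mod_cast Nat.card_pos.ne')
  rw [length_intertwiningMap, length_intertwiningMap]
  congr 1
  rw [← Nat.cast_inj (R := ℂ), ← Representation.card_inv_mul_sum_char_mul_char_eq_finrank,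
    ← Representation.card_inv_mul_sum_char_mul_char_eq_finrank]
  simp only [Representation.char_tensor, Pi.mul_apply, hdual.char_inv]
  congr 1
  exact Finset.sum_congr rfl fun w _ => by ring

end Character

/-! ### Self-duality for homomorphisms between projectives and into duals -/

section Skew

set_option linter.unusedSectionVars false

variable {n : ℕ} {W : Type} [Group W] [MulSemiringAction W (PolyRing n)]
  [SMulCommClass W ℂ (PolyRing n)] [GradedAction n W]

variable (n W) in
/-- `S_i` as a representation of `W`. -/
def polyRep (i : ℤ) : Representation ℂ W (polyDeg n i) where
  toFun w := (Representation.ofDistribMulAction ℂ W (PolyRing n) w).restrict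
    fun _ hs => smul_mem_polyDeg w hs
  map_one' := LinearMap.ext fun s => Subtype.ext (one_smul W (s : PolyRing n))
  map_mul' w v := LinearMap.ext fun s => Subtype.ext (mul_smul w v (s : PolyRing n))

theorem length_homDeg_projMod_projMod {V V' S : Type} [AddCommGroup V] [Module ℂ V]
    [AddCommGroup V'] [Module ℂ V'] [AddCommGroup S] [Module ℂ S] (ρ : Representation ℂ W V)
    (σ : Representation ℂ W V') (τ : Representation ℂ W S) {d : ℤ} (e : S ≃ₗ[ℂ] polyDeg n d)
    (he : ∀ w s, (e (τ w s) : PolyRing n) = w • (e s : PolyRing n)) :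
    Module.length ℂ ((projMod n ρ).homDeg (projMod n σ) d) =
      Module.length ℂ (ρ.IntertwiningMap (τ.tprod σ)) := by
  let j : S ⊗[ℂ] V' →ₗ[ℂ] projMod n σ :=
    (polyDeg n d).subtype.rTensor V' ∘ₗ (e.rTensor V').toLinearMap
  refine length_homDeg_projMod ρ (τ.tprod σ) (isGraded_projMod σ).smul_mem
    j ?_ ?_ fun w v => ?_
  · exact (Module.Flat.rTensor_preserves_injective_linearMap (M := V') (polyDeg n d).subtype
      (polyDeg n d).subtype_injective).comp (e.rTensor V').injective
  · exact LinearMap.range_comp_of_range_eq_top _ (e.rTensor V').range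
  · induction v using TensorProduct.induction_on with
    | zero =>
      rw [map_zero, map_zero]; exact (smul_zero _).symm
    | add x y hx hy =>
      rw [map_add, map_add, map_add, hx, hy]
      exact (smul_add _ _ _).symm
    | tmul s v =>
      have := single_smul_ptmul σ w 1 (e s : PolyRing n) v
      rw [one_mul, ← he] at this
      exact this.symm

/-- Both spaces are spaces of intertwining maps, into `S_d ⊗ V'` and into `S_d ⊗ V`, so the symmetry
is one of characters. -/
theorem AllSelfDual.length_homDeg_projMod_comm [Finite W] (hdual : AllSelfDual W) {V V' : Type}
    [AddCommGroup V] [Module ℂ V] [FiniteDimensional ℂ V] [AddCommGroup V'] [Module ℂ V']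
    [FiniteDimensional ℂ V'] (ρ : Representation ℂ W V) (σ : Representation ℂ W V') (d : ℤ) :
    Module.length ℂ ((projMod n ρ).homDeg (projMod n σ) d) =
      Module.length ℂ ((projMod n σ).homDeg (projMod n ρ) d) := by
  rw [length_homDeg_projMod_projMod ρ σ (polyRep n W d) (LinearEquiv.refl ℂ _) fun _ _ => rfl,
    length_homDeg_projMod_projMod σ ρ (polyRep n W d) (LinearEquiv.refl ℂ _) fun _ _ => rfl]
  exact hdual.length_intertwiningMap_tprod_comm _ _ _

section Dual

variable {V : Type} [AddCommGroup V] [Module ℂ V] (ρ : Representation ℂ W V)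
  {M : GrMod (Skew n W)}

theorem length_homDeg_projMod_subRep (hM : M.IsGraded (skewDeg n W)) (d : ℤ) :
    Module.length ℂ ((projMod n ρ).homDeg M d) = Module.length ℂ (ρ.IntertwiningMap
      (subRep M (M.deg d) fun w _ hu => single_one_smul_mem_deg hM w hu)) :=
  length_homDeg_projMod ρ _ hM.smul_mem (M.deg d).subtype (M.deg d).subtype_injective
    (M.deg d).range_subtype fun _ _ => rfl

/-- `dual M` as functionals. -/
def dualEquiv (M : GrMod (Skew n W)) : Module.Dual ℂ M ≃ₗ[ℂ] dual M := LinearEquiv.refl _ _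

theorem single_smul_dualEquiv_apply (w : W) (s : PolyRing n) (f : Module.Dual ℂ M) (x : M) :
    (dualEquiv M).symm ((single w s : Skew n W) • dualEquiv M f) x =
      f ((single w⁻¹ (w⁻¹ • s) : Skew n W) • x) := by
  have h : dualAction M (single w s) =
      dualRight M (single (1 : W) s) * dualRight M (single w⁻¹ (1 : PolyRing n)) :=
    liftNC_single _ _ _ _
  rw [dualRight_mul, single_mul_single, one_mul, mul_one] at h
  exact LinearMap.congr_fun (LinearMap.congr_fun h f) x

theorem mem_dual_deg {i : ℤ} {f : dual M} :
    f ∈ (dual M).deg i ↔ ∀ j : ℤ, j ≠ -i → ∀ m ∈ M.deg j, (dualEquiv M).symm f m = 0 := Iff.rfl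

/-- The dual of an infinite dimensional module need not be the sum of its homogeneous parts; this
compatibility of the action is what counting homomorphisms from `P_V` requires. -/
theorem smul_mem_dual_deg (hM : M.IsGraded (skewDeg n W)) {i j : ℤ} {a : Skew n W} {f : dual M}
    (ha : a ∈ skewDeg n W i) (hf : f ∈ (dual M).deg j) : a • f ∈ (dual M).deg (i + j) := by
  refine skewDeg_eq_sum (p := fun a => a • f ∈ (dual M).deg (i + j)) ha ?_ ?_ fun w s hs => ?_
  · rw [zero_smul]; exact Submodule.zero_mem _
  · intro a b ha hb
    rw [add_smul]; exact Submodule.add_mem _ ha hb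
  · rw [mem_dual_deg]
    intro k hk m hm
    refine (single_smul_dualEquiv_apply w s ((dualEquiv M).symm f) m).trans ?_
    exact mem_dual_deg.1 hf (i + k) (by omega) _
      (hM.smul_mem (single_mem_skewDeg (smul_mem_polyDeg _ hs) _) hm)

/-- The degree `-d` part of `M^*` is the dual representation of `M_d`, embedded by transposing the
projection to degree `d`. Self-duality then removes the dual. -/
theorem AllSelfDual.length_homDeg_projMod_dual [Finite W] [FiniteDimensional ℂ V]
    (hdual : AllSelfDual W) (hM : M.IsLocFinite (skewDeg n W)) (d : ℤ) :
    Module.length ℂ ((projMod n ρ).homDeg (dual M) (-d)) =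
      Module.length ℂ ((projMod n ρ).homDeg M d) := by
  have := hM.finite d
  let σ := subRep M (M.deg d) fun w _ hu => single_one_smul_mem_deg hM.graded w hu
  let p : M →ₗ[ℂ] M.deg d := (M.proj d).codRestrict _ (hM.graded.proj_mem d)
  have hp (x : M.deg d) : p x = x := Subtype.ext (hM.graded.proj_of_mem x.2)
  have hp0 {i : ℤ} (hi : i ≠ d) {x : M} (hx : x ∈ M.deg i) : p x = 0 :=
    Subtype.ext (hM.graded.proj_of_ne hi hx)
  let j : Module.Dual ℂ (M.deg d) →ₗ[ℂ] dual M :=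
    (dualEquiv M).toLinearMap ∘ₗ Module.Dual.transpose (R := ℂ) p
  have hj (φ : Module.Dual ℂ (M.deg d)) (x : M) : (dualEquiv M).symm (j φ) x = φ (p x) := rfl
  have ext {f g : dual M} (h : ∀ x, (dualEquiv M).symm f x = (dualEquiv M).symm g x) : f = g :=
    (dualEquiv M).symm.injective (LinearMap.ext h)
  have hpw (w : W) (x : M) : p ((single w 1 : Skew n W) • x) = σ w (p x) := Subtype.ext (by
    have := hM.graded.proj_smul (single_mem_skewDeg one_mem_polyDeg w) d x
    rwa [sub_zero] at this)
  rw [length_homDeg_projMod_subRep ρ hM.graded]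
  refine (length_homDeg_projMod ρ σ.dual (smul_mem_dual_deg hM.graded) j ?_ ?_ ?_).trans
    (hdual.length_intertwiningMap_dual ρ σ)
  · intro φ ψ h
    refine LinearMap.ext fun x => ?_
    have := LinearMap.congr_fun (congrArg (dualEquiv M).symm h) x
    rwa [hj, hj, hp] at this
  · ext f
    constructor
    · rintro ⟨φ, rfl⟩
      rw [mem_dual_deg]
      intro i hi m hm
      rw [hj, hp0 (by simpa using hi) hm, map_zero]
    · intro hf
      rw [mem_dual_deg, neg_neg] at hf
      refine ⟨(dualEquiv M).symm f ∘ₗ (M.deg d).subtype, ext fun x => ?_⟩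
      rw [hj]
      refine hM.graded.homogeneous_induction (p := fun x => ((dualEquiv M).symm f)
        (p x) = (dualEquiv M).symm f x) x (fun i x hx => ?_) ?_ ?_
      · by_cases hi : i = d
        · subst hi
          rw [hp ⟨x, hx⟩]
        · rw [hp0 hi hx, hf i hi x hx]
          exact map_zero _
      · rw [map_zero]; rfl
      · intro x y hx hy
        rw [map_add, map_add, ← hx, ← hy]
        exact map_add _ _ _
  · intro w φ
    refine ext fun x => ?_
    refine Eq.trans ?_ (single_smul_dualEquiv_apply w 1 ((dualEquiv M).symm (j φ)) x).symm
    rw [hj, hj, smul_one, hpw]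
    rfl

end Dual

end Skew

section Skew

set_option linter.unusedSectionVars false

variable {n : ℕ} {W : Type} [Group W] [MulSemiringAction W (PolyRing n)]
  [SMulCommClass W ℂ (PolyRing n)] [GradedAction n W]

/-! ### Graded multiplicities -/

/-- The dimension of `Hom_A(P_μ, M)_d`. -/
def homDim (mu : Irr W) (M : GrMod (Skew n W)) (d : ℤ) : ℕ :=
  (Module.length ℂ ((P n mu).homDeg M d)).toNat

/-- The generating function of the dimensions of `Hom_A(P_μ, M)_d`, for `d ≥ 0`. -/
def homSeries (mu : Irr W) (M : GrMod (Skew n W)) : PowerSeries ℚ :=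
  PowerSeries.mk fun d => (homDim mu M d : ℚ)

variable [Finite W] {M : GrMod (Skew n W)}

/-- Local finiteness makes the length finite, so `toNat` loses nothing. -/
theorem coe_homDim (mu : Irr W) (hM : M.IsLocFinite (skewDeg n W)) (d : ℤ) :
    (homDim mu M d : ℕ∞) = Module.length ℂ ((P n mu).homDeg M d) := by
  refine ENat.natCast_toNat ?_
  have := hM.finite d
  have h : Module.length ℂ ((P n mu).homDeg M d) = _ :=
    length_homDeg_projMod_subRep mu.rep.ρ hM.graded d
  rw [h, length_intertwiningMap]
  exact ENat.natCast_ne_top _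

theorem homDim_ne_zero_iff {mu : Irr W} (hM : M.IsLocFinite (skewDeg n W)) {d : ℤ} :
    homDim mu M d ≠ 0 ↔ ∃ f ∈ (P n mu).homDeg M d, f ≠ 0 := by
  rw [← Nat.cast_ne_zero (R := ℕ∞), coe_homDim mu hM, ne_eq, Module.length_eq_zero_iff,
    Submodule.subsingleton_iff_eq_bot, ← ne_eq, Submodule.ne_bot_iff]

theorem homDim_of_neg {mu : Irr W} (hM : M.IsLocFinite (skewDeg n W)) {d : ℤ} (hd : d < 0) :
    homDim mu M d = 0 := by
  by_contra h
  obtain ⟨f, hf, hf0⟩ := (homDim_ne_zero_iff hM).1 h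
  refine hf0 (projMod_hom_ext fun v => ?_)
  have := (mem_homDeg_projMod hM.graded).1 hf v
  rw [hM.deg_of_neg d hd, Submodule.mem_bot] at this
  rw [this]; rfl

/-- Each coefficient of `Hom(P_μ, -)` is additive along the filtration by projectivity and vanishes
on late terms, so multiplicities compute it. The shift by `e` turns the sum into a product of power
series. -/
theorem homSeries_eq_sum [Fintype (Irr W)] {F : Irr W → GrMod (Skew n W)}
    {N : ℕ → Submodule (Skew n W) M} (h : M.IsFiltration F N) (hM : M.IsLocFinite (skewDeg n W))
    (hF : ∀ α, (F α).IsLocFinite (skewDeg n W)) {m : Irr W → ℕ → ℕ} (hm : h.IsMult m) (mu : Irr W) :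
    homSeries mu M = ∑ α, PowerSeries.mk (fun e => (m α e : ℚ)) * homSeries mu (F α) := by
  ext d
  have key := hm d (fun U => Module.length ℂ ((P n mu).homDeg (M.sub U) d))
    (fun α e => homDim mu (F α) (d - e)) (fun α e he => by
      rw [homDim_of_neg (hF α) (by omega), Nat.cast_zero]) (fun k α e π hπ => by
      rw [coe_homDim mu (hF α)]
      exact length_homDeg_right mu.rep.ρ hπ (hM.graded.sub (h.homogeneous k)) (hF α).graded d) (by
      obtain ⟨l, hl⟩ := hM.exists_eq_zero h.antitone h.separable d
      refine ⟨l, fun k hk => ?_⟩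
      rw [Module.length_eq_zero_iff, Submodule.subsingleton_iff_eq_bot, Submodule.eq_bot_iff]
      intro f hf
      refine projMod_hom_ext fun v => Subtype.ext (hl d le_rfl _ (h.antitone hk (f _).2) ?_)
      exact (mem_homDeg_projMod (hM.graded.sub (h.homogeneous k))).1 hf v)
  rw [length_homDeg_sub_top_right, ← coe_homDim mu hM] at key
  have key : homDim mu M d = ∑ α, ∑ e ∈ Finset.range (d + 1), m α e * homDim mu (F α) (d - e) := by
    exact_mod_cast key
  rw [_root_.map_sum, homSeries, PowerSeries.coeff_mk, key, Nat.cast_sum]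
  refine Finset.sum_congr rfl fun α _ => ?_
  rw [PowerSeries.coeff_mul, Finset.Nat.sum_antidiagonal_eq_sum_range_succ_mk, Nat.cast_sum]
  refine Finset.sum_congr rfl fun e he => ?_
  have he : e ≤ d := by simpa [Nat.lt_succ_iff] using he
  rw [PowerSeries.coeff_mk, homSeries, PowerSeries.coeff_mk, Nat.cast_mul, Nat.cast_sub he]

/-! ### Homomorphisms between projective and trace quotient modules -/

section TraceQuotient

variable {r : Irr W → Irr W → Prop} {nu mu : Irr W}

theorem homDim_quot_trace_self_ne_zero (r : Irr W → Irr W → Prop) (nu : Irr W) :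
    homDim nu ((P n nu).quot (trace n r nu)) 0 ≠ 0 := by
  rw [homDim_ne_zero_iff (isLocFinite_quot_trace r nu)]
  refine ⟨(trace n r nu).mkQ, fun i x hx => ⟨x, by rwa [add_zero], rfl⟩, fun h0 => ?_⟩
  obtain ⟨v, hv⟩ := exists_ptmul_notMem_trace (n := n) (r := r) nu
  exact hv ((Submodule.Quotient.mk_eq_zero _).1 (LinearMap.congr_fun h0 _))

theorem exists_deg_zero_ne_zero (r : Irr W → Irr W → Prop) (nu : Irr W) :
    ∃ x ∈ ((P n nu).quot (trace n r nu)).deg 0, x ≠ 0 := by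
  obtain ⟨v, hv⟩ := exists_ptmul_notMem_trace (n := n) (r := r) nu
  exact ⟨(trace n r nu).mkQ (ptmul nu.rep.ρ 1 v), ⟨_, ptmul_mem_deg _ one_mem_polyDeg v, rfl⟩,
    fun h0 => hv ((Submodule.Quotient.mk_eq_zero _).1 h0)⟩

/-- A degree `0` map sends generators into `1 ⊗ ν`, where the augmentation is injective, so its
composite with `P_ν → L_ν` is still nonzero. -/
theorem eq_of_hom_deg_zero {f : P n mu →ₗ[Skew n W] P n nu} (hf : f ∈ (P n mu).homDeg (P n nu) 0)
    (hf0 : f ≠ 0) : mu = nu := by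
  obtain ⟨ε, hε⟩ := exists_augmentation n nu.rep.ρ
  let ε' : P n nu →ₗ[Skew n W] L n nu := ε
  refine eq_of_P_hom_L (ε' ∘ₗ f) fun h0 => hf0 (projMod_hom_ext fun v => ?_)
  obtain ⟨u, hu⟩ := exists_ptmul_one_eq ((mem_homDeg_projMod (isGraded_P nu)).1 hf v)
  have hu0 : u = 0 := by
    refine (LinearEquiv.map_eq_zero_iff (simpleEquiv n nu.rep.ρ)).1 ((hε u).symm.trans ?_)
    rw [hu]
    exact LinearMap.congr_fun h0 (ptmul mu.rep.ρ 1 v)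
  rw [← hu, hu0]
  exact map_zero _

/-- The possible degrees of homomorphisms from `P_μ` to a trace quotient of `P_ν`. -/
theorem of_homDim_quot_trace_ne_zero {d : ℤ}
    (h : homDim mu ((P n nu).quot (trace n r nu)) d ≠ 0) :
    d = 0 ∧ mu = nu ∨ 0 < d ∧ ¬ r nu mu := by
  have hd : 0 ≤ d := by
    by_contra hd
    exact h (homDim_of_neg (isLocFinite_quot_trace r nu) (not_le.1 hd))
  obtain ⟨f, hf, hf0⟩ := (homDim_ne_zero_iff (isLocFinite_quot_trace r nu)).1 h
  let q : P n nu →ₗ[Skew n W] (P n nu).quot (trace n r nu) := (trace n r nu).mkQ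
  obtain ⟨g, hg, hgd⟩ := exists_projMod_lift q f ((P n nu).deg d)
    (fun w u hu => single_one_smul_mem_deg (isGraded_P nu) w hu)
    (fun v => (mem_homDeg_projMod (isLocFinite_quot_trace r nu).graded).1 hf v)
  have hgd := (mem_homDeg_projMod (isGraded_P nu)).2 hgd
  rcases hd.eq_or_lt with rfl | hd
  · refine .inl ⟨rfl, eq_of_hom_deg_zero hgd fun h0 => hf0 ?_⟩
    rw [← hg, h0]
    exact q.comp_zero
  · refine .inr ⟨hd, fun hr => hf0 ?_⟩
    rw [← hg]
    exact LinearMap.ext fun x => (Submodule.Quotient.mk_eq_zero _).2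
      (range_le_trace hr hd hgd ⟨x, rfl⟩)

end TraceQuotient

/-! ### Reciprocity -/

section Reciprocity

variable {le : Irr W → Irr W → Prop}

/-- `(M^*)_i` pairs with `M_{-i}`, which is zero for `i > 0`. -/
theorem dual_deg_of_pos (hM : M.IsLocFinite (skewDeg n W)) {i : ℤ} (hi : 0 < i) {f : dual M}
    (hf : f ∈ (dual M).deg i) : f = 0 := by
  refine (dualEquiv M).symm.injective (LinearMap.ext fun x => ?_)
  refine hM.graded.homogeneous_induction (p := fun x => (dualEquiv M).symm f x = 0) x
    (fun j x hx => ?_) (map_zero _) fun x y hx hy => by rw [map_add, hx, hy, add_zero]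
  by_cases hj : j = -i
  · rw [hM.deg_of_neg j (by omega), Submodule.mem_bot] at hx
    rw [hx]
    exact map_zero _
  · exact hf j hj x hx

/-- Reciprocity: the multiplicity `(P_λ : K̃_ν⟨d⟩)` is the dimension of `Hom_A(P_λ, K_ν)_d`. -/
theorem BHRConditions.mult_eq_homDim [Fintype (Irr W)] (hdual : AllSelfDual W)
    (h : BHRConditions n le) {lam : Irr W} {N : ℕ → Submodule (Skew n W) (P n lam)}
    (hN : (P n lam).IsFiltration (Ktilde n le) N) {m : Irr W → ℕ → ℕ} (hm : hN.IsMult m)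
    (nu : Irr W) (d : ℕ) : m nu d = homDim lam (K n le nu) d := by
  classical
  -- Orthogonality for `Ext^0`: among all `K̃_α⟨e⟩`, only `K̃_ν⟨d⟩` has a nonzero map to `K_ν^*` in
  -- degree `-d`, and that space is one dimensional.
  have hlen (α : Irr W) (e : ℕ) :
      Module.length ℂ ((Ktilde n le α).homDeg (dual (K n le nu)) (-d + e)) =
        if α = nu ∧ e = d then 1 else 0 := by
    rw [← length_gext_zero isGraded_regular one_mem_skewDeg (isLocFinite_Ktilde le α).graded]
    split_ifs with hc
    · obtain ⟨rfl, rfl⟩ := hc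
      obtain ⟨E⟩ := h.ext_self α
      rw [neg_add_cancel, E.length_eq]
      simp
    · rw [Module.length_eq_zero_iff]
      exact h.ext_eq_zero α nu 0 _ fun h' => hc ⟨h'.2.2, by omega⟩
  -- The function `Hom(-, K_ν^*)_{-d}` is additive on the filtration because `Ext^1` vanishes. Late
  -- terms live in degrees above `d`, which it sends to positive degrees of `K_ν^*`, that is, to
  -- zero.
  have key := hm d (fun U => Module.length ℂ (((P n lam).sub U).homDeg (dual (K n le nu)) (-d)))
    (fun α e => if α = nu ∧ e = d then 1 else 0) (fun α e he => if_neg (by omega))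
    (fun k α e π hπ => by
      have := hπ.length_homDeg_left (N := dual (K n le nu)) (d := -d) isGraded_regular
        one_mem_skewDeg ((isGraded_P lam).sub (hN.homogeneous k)) (isLocFinite_Ktilde le α).graded
        (h.ext_eq_zero α nu 1 _ fun h' => one_ne_zero h'.1)
      rw [hlen, add_comm] at this
      exact this) (by
      obtain ⟨l, hl⟩ := (isLocFinite_P (n := n) lam).exists_eq_zero hN.antitone hN.separable d
      refine ⟨l, fun k hk => ?_⟩
      rw [Module.length_eq_zero_iff, Submodule.subsingleton_iff_eq_bot, Submodule.eq_bot_iff]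
      intro f hf
      refine LinearMap.ext fun x => ?_
      refine ((isGraded_P lam).sub (hN.homogeneous k)).homogeneous_induction
        (p := fun x => f x = 0) x (fun i x hx => ?_) (map_zero _)
        fun x y hx hy => by rw [map_add, hx, hy, add_zero]
      rcases le_or_gt i d with hi | hi
      · have : x = 0 := Subtype.ext (hl i hi _ (hN.antitone hk x.2) hx)
        rw [this, map_zero]
      · exact dual_deg_of_pos (isLocFinite_K le nu) (by omega) (hf i x hx))
  rw [length_homDeg_sub_top_left] at key
  have h1 : Module.length ℂ ((P n lam).homDeg (dual (K n le nu)) (-d)) = _ :=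
    hdual.length_homDeg_projMod_dual lam.rep.ρ (isLocFinite_K le nu) d
  have h2 : (homDim lam (K n le nu) d : ℕ∞) = _ := coe_homDim lam (isLocFinite_K le nu) d
  have h3 : (homDim lam (K n le nu) d : ℕ∞) = m nu d := by
    refine h2.trans (h1.symm.trans (key.trans ?_))
    rw [Finset.sum_eq_single nu, Finset.sum_eq_single d]
    · simp
    · intro e _ he; simp [he]
    · intro hd; simp at hd
    · intro α _ hα; simp [hα]
    · simp
  exact_mod_cast h3.symm

/-- The multiplicity `(K̃_λ : K_μ⟨d⟩)` is symmetric in `λ` and `μ`. -/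
theorem BHRConditions.mult_symm [Fintype (Irr W)] (hdual : AllSelfDual W)
    (h : BHRConditions n le) {N : ∀ lam : Irr W, ℕ → Submodule (Skew n W) (Ktilde n le lam)}
    (hN : ∀ lam, (Ktilde n le lam).IsFiltration (K n le) (N lam)) {m : Irr W → Irr W → ℕ → ℕ}
    (hm : ∀ lam, (hN lam).IsMult (m lam)) (lam mu : Irr W) (d : ℕ) :
    m lam mu d = m mu lam d := by
  classical
  let Ω : Matrix (Irr W) (Irr W) (PowerSeries ℚ) :=
    fun lam mu => PowerSeries.mk fun e => (m lam mu e : ℚ)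
  let k : Matrix (Irr W) (Irr W) (PowerSeries ℚ) := fun nu mu => homSeries mu (K n le nu)
  let C : Matrix (Irr W) (Irr W) (PowerSeries ℚ) := fun lam mu => homSeries mu (P n lam)
  -- Filter `P_λ` by the `K̃_ν` and these by the `K_κ`; reciprocity identifies the first
  -- multiplicities with the entries of `k` transposed.
  have hC : C = k.transpose * (Ω * k) := by
    ext1 lam mu
    obtain ⟨N', hN'⟩ := h.filtered_P lam
    obtain ⟨m', -, hm'⟩ := hN'.exists_isMult (isLocFinite_P lam)
      fun α => exists_deg_zero_ne_zero _ α
    refine (homSeries_eq_sum hN' (isLocFinite_P lam)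
      (fun α => isLocFinite_Ktilde le α) hm' mu).trans ?_
    rw [Matrix.mul_apply]
    refine Finset.sum_congr rfl fun nu _ => congrArg₂ (· * ·) ?_ ?_
    · exact PowerSeries.ext fun d => by
        rw [PowerSeries.coeff_mk, h.mult_eq_homDim hdual hN' hm']
        exact (PowerSeries.coeff_mk (R := ℚ) d fun d => (homDim lam (K n le nu) d : ℚ)).symm
    · exact homSeries_eq_sum (hN nu) (isLocFinite_Ktilde le nu)
        (fun α => isLocFinite_K le α) (hm nu) mu
  have hCs : C.transpose = C := by
    refine Matrix.ext fun lam mu => PowerSeries.ext fun d => ?_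
    change PowerSeries.coeff d (homSeries lam (P n mu)) = PowerSeries.coeff d (homSeries mu (P n lam))
    rw [homSeries, homSeries, PowerSeries.coeff_mk, PowerSeries.coeff_mk]
    have : Module.length ℂ ((P n lam).homDeg (P n mu) d) = _ :=
      hdual.length_homDeg_projMod_comm lam.rep.ρ mu.rep.ρ d
    rw [homDim, this]
    rfl
  -- In degree `0` only `P_ν` maps to `K_ν`, so the constant term of `k` is diagonal with nonzero
  -- entries, which are units in `ℚ`.
  have hk : IsUnit k := by
    rw [Matrix.isUnit_iff_isUnit_det, PowerSeries.isUnit_iff_constantCoeff, RingHom.map_det]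
    have : (PowerSeries.constantCoeff (R := ℚ)).mapMatrix k =
        Matrix.diagonal fun nu => (homDim nu (K n le nu) 0 : ℚ) := by
      ext nu mu
      have h0 : PowerSeries.constantCoeff (homSeries mu (K n le nu)) =
          (homDim mu (K n le nu) 0 : ℚ) := by
        rw [← PowerSeries.coeff_zero_eq_constantCoeff_apply, homSeries, PowerSeries.coeff_mk]
        rfl
      refine h0.trans ?_
      rcases eq_or_ne nu mu with rfl | hne
      · rw [Matrix.diagonal_apply_eq]
      · rw [Matrix.diagonal_apply_ne _ hne, Nat.cast_eq_zero]
        by_contra hd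
        rcases of_homDim_quot_trace_ne_zero hd with h' | h'
        · exact hne h'.2.symm
        · exact h'.1.false
    rw [this, Matrix.det_diagonal, isUnit_iff_ne_zero, Finset.prod_ne_zero_iff]
    intro nu _
    rw [Nat.cast_ne_zero]
    exact homDim_quot_trace_self_ne_zero le nu
  -- Transpose the factorization of the symmetric matrix `C` and cancel the units `kᵀ` and `k`.
  have hΩ : Ω.transpose = Ω := by
    have h1 : k.transpose * (Ω.transpose * k) = k.transpose * (Ω * k) := by
      rw [← hC, ← hCs, hC, Matrix.transpose_mul, Matrix.transpose_mul, Matrix.transpose_transpose,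
        Matrix.mul_assoc]
    have hkt : IsUnit k.transpose := by
      rw [Matrix.isUnit_iff_isUnit_det, Matrix.det_transpose]
      exact (Matrix.isUnit_iff_isUnit_det k).1 hk
    exact hk.mul_right_cancel (hkt.mul_left_cancel h1)
  have := congrArg (PowerSeries.coeff d) (congrFun (congrFun hΩ mu) lam)
  have h2 : PowerSeries.coeff d (Ω lam mu) = PowerSeries.coeff d (Ω mu lam) := this
  rw [PowerSeries.coeff_mk, PowerSeries.coeff_mk] at h2
  exact_mod_cast h2

end Reciprocity

end Skew

/-! ### The two equalities of traces -/

section Skew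

set_option linter.unusedSectionVars false

variable {n : ℕ} {W : Type} [Group W] [MulSemiringAction W (PolyRing n)]
  [SMulCommClass W ℂ (PolyRing n)] [GradedAction n W] [Finite W] {le : Irr W → Irr W → Prop}

theorem I_eq_trace_leK (hrefl : ∀ x, le x x) (htrans : ∀ x y z, le x y → le y z → le x z)
    (lam : Irr W) : I n le lam = trace n (leK n le) lam :=
  le_antisymm (I_le_trace_leK le lam) (trace_mono fun _ => le_of_leK hrefl htrans)

/-- The only generators at issue come from `μ` equivalent to `λ` for `≾` but strictly above it for
`≾_K`. One that is nonzero in `K̃_λ` would force `K_μ` to be a factor of `K̃_λ`; by symmetry of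
multiplicities `K_λ` would be a factor of `K̃_μ`, making `μ ≾_K λ`. -/
theorem BHRConditions.trace_leK_le_Itilde (hdual : AllSelfDual W) (hrefl : ∀ x, le x x)
    (htrans : ∀ x y z, le x y → le y z → le x z) (h : BHRConditions n le) (lam : Irr W) :
    trace n (strict (leK n le)) lam ≤ Itilde n le lam := by
  have := finite_Irr W
  have := Fintype.ofFinite (Irr W)
  choose N hN using h.filtered_Ktilde
  choose m hfac hm using fun lam => (hN lam).exists_isMult (isLocFinite_Ktilde le lam)
    fun α => exists_deg_zero_ne_zero le α
  have hdim (lam mu : Irr W) (d : ℕ) : homDim mu (Ktilde n le lam) d =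
      ∑ κ, ∑ p ∈ Finset.HasAntidiagonal.antidiagonal d, m lam κ p.1 * homDim mu (K n le κ) p.2 := by
    have := congrArg (PowerSeries.coeff d) (homSeries_eq_sum (hN lam) (isLocFinite_Ktilde le lam)
      (fun α => isLocFinite_K le α) (hm lam) mu)
    simp only [homSeries, _root_.map_sum, PowerSeries.coeff_mul, PowerSeries.coeff_mk] at this
    exact_mod_cast this
  have hleK {lam κ : Irr W} {e : ℕ} (hκ : m lam κ e ≠ 0) : leK n le lam κ := by
    obtain ⟨k, π, hπ⟩ := hfac lam κ e hκ
    exact leK_of_factor (hN lam) k hπ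
  rw [trace_le_iff]
  intro mu hmu d hd f hf
  lift d to ℕ using hd.le
  have hle := le_of_leK hrefl htrans hmu.1
  -- If `λ ≺ μ`, the map is one of those generating `Ĩ_λ`; the remaining case is `λ ∼ μ`.
  by_cases hle' : le mu lam
  swap
  · exact range_le_trace ⟨hle, fun h' => hle' h'.2⟩ hd hf
  by_contra hfI
  have h0 : homDim mu (Ktilde n le lam) d ≠ 0 := by
    rw [homDim_ne_zero_iff (isLocFinite_Ktilde le lam)]
    refine ⟨(Itilde n le lam).mkQ ∘ₗ f, fun i x hx => ⟨f x, hf i x hx, rfl⟩, fun h0 => hfI ?_⟩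
    rintro _ ⟨x, rfl⟩
    exact (Submodule.Quotient.mk_eq_zero _).1 (LinearMap.congr_fun h0 x)
  -- A nonzero map to `K̃_λ` in degree `d` is accounted for by a factor `K_κ⟨e⟩` with a nonzero map
  -- `P_μ → K_κ` in degree `c`, where `e + c = d`.
  rw [hdim] at h0
  obtain ⟨κ, -, h0⟩ := Finset.exists_ne_zero_of_sum_ne_zero h0
  obtain ⟨⟨e, c⟩, hec, h0⟩ := Finset.exists_ne_zero_of_sum_ne_zero h0
  rw [Finset.HasAntidiagonal.mem_antidiagonal] at hec
  obtain ⟨hκ, hc⟩ := mul_ne_zero_iff.1 h0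
  -- The factor `K_κ⟨e⟩` also yields a nonzero map `P_κ → K̃_λ`, so `κ` is `λ` or is not strictly
  -- above `λ`. Since `λ ≾ κ` for every factor, this gives `κ ≾ λ ≾ μ`.
  have hκmu : le κ mu := by
    have h1 : homDim κ (Ktilde n le lam) e ≠ 0 := by
      rw [hdim]
      refine (Nat.pos_of_ne_zero ?_).ne'
      rw [ne_eq, Finset.sum_eq_zero_iff]
      intro h1
      have := (Finset.sum_eq_zero_iff.1 (h1 κ (Finset.mem_univ _))) (e, 0) (by simp)
      exact mul_ne_zero hκ (homDim_quot_trace_self_ne_zero le κ) this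
    rcases of_homDim_quot_trace_ne_zero h1 with ⟨-, rfl⟩ | ⟨-, hs⟩
    · exact hle
    · have hlamκ := le_of_leK hrefl htrans (hleK hκ)
      by_cases hκlam : le κ lam
      · exact htrans _ _ _ hκlam hle
      · exact absurd ⟨hlamκ, fun h' => hκlam h'.2⟩ hs
  -- As `κ ≾ μ`, a map `P_μ → K_κ` of positive degree is zero, which leaves `c = 0` and `κ = μ`;
  -- symmetry of the multiplicities then applies.
  rcases of_homDim_quot_trace_ne_zero hc with ⟨-, rfl⟩ | ⟨-, hs⟩
  · rw [h.mult_symm hdual hN hm] at hκ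
    exact hmu.2 ⟨hmu.1, hleK hκ⟩
  · exact hs hκmu

theorem BHRConditions.Itilde_eq_trace_leK (hdual : AllSelfDual W) (hrefl : ∀ x, le x x)
    (htrans : ∀ x y z, le x y → le y z → le x z) (h : BHRConditions n le) (lam : Irr W) :
    Itilde n le lam = trace n (strict (leK n le)) lam := by
  obtain ⟨N, hN⟩ := h.filtered_Ktilde lam
  exact le_antisymm (Itilde_le_trace_leK hrefl htrans hN)
    (h.trace_leK_le_Itilde hdual hrefl htrans lam)

end Skew

end SkewTrace

end

theorem mainTheorem4 (n : ℕ) {W : Type} [Group W] [Finite W]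
    [MulSemiringAction W (PolyRing n)] [SMulCommClass W ℂ (PolyRing n)] [GradedAction n W]
    (hdual : AllSelfDual W) (hfin : FiniteDimensional ℂ (PolyRing n ⧸ invariantIdeal n W))
    (le : Irr W → Irr W → Prop) (hrefl : ∀ x, le x x)
    (htrans : ∀ x y z, le x y → le y z → le x z)
    (h : BHRConditions n le) :
    (∀ lam : Irr W, I n le lam = trace n (leK n le) lam ∧
      Itilde n le lam = trace n (strict (leK n le)) lam) ∧
    K n (leK n le) = K n le ∧ Ktilde n (leK n le) = Ktilde n le := by
  have hI := I_eq_trace_leK (n := n) hrefl htrans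
  have hIt := h.Itilde_eq_trace_leK hdual hrefl htrans
  exact ⟨fun lam => ⟨hI lam, hIt lam⟩,
    funext fun lam => congrArg (P n lam).quot (hI lam).symm,
    funext fun lam => congrArg (P n lam).quot (hIt lam).symm⟩
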